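/- **Conventions.** A Temperley-Lieb diagram on $2n$ points is a plane diagram in a strip, with $n$ endpoints on each of the two boundary lines, no crossings, closed circles allowed. $\mathrm{Cob}(n)$ is Bar-Natan's category: its objects are formally $q$-graded diagrams $q^iA$; its morphisms are $\mathbb Z[\alpha]$-linear combinations of dotted orientable cobordisms rel boundary up to isotopy, modulo the local relations (sphere) $=0$, (sphere with one dot) $=1$, (sphere with two dots) $=0$, (sphere with three dots) $=\alpha$, and neck cutting (a cylinder equals the sum of the two ways of cutting it into two disks and putting one dot on one of them). The degree of a cobordism $S\colon q^iA\to q^jB$ is $\chi(S)-n+j-i$, where each dot counts $-2$ and $\alpha$ has degree $-4$, and all morphisms are taken of degree $0$. $\mathrm{Kom}(n)$ consists of the complexes $\cdots\to P_k\to P_{k+1}\to\cdots$ ($k\in\mathbb Z$), bounded below, of finite formal direct sums of objects of $\mathrm{Cob}(n)$; $\simeq$ is chain homotopy equivalence. $\otimes$ is induced by stacking diagrams and gluing cobordisms (on complexes: the total complex), $1=1_n$ is the diagram of $n$ vertical strands, $e_i$ ($0<i<n$) is the diagram of the standard Temperley-Lieb generator, and $-\sqcup 1^{k}\colon \mathrm{Kom}(m)\to\mathrm{Kom}(m+k)$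 adds $k$ vertical strands on the right. A complex $P\in\mathrm{Kom}(n)$ is a *universal projector* if 1. $P_k=0$ for $k<0$, and for $k>0$ all summands $q^jA$ of $P_k$ have $j\ge 0$; 2. $P_0\cong 1$, and for $k>0$ there are no $j\in\mathbb Z$ and $D$ with $P_k\cong q^j1\oplus D$; 3. $P\otimes e_i\simeq 0$ and $e_i\otimes P\simeq 0$ for all $0<i<n$. **Proposition (composition of projectors).** Let $0\le m\le n$, and let $C\in\mathrm{Kom}(n)$ and $D\in\mathrm{Kom}(m)$ be universal projectors. Then $$C\otimes(D\sqcup 1^{n-m})\;\simeq\; C\;\simeq\;(D\sqcup 1^{n-m})\otimes C .$$ -/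

import Mathlib

open CategoryTheory CategoryTheory.Limits
open scoped ZeroObject
open scoped Polynomial

noncomputable section

namespace BarNatan

/-! ### Plane diagrams -/

/-- Temperley-Lieb diagrams with `n` endpoints on one horizontal line and `m` on the other, closed
circles allowed, in Morse position: words in elementary diagrams.
`cup n i` has `n` vertical strands and creates one arc in the `i`-th gap, so that the arc ends at
the points `i`, `i+1` of the second line; `cap n i` is its mirror image; `comp` is stacking. -/
inductive Diag : ℕ → ℕ → Type
  | id (n : ℕ) : Diag n n
  | cup (n : ℕ) (i : Fin (n + 1)) : Diag n (n + 2)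
  | cap (n : ℕ) (i : Fin (n + 1)) : Diag (n + 2) n
  | comp {n m l : ℕ} (a : Diag n m) (b : Diag m l) : Diag n l

/-- The result of adding one vertical strand on the right of a diagram. -/
def Diag.strand : {n m : ℕ} → Diag n m → Diag (n + 1) (m + 1)
  | _, _, .id n => .id (n + 1)
  | _, _, .cup n i => .cup (n + 1) i.castSucc
  | _, _, .cap n i => .cap (n + 1) i.castSucc
  | _, _, .comp a b => .comp a.strand b.strand

/-- The diagram of the standard generator `e_i` of the Temperley-Lieb algebra on `n` strands
(with `i` counted from `0`, so `i < n - 1`). -/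
def Diag.gen : (n : ℕ) → Fin (n - 1) → Diag n n
  | 0, i => i.elim0
  | 1, i => i.elim0
  | n + 2, i => .comp (.cap n i) (.cup n i)

/-- A combinatorial 1-manifold with endpoints: sample points, the endpoints on the two lines, and
a relation which says that two sample points are adjacent on the same component. The components
are the classes of the equivalence relation generated by `rel`. -/
structure Graph (n m : ℕ) where
  Pt : Type
  src : Fin n → Pt
  tgt : Fin m → Pt
  rel : Pt → Pt → Prop

/-- The relation on the disjoint union of two graphs that are stacked. -/
inductive Graph.CompRel {n m l : ℕ} (G : Graph n m) (H : Graph m l) :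
    G.Pt ⊕ H.Pt → G.Pt ⊕ H.Pt → Prop
  | left {a b : G.Pt} : G.rel a b → CompRel G H (.inl a) (.inl b)
  | right {a b : H.Pt} : H.rel a b → CompRel G H (.inr a) (.inr b)
  | glue (p : Fin m) : CompRel G H (.inl (G.tgt p)) (.inr (H.src p))

/-- Stacking of graphs. -/
def Graph.comp {n m l : ℕ} (G : Graph n m) (H : Graph m l) : Graph n l where
  Pt := G.Pt ⊕ H.Pt
  src p := .inl (G.src p)
  tgt p := .inr (H.tgt p)
  rel := G.CompRel H

/-- The order preserving map from `n` points to `n+2` points which skips the points `i`, `i+1`. -/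
def skipTwo {n : ℕ} (i : Fin (n + 1)) (p : Fin n) : Fin (n + 2) :=
  if p.1 < i.1 then ⟨p.1, by omega⟩ else ⟨p.1 + 2, by omega⟩

/-- The combinatorial 1-manifold underlying a diagram. -/
def Diag.graph : {n m : ℕ} → Diag n m → Graph n m
  | _, _, .id n => ⟨Fin n, fun p => p, fun p => p, fun _ _ => False⟩
  | _, _, .cup n i => ⟨Fin (n + 2), skipTwo i, fun p => p, fun a b => a.1 = i.1 ∧ b.1 = i.1 + 1⟩
  | _, _, .cap n i => ⟨Fin (n + 2), fun p => p, skipTwo i, fun a b => a.1 = i.1 ∧ b.1 = i.1 + 1⟩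
  | _, _, .comp a b => a.graph.comp b.graph

/-- The sample points of a diagram. Every component contains at least one. -/
abbrev Diag.Pt {n m : ℕ} (w : Diag n m) : Type := w.graph.Pt

/-- The sample points of a diagram, after a strand has been added on the right. -/
def Diag.ptStrand : {n m : ℕ} → (w : Diag n m) → w.Pt → w.strand.Pt
  | _, _, .id n => fun p => Fin.castSucc (n := n) p
  | _, _, .cup n _ => fun p => Fin.castSucc (n := n + 2) p
  | _, _, .cap n _ => fun p => Fin.castSucc (n := n + 2) p
  | _, _, .comp a b => Sum.map a.ptStrand b.ptStrand

/-! ### Cobordisms -/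

/-- The elementary planar isotopies of diagrams in Morse position. -/
inductive Move : {n m : ℕ} → Diag n m → Diag n m → Type
  | zigzag (n : ℕ) (i : Fin (n + 1)) :
      Move (.comp (.cup (n + 1) i.castSucc) (.cap (n + 1) i.succ)) (.id (n + 1))
  | zagzig (n : ℕ) (i : Fin (n + 1)) :
      Move (.comp (.cup (n + 1) i.succ) (.cap (n + 1) i.castSucc)) (.id (n + 1))
  | cupCup (n : ℕ) (i j : Fin (n + 1)) (h : i ≤ j) :
      Move (.comp (.cup n i) (.cup (n + 2) j.succ.succ))
        (.comp (.cup n j) (.cup (n + 2) i.castSucc.castSucc))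
  | capCap (n : ℕ) (i j : Fin (n + 1)) (h : i ≤ j) :
      Move (.comp (.cap (n + 2) j.succ.succ) (.cap n i))
        (.comp (.cap (n + 2) i.castSucc.castSucc) (.cap n j))
  | cupCap (n : ℕ) (i j : Fin (n + 1)) (h : i ≤ j) :
      Move (.comp (.cup (n + 2) i.castSucc.castSucc) (.cap (n + 2) j.succ.succ))
        (.comp (.cap n j) (.cup n i))
  | capCup (n : ℕ) (i j : Fin (n + 1)) (h : i ≤ j) :
      Move (.comp (.cup (n + 2) j.succ.succ) (.cap (n + 2) i.castSucc.castSucc))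
        (.comp (.cap n i) (.cup n j))

/-- Dotted cobordisms between diagrams with the same endpoints, built from elementary ones.
`comp` is composition of cobordisms, `hcomp` glues two cobordisms along the vertical intervals over
the common endpoints of the diagrams. -/
inductive Cb : {n m : ℕ} → Diag n m → Diag n m → Type
  /-- the identity cobordism -/
  | id {n m : ℕ} (w : Diag n m) : Cb w w
  | comp {n m : ℕ} {w w' w'' : Diag n m} (S : Cb w w') (T : Cb w' w'') : Cb w w''
  | hcomp {n m l : ℕ} {w w' : Diag n m} {v v' : Diag m l} (S : Cb w w') (T : Cb v v') :
      Cb (.comp w v) (.comp w' v')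
  /-- the identity cobordism with one dot, on the component of `x` -/
  | dot {n m : ℕ} (w : Diag n m) (x : w.Pt) : Cb w w
  /-- a disk that creates a circle in the `i`-th gap -/
  | birth (n : ℕ) (i : Fin (n + 1)) : Cb (.id n) (.comp (.cup n i) (.cap n i))
  | death (n : ℕ) (i : Fin (n + 1)) : Cb (.comp (.cup n i) (.cap n i)) (.id n)
  /-- the saddle from two adjacent vertical strands to a cap and a cup -/
  | saddle (n : ℕ) (i : Fin (n + 1)) : Cb (.id (n + 2)) (.comp (.cap n i) (.cup n i))
  | saddleInv (n : ℕ) (i : Fin (n + 1)) : Cb (.comp (.cap n i) (.cup n i)) (.id (n + 2))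
  /-- the traces of planar isotopies -/
  | move {n m : ℕ} {w w' : Diag n m} (μ : Move w w') : Cb w w'
  | moveInv {n m : ℕ} {w w' : Diag n m} (μ : Move w w') : Cb w' w
  /-- the traces of vertical rescalings, which identify different bracketings of a word -/
  | assoc {n m l k : ℕ} (a : Diag n m) (b : Diag m l) (c : Diag l k) :
      Cb (.comp (.comp a b) c) (.comp a (.comp b c))
  | assocInv {n m l k : ℕ} (a : Diag n m) (b : Diag m l) (c : Diag l k) :
      Cb (.comp a (.comp b c)) (.comp (.comp a b) c)
  | idComp {n m : ℕ} (a : Diag n m) : Cb (.comp (.id n) a) a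
  | idCompInv {n m : ℕ} (a : Diag n m) : Cb a (.comp (.id n) a)
  | compId {n m : ℕ} (a : Diag n m) : Cb (.comp a (.id m)) a
  | compIdInv {n m : ℕ} (a : Diag n m) : Cb a (.comp a (.id m))

/-- Adding a strand on the right of a planar isotopy. -/
def Move.strand : {n m : ℕ} → {w w' : Diag n m} → Move w w' → Move w.strand w'.strand
  | _, _, _, _, .zigzag n i => .zigzag (n + 1) i.castSucc
  | _, _, _, _, .zagzig n i => .zagzig (n + 1) i.castSucc
  | _, _, _, _, .cupCup n i j h => .cupCup (n + 1) i.castSucc j.castSucc h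
  | _, _, _, _, .capCap n i j h => .capCap (n + 1) i.castSucc j.castSucc h
  | _, _, _, _, .cupCap n i j h => .cupCap (n + 1) i.castSucc j.castSucc h
  | _, _, _, _, .capCup n i j h => .capCup (n + 1) i.castSucc j.castSucc h

/-- The disjoint union of a cobordism with a vertical disk on the right. -/
def Cb.strand : {n m : ℕ} → {w w' : Diag n m} → Cb w w' → Cb w.strand w'.strand
  | _, _, _, _, .id w => .id w.strand
  | _, _, _, _, .comp S T => .comp S.strand T.strand
  | _, _, _, _, .hcomp S T => .hcomp S.strand T.strand
  | _, _, _, _, .dot w x => .dot w.strand (w.ptStrand x)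
  | _, _, _, _, .birth n i => .birth (n + 1) i.castSucc
  | _, _, _, _, .death n i => .death (n + 1) i.castSucc
  | _, _, _, _, .saddle n i => .saddle (n + 1) i.castSucc
  | _, _, _, _, .saddleInv n i => .saddleInv (n + 1) i.castSucc
  | _, _, _, _, .move μ => .move μ.strand
  | _, _, _, _, .moveInv μ => .moveInv μ.strand
  | _, _, _, _, .assoc a b c => .assoc a.strand b.strand c.strand
  | _, _, _, _, .assocInv a b c => .assocInv a.strand b.strand c.strand
  | _, _, _, _, .idComp a => .idComp a.strand
  | _, _, _, _, .idCompInv a => .idCompInv a.strand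
  | _, _, _, _, .compId a => .compId a.strand
  | _, _, _, _, .compIdInv a => .compIdInv a.strand

/-- The topological degree `χ(S) - n` of a cobordism between diagrams with `2n` endpoints, where
every dot counts `-2`. Euler characteristic is counted by critical points. -/
def Cb.deg : {n m : ℕ} → {w w' : Diag n m} → Cb w w' → ℤ
  | _, _, _, _, .comp S T => S.deg + T.deg
  | _, _, _, _, .hcomp S T => S.deg + T.deg
  | _, _, _, _, .dot _ _ => -2
  | _, _, _, _, .birth _ _ => 1
  | _, _, _, _, .death _ _ => 1
  | _, _, _, _, .saddle _ _ => -1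
  | _, _, _, _, .saddleInv _ _ => -1
  | _, _, _, _, _ => 0

/-! ### The topological type of a cobordism -/

/-- A combinatorial surface between two diagrams: sample points, the inclusion of the sample points
of the two diagrams, a relation that generates the partition into components, the contributions
of the critical points to the Euler characteristic, and the dots. -/
structure Surf {n m : ℕ} (G G' : Graph n m) where
  Pt : Type
  src : G.Pt → Pt
  tgt : G'.Pt → Pt
  rel : Pt → Pt → Prop
  wt : Pt →₀ ℤ
  dots : Pt →₀ ℕ

namespace Surf

variable {n m l : ℕ}

/-- The cylinder over a diagram, with dots. -/
def cyl (G : Graph n m) (dots : G.Pt →₀ ℕ) : Surf G G :=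
  ⟨G.Pt, fun p => p, fun p => p, G.rel, 0, dots⟩

/-- The cylinder over an identification of sample points. -/
def trace (G G' : Graph n m) (Pt : Type) (src : G.Pt → Pt) (tgt : G'.Pt → Pt)
    (rel : Pt → Pt → Prop) : Surf G G' := ⟨Pt, src, tgt, rel, 0, 0⟩

/-- The relation generated by the components of two diagrams and by the vertical intervals over
their endpoints. -/
inductive WallRel (G G' : Graph n m) : G.Pt ⊕ G'.Pt → G.Pt ⊕ G'.Pt → Prop
  | left {a b : G.Pt} : G.rel a b → WallRel G G' (.inl a) (.inl b)
  | right {a b : G'.Pt} : G'.rel a b → WallRel G G' (.inr a) (.inr b)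
  | src (p : Fin n) : WallRel G G' (.inl (G.src p)) (.inr (G'.src p))
  | tgt (p : Fin m) : WallRel G G' (.inl (G.tgt p)) (.inr (G'.tgt p))

/-- The surface which has one component for every boundary circle or, more precisely, for every
component of the closed curve formed by the two diagrams and the vertical intervals over their
endpoints. -/
def wall (G G' : Graph n m) (wt : G.Pt ⊕ G'.Pt →₀ ℤ) : Surf G G' :=
  ⟨G.Pt ⊕ G'.Pt, .inl, .inr, WallRel G G', wt, 0⟩

/-- The relation on the composition of two surfaces. -/
inductive CompRel {G G' G'' : Graph n m} (S : Surf G G') (T : Surf G' G'') :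
    S.Pt ⊕ T.Pt → S.Pt ⊕ T.Pt → Prop
  | left {a b : S.Pt} : S.rel a b → CompRel S T (.inl a) (.inl b)
  | right {a b : T.Pt} : T.rel a b → CompRel S T (.inr a) (.inr b)
  | glue (p : G'.Pt) : CompRel S T (.inl (S.tgt p)) (.inr (T.src p))

/-- Composition of surfaces. -/
def comp {G G' G'' : Graph n m} (S : Surf G G') (T : Surf G' G'') : Surf G G'' where
  Pt := S.Pt ⊕ T.Pt
  src p := .inl (S.src p)
  tgt p := .inr (T.tgt p)
  rel := CompRel S T
  wt := S.wt.mapDomain .inl + T.wt.mapDomain .inr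
  dots := S.dots.mapDomain .inl + T.dots.mapDomain .inr

/-- The relation on two surfaces that are glued along vertical intervals. -/
inductive HcompRel {G G' : Graph n m} {H H' : Graph m l} (S : Surf G G') (T : Surf H H') :
    S.Pt ⊕ T.Pt → S.Pt ⊕ T.Pt → Prop
  | left {a b : S.Pt} : S.rel a b → HcompRel S T (.inl a) (.inl b)
  | right {a b : T.Pt} : T.rel a b → HcompRel S T (.inr a) (.inr b)
  | src (p : Fin m) : HcompRel S T (.inl (S.src (G.tgt p))) (.inr (T.src (H.src p)))
  | tgt (p : Fin m) : HcompRel S T (.inl (S.tgt (G'.tgt p))) (.inr (T.tgt (H'.src p)))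

/-- Gluing of surfaces along vertical intervals. -/
def hcomp {G G' : Graph n m} {H H' : Graph m l} (S : Surf G G') (T : Surf H H') :
    Surf (G.comp H) (G'.comp H') where
  Pt := S.Pt ⊕ T.Pt
  src := Sum.map S.src T.src
  tgt := Sum.map S.tgt T.tgt
  rel := HcompRel S T
  wt := S.wt.mapDomain .inl + T.wt.mapDomain .inr
  dots := S.dots.mapDomain .inl + T.dots.mapDomain .inr

/-- The set of components. -/
abbrev Comp {G G' : Graph n m} (S : Surf G G') : Type := Quot S.rel

/-- Two surfaces have the same topological type relative to the boundary: there is a bijection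
between the components which is compatible with the boundary, with the Euler characteristics and
with the numbers of dots. For orientable dotted surfaces this means that there is a homeomorphism
which is the identity on the boundary. -/
def SameType {G G' : Graph n m} (S T : Surf G G') : Prop :=
  ∃ e : S.Comp ≃ T.Comp,
    (∀ p, e (Quot.mk _ (S.src p)) = Quot.mk _ (T.src p)) ∧
    (∀ p, e (Quot.mk _ (S.tgt p)) = Quot.mk _ (T.tgt p)) ∧
    (∀ c, S.wt.mapDomain (Quot.mk S.rel) c = T.wt.mapDomain (Quot.mk T.rel) (e c)) ∧
    (∀ c, S.dots.mapDomain (Quot.mk S.rel) c = T.dots.mapDomain (Quot.mk T.rel) (e c))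

end Surf

/-- The combinatorial surface of a cobordism. -/
def Cb.surf : {n m : ℕ} → {w w' : Diag n m} → Cb w w' → Surf w.graph w'.graph
  | _, _, _, _, .id w => .cyl w.graph 0
  | _, _, _, _, .comp S T => S.surf.comp T.surf
  | _, _, _, _, .hcomp S T => S.surf.hcomp T.surf
  | _, _, _, _, .dot w x => .cyl w.graph (Finsupp.single x 1)
  | _, _, _, _, .birth n i =>
      .wall (Diag.id n).graph ((Diag.cup n i).comp (.cap n i)).graph
        (Finsupp.single (.inr (.inl (⟨i.1, by omega⟩ : Fin (n + 2)))) 1)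
  | _, _, _, _, .death n i =>
      .wall ((Diag.cup n i).comp (.cap n i)).graph (Diag.id n).graph
        (Finsupp.single (.inl (.inl (⟨i.1, by omega⟩ : Fin (n + 2)))) 1)
  | _, _, _, _, .saddle n i =>
      .wall (Diag.id (n + 2)).graph ((Diag.cap n i).comp (.cup n i)).graph
        (Finsupp.single (.inl (⟨i.1, by omega⟩ : Fin (n + 2))) (-1))
  | _, _, _, _, .saddleInv n i =>
      .wall ((Diag.cap n i).comp (.cup n i)).graph (Diag.id (n + 2)).graph
        (Finsupp.single (.inr (⟨i.1, by omega⟩ : Fin (n + 2))) (-1))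
  | _, _, w, w', .move _ => .wall w.graph w'.graph 0
  | _, _, w, w', .moveInv _ => .wall w.graph w'.graph 0
  | _, _, _, _, .assoc a b c =>
      .trace ((a.comp b).comp c).graph (a.comp (b.comp c)).graph ((a.Pt ⊕ b.Pt) ⊕ c.Pt)
        (fun p => p) (Equiv.sumAssoc _ _ _).symm ((a.comp b).comp c).graph.rel
  | _, _, _, _, .assocInv a b c =>
      .trace (a.comp (b.comp c)).graph ((a.comp b).comp c).graph ((a.Pt ⊕ b.Pt) ⊕ c.Pt)
        (Equiv.sumAssoc _ _ _).symm (fun p => p) ((a.comp b).comp c).graph.rel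
  | n, _, _, _, .idComp a =>
      .trace ((Diag.id n).comp a).graph a.graph ((Diag.id n).Pt ⊕ a.Pt)
        (fun p => p) .inr ((Diag.id n).comp a).graph.rel
  | n, _, _, _, .idCompInv a =>
      .trace a.graph ((Diag.id n).comp a).graph ((Diag.id n).Pt ⊕ a.Pt)
        .inr (fun p => p) ((Diag.id n).comp a).graph.rel
  | _, m, _, _, .compId a =>
      .trace (a.comp (Diag.id m)).graph a.graph (a.Pt ⊕ (Diag.id m).Pt)
        (fun p => p) .inl (a.comp (Diag.id m)).graph.rel
  | _, m, _, _, .compIdInv a =>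
      .trace a.graph (a.comp (Diag.id m)).graph (a.Pt ⊕ (Diag.id m).Pt)
        .inl (fun p => p) (a.comp (Diag.id m)).graph.rel

/-- Two cobordisms have the same topological type. -/
def Cb.SameType {n m : ℕ} {w w' : Diag n m} (S T : Cb w w') : Prop := S.surf.SameType T.surf

/-! ### Laws for topological types -/

namespace Surf

variable {n m l : ℕ}

theorem mapDomain_sum {A B C M : Type} [AddCommMonoid M] (f : A ⊕ B → C) (s : A →₀ M)
    (t : B →₀ M) : (s.mapDomain Sum.inl + t.mapDomain Sum.inr).mapDomain f =
      s.mapDomain (fun x => f (.inl x)) + t.mapDomain (fun x => f (.inr x)) := by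
  rw [Finsupp.mapDomain_add, ← Finsupp.mapDomain_comp, ← Finsupp.mapDomain_comp]; rfl

/-- A criterion for equality of topological types through maps on sample points. -/
theorem SameType.of_maps {G G' : Graph n m} {S T : Surf G G'} (f : S.Pt → T.Pt) (g : T.Pt → S.Pt)
    (hf : ∀ a b, S.rel a b → Quot.mk T.rel (f a) = Quot.mk T.rel (f b))
    (hg : ∀ a b, T.rel a b → Quot.mk S.rel (g a) = Quot.mk S.rel (g b))
    (hgf : ∀ a, Quot.mk S.rel (g (f a)) = Quot.mk S.rel a)
    (hfg : ∀ a, Quot.mk T.rel (f (g a)) = Quot.mk T.rel a)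
    (hsrc : ∀ p, Quot.mk T.rel (f (S.src p)) = Quot.mk T.rel (T.src p))
    (htgt : ∀ p, Quot.mk T.rel (f (S.tgt p)) = Quot.mk T.rel (T.tgt p))
    (hwt : (S.wt.mapDomain f).mapDomain (Quot.mk T.rel) = T.wt.mapDomain (Quot.mk T.rel))
    (hdots : (S.dots.mapDomain f).mapDomain (Quot.mk T.rel) = T.dots.mapDomain (Quot.mk T.rel)) :
    S.SameType T := by
  let e : S.Comp ≃ T.Comp :=
    { toFun := Quot.lift (fun a => Quot.mk T.rel (f a)) hf
      invFun := Quot.lift (fun a => Quot.mk S.rel (g a)) hg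
      left_inv := by rintro ⟨a⟩; exact hgf a
      right_inv := by rintro ⟨a⟩; exact hfg a }
  have key : ∀ {M : Type} [AddCommMonoid M] (s : S.Pt →₀ M) (c : S.Comp),
      s.mapDomain (Quot.mk S.rel) c = ((s.mapDomain f).mapDomain (Quot.mk T.rel)) (e c) := by
    intro M _ s c
    have h : (s.mapDomain f).mapDomain (Quot.mk T.rel) = (s.mapDomain (Quot.mk S.rel)).mapDomain e := by
      rw [← Finsupp.mapDomain_comp, ← Finsupp.mapDomain_comp]; rfl
    rw [h, Finsupp.mapDomain_apply e.injective]
  refine ⟨e, hsrc, htgt, fun c => ?_, fun c => ?_⟩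
  · rw [← hwt]; exact key _ c
  · rw [← hdots]; exact key _ c

end Surf

theorem Cb.src_tgt_rel {n m : ℕ} {w w' : Diag n m} (S : Cb w w') :
    (∀ a b, w.graph.rel a b →
      Quot.mk S.surf.rel (S.surf.src a) = Quot.mk S.surf.rel (S.surf.src b)) ∧
    (∀ a b, w'.graph.rel a b →
      Quot.mk S.surf.rel (S.surf.tgt a) = Quot.mk S.surf.rel (S.surf.tgt b)) := by
  induction S with
  | id w => exact ⟨fun a b h => Quot.sound h, fun a b h => Quot.sound h⟩
  | dot w x => exact ⟨fun a b h => Quot.sound h, fun a b h => Quot.sound h⟩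
  | comp S T hS hT =>
    refine ⟨fun a b h => ?_, fun a b h => ?_⟩
    · exact congrArg (Quot.lift (fun x => Quot.mk (Surf.CompRel S.surf T.surf) (.inl x))
        (fun x y hxy => Quot.sound (.left hxy))) (hS.1 a b h)
    · exact congrArg (Quot.lift (fun x => Quot.mk (Surf.CompRel S.surf T.surf) (.inr x))
        (fun x y hxy => Quot.sound (.right hxy))) (hT.2 a b h)
  | hcomp S T hS hT =>
    have hl : ∀ x y, Quot.mk S.surf.rel x = Quot.mk S.surf.rel y →
        Quot.mk (Surf.HcompRel S.surf T.surf) (.inl x) = Quot.mk _ (.inl y) := fun x y h =>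
      congrArg (Quot.lift (fun x => Quot.mk (Surf.HcompRel S.surf T.surf) (.inl x))
        (fun x y hxy => Quot.sound (.left hxy))) h
    have hr : ∀ x y, Quot.mk T.surf.rel x = Quot.mk T.surf.rel y →
        Quot.mk (Surf.HcompRel S.surf T.surf) (.inr x) = Quot.mk _ (.inr y) := fun x y h =>
      congrArg (Quot.lift (fun x => Quot.mk (Surf.HcompRel S.surf T.surf) (.inr x))
        (fun x y hxy => Quot.sound (.right hxy))) h
    refine ⟨fun a b h => ?_, fun a b h => ?_⟩
    · cases h with
      | left h => exact hl _ _ (hS.1 _ _ h)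
      | right h => exact hr _ _ (hT.1 _ _ h)
      | glue p => exact Quot.sound (.src p)
    · cases h with
      | left h => exact hl _ _ (hS.2 _ _ h)
      | right h => exact hr _ _ (hT.2 _ _ h)
      | glue p => exact Quot.sound (.tgt p)
  | birth n i => exact ⟨fun a b h => Quot.sound (.left h), fun a b h => Quot.sound (.right h)⟩
  | death n i => exact ⟨fun a b h => Quot.sound (.left h), fun a b h => Quot.sound (.right h)⟩
  | saddle n i => exact ⟨fun a b h => Quot.sound (.left h), fun a b h => Quot.sound (.right h)⟩
  | saddleInv n i => exact ⟨fun a b h => Quot.sound (.left h), fun a b h => Quot.sound (.right h)⟩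
  | move μ => exact ⟨fun a b h => Quot.sound (.left h), fun a b h => Quot.sound (.right h)⟩
  | moveInv μ => exact ⟨fun a b h => Quot.sound (.left h), fun a b h => Quot.sound (.right h)⟩
  | assoc a b c =>
    refine ⟨fun x y h => Quot.sound h, fun x y h => Quot.sound ?_⟩
    cases h with
    | left h => exact .left (.left h)
    | right h =>
      cases h with
      | left h => exact .left (.right h)
      | right h => exact .right h
      | glue p => exact .glue p
    | glue p => exact .left (.glue p)
  | assocInv a b c =>
    refine ⟨fun x y h => Quot.sound ?_, fun x y h => Quot.sound h⟩
    cases h with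
    | left h => exact .left (.left h)
    | right h =>
      cases h with
      | left h => exact .left (.right h)
      | right h => exact .right h
      | glue p => exact .glue p
    | glue p => exact .left (.glue p)
  | idComp a => exact ⟨fun x y h => Quot.sound h, fun x y h => Quot.sound (.right h)⟩
  | idCompInv a => exact ⟨fun x y h => Quot.sound (.right h), fun x y h => Quot.sound h⟩
  | compId a => exact ⟨fun x y h => Quot.sound h, fun x y h => Quot.sound (.left h)⟩
  | compIdInv a => exact ⟨fun x y h => Quot.sound (.left h), fun x y h => Quot.sound h⟩


theorem Cb.wall {n m : ℕ} {w w' : Diag n m} (S : Cb w w') :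
    (∀ p, Quot.mk S.surf.rel (S.surf.src (w.graph.src p)) =
      Quot.mk S.surf.rel (S.surf.tgt (w'.graph.src p))) ∧
    (∀ p, Quot.mk S.surf.rel (S.surf.src (w.graph.tgt p)) =
      Quot.mk S.surf.rel (S.surf.tgt (w'.graph.tgt p))) := by
  induction S with
  | id w => exact ⟨fun p => rfl, fun p => rfl⟩
  | dot w x => exact ⟨fun p => rfl, fun p => rfl⟩
  | @comp n m w w' w'' S T hS hT =>
    have hl : ∀ x y, Quot.mk S.surf.rel x = Quot.mk S.surf.rel y →
        Quot.mk (Surf.CompRel S.surf T.surf) (.inl x) = Quot.mk _ (.inl y) := fun x y h =>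
      congrArg (Quot.lift (fun x => Quot.mk (Surf.CompRel S.surf T.surf) (.inl x))
        (fun x y hxy => Quot.sound (.left hxy))) h
    have hr : ∀ x y, Quot.mk T.surf.rel x = Quot.mk T.surf.rel y →
        Quot.mk (Surf.CompRel S.surf T.surf) (.inr x) = Quot.mk _ (.inr y) := fun x y h =>
      congrArg (Quot.lift (fun x => Quot.mk (Surf.CompRel S.surf T.surf) (.inr x))
        (fun x y hxy => Quot.sound (.right hxy))) h
    exact ⟨fun p => ((hl _ _ (hS.1 p)).trans (Quot.sound (.glue _))).trans (hr _ _ (hT.1 p)),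
      fun p => ((hl _ _ (hS.2 p)).trans (Quot.sound (.glue _))).trans (hr _ _ (hT.2 p))⟩
  | hcomp S T hS hT =>
    exact ⟨fun p => congrArg (Quot.lift (fun x => Quot.mk (Surf.HcompRel S.surf T.surf) (.inl x))
        (fun x y hxy => Quot.sound (.left hxy))) (hS.1 p),
      fun p => congrArg (Quot.lift (fun x => Quot.mk (Surf.HcompRel S.surf T.surf) (.inr x))
        (fun x y hxy => Quot.sound (.right hxy))) (hT.2 p)⟩
  | birth n i => exact ⟨fun p => Quot.sound (.src p), fun p => Quot.sound (.tgt p)⟩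
  | death n i => exact ⟨fun p => Quot.sound (.src p), fun p => Quot.sound (.tgt p)⟩
  | saddle n i => exact ⟨fun p => Quot.sound (.src p), fun p => Quot.sound (.tgt p)⟩
  | saddleInv n i => exact ⟨fun p => Quot.sound (.src p), fun p => Quot.sound (.tgt p)⟩
  | move μ => exact ⟨fun p => Quot.sound (.src p), fun p => Quot.sound (.tgt p)⟩
  | moveInv μ => exact ⟨fun p => Quot.sound (.src p), fun p => Quot.sound (.tgt p)⟩
  | assoc a b c => exact ⟨fun p => rfl, fun p => rfl⟩
  | assocInv a b c => exact ⟨fun p => rfl, fun p => rfl⟩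
  | idComp a => exact ⟨fun p => Quot.sound (.glue p), fun p => rfl⟩
  | idCompInv a => exact ⟨fun p => (Quot.sound (.glue p)).symm, fun p => rfl⟩
  | compId a => exact ⟨fun p => rfl, fun p => (Quot.sound (.glue p)).symm⟩
  | compIdInv a => exact ⟨fun p => rfl, fun p => Quot.sound (.glue p)⟩

theorem Cb.id_comp_sameType {n m : ℕ} {w w' : Diag n m} (S : Cb w w') :
    ((Cb.id w).comp S).SameType S := by
  have hz : ∀ {M : Type} [AddCommMonoid M] (s : S.surf.Pt →₀ M),
      (((0 : w.Pt →₀ M).mapDomain Sum.inl + s.mapDomain Sum.inr).mapDomain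
        (Sum.elim S.surf.src fun x => x)) = s := by
    intro M _ s
    rw [Surf.mapDomain_sum, Finsupp.mapDomain_zero, zero_add]; exact Finsupp.mapDomain_id
  refine Surf.SameType.of_maps (S := ((Cb.id w).comp S).surf) (T := S.surf)
    (Sum.elim S.surf.src fun x => x) .inr ?_ ?_ ?_ ?_ ?_ ?_ ?_ ?_
  · intro a b h
    cases h with
    | left h => exact S.src_tgt_rel.1 _ _ h
    | right h => exact Quot.sound h
    | glue p => rfl
  · intro a b h; exact Quot.sound (.right h)
  · rintro (a | a)
    · exact (Quot.sound (.glue a)).symm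
    · rfl
  · intro a; rfl
  · intro p; rfl
  · intro p; rfl
  · exact congrArg (Finsupp.mapDomain _) (hz _)
  · exact congrArg (Finsupp.mapDomain _) (hz _)

theorem Cb.comp_id_sameType {n m : ℕ} {w w' : Diag n m} (S : Cb w w') :
    (S.comp (Cb.id w')).SameType S := by
  have hz : ∀ {M : Type} [AddCommMonoid M] (s : S.surf.Pt →₀ M),
      ((s.mapDomain Sum.inl + (0 : w'.Pt →₀ M).mapDomain Sum.inr).mapDomain
        (Sum.elim (fun x => x) S.surf.tgt)) = s := by
    intro M _ s
    rw [Surf.mapDomain_sum, Finsupp.mapDomain_zero, add_zero]; exact Finsupp.mapDomain_id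
  refine Surf.SameType.of_maps (S := (S.comp (Cb.id w')).surf) (T := S.surf)
    (Sum.elim (fun x => x) S.surf.tgt) .inl ?_ ?_ ?_ ?_ ?_ ?_ ?_ ?_
  · intro a b h
    cases h with
    | left h => exact Quot.sound h
    | right h => exact S.src_tgt_rel.2 _ _ h
    | glue p => rfl
  · intro a b h; exact Quot.sound (.left h)
  · rintro (a | a)
    · rfl
    · exact Quot.sound (.glue a)
  · intro a; rfl
  · intro p; rfl
  · intro p; rfl
  · exact congrArg (Finsupp.mapDomain _) (hz _)
  · exact congrArg (Finsupp.mapDomain _) (hz _)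

theorem Cb.assoc_sameType {n m : ℕ} {w₁ w₂ w₃ w₄ : Diag n m} (S : Cb w₁ w₂) (T : Cb w₂ w₃)
    (U : Cb w₃ w₄) : ((S.comp T).comp U).SameType (S.comp (T.comp U)) := by
  have hz : ∀ {A B C M : Type} [AddCommMonoid M] (s : A →₀ M) (t : B →₀ M) (u : C →₀ M),
      ((s.mapDomain Sum.inl + t.mapDomain Sum.inr).mapDomain Sum.inl +
        u.mapDomain Sum.inr).mapDomain (Equiv.sumAssoc A B C) =
      s.mapDomain Sum.inl + (t.mapDomain Sum.inl + u.mapDomain Sum.inr).mapDomain Sum.inr := by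
    intro A B C M _ s t u
    rw [Surf.mapDomain_sum, Surf.mapDomain_sum, Surf.mapDomain_sum, add_assoc]; rfl
  refine Surf.SameType.of_maps (S := ((S.comp T).comp U).surf) (T := (S.comp (T.comp U)).surf)
    (Equiv.sumAssoc _ _ _) (Equiv.sumAssoc _ _ _).symm ?_ ?_ ?_ ?_ ?_ ?_ ?_ ?_
  · intro a b h
    refine Quot.sound ?_
    cases h with
    | left h =>
      cases h with
      | left h => exact .left h
      | right h => exact .right (.left h)
      | glue p => exact .glue p
    | right h => exact .right (.right h)
    | glue p => exact .right (.glue p)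
  · intro a b h
    refine Quot.sound ?_
    cases h with
    | left h => exact .left (.left h)
    | right h =>
      cases h with
      | left h => exact .left (.right h)
      | right h => exact .right h
      | glue p => exact .glue p
    | glue p => exact .left (.glue p)
  · intro a; exact congrArg _ (Equiv.symm_apply_apply _ a)
  · intro a; exact congrArg _ (Equiv.apply_symm_apply _ a)
  · intro p; rfl
  · intro p; rfl
  · exact congrArg (Finsupp.mapDomain _) (hz _ _ _)
  · exact congrArg (Finsupp.mapDomain _) (hz _ _ _)

theorem Cb.hcomp_id_sameType {n m l : ℕ} (w : Diag n m) (v : Diag m l) :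
    ((Cb.id w).hcomp (Cb.id v)).SameType (Cb.id (w.comp v)) := by
  have hz : ∀ {A B M : Type} [AddCommMonoid M],
      ((0 : A →₀ M).mapDomain Sum.inl + (0 : B →₀ M).mapDomain Sum.inr).mapDomain
        (fun x => x) = (0 : A ⊕ B →₀ M) := by
    intro A B M _
    rw [Surf.mapDomain_sum, Finsupp.mapDomain_zero, Finsupp.mapDomain_zero, add_zero]
  refine Surf.SameType.of_maps (S := ((Cb.id w).hcomp (Cb.id v)).surf)
    (T := (Cb.id (w.comp v)).surf) (fun x => x) (fun x => x) ?_ ?_ ?_ ?_ ?_ ?_ ?_ ?_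
  · intro a b h
    refine Quot.sound ?_
    cases h with
    | left h => exact .left h
    | right h => exact .right h
    | src p => exact .glue p
    | tgt p => exact .glue p
  · intro a b h
    refine Quot.sound ?_
    cases h with
    | left h => exact .left h
    | right h => exact .right h
    | glue p => exact .src p
  · intro a; rfl
  · intro a; rfl
  · rintro (p | p) <;> rfl
  · rintro (p | p) <;> rfl
  · exact congrArg (Finsupp.mapDomain _) hz
  · exact congrArg (Finsupp.mapDomain _) hz

theorem Cb.interchange_sameType {n m l : ℕ} {w w' w'' : Diag n m} {v v' v'' : Diag m l}
    (S : Cb w w') (S' : Cb w' w'') (T : Cb v v') (T' : Cb v' v'') :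
    ((S.comp S').hcomp (T.comp T')).SameType ((S.hcomp T).comp (S'.hcomp T')) := by
  have hz : ∀ {A B C D M : Type} [AddCommMonoid M] (s : A →₀ M) (t : B →₀ M) (u : C →₀ M)
      (v : D →₀ M),
      ((s.mapDomain Sum.inl + t.mapDomain Sum.inr).mapDomain Sum.inl +
        (u.mapDomain Sum.inl + v.mapDomain Sum.inr).mapDomain Sum.inr).mapDomain
          (Equiv.sumSumSumComm A B C D) =
      (s.mapDomain Sum.inl + u.mapDomain Sum.inr).mapDomain Sum.inl +
        (t.mapDomain Sum.inl + v.mapDomain Sum.inr).mapDomain Sum.inr := by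
    intro A B C D M _ s t u v
    rw [Surf.mapDomain_sum, Surf.mapDomain_sum, Surf.mapDomain_sum, Surf.mapDomain_sum,
      Surf.mapDomain_sum, add_add_add_comm]; rfl
  let X := ((S.comp S').hcomp (T.comp T')).surf
  have hrel : ∀ a b, X.rel a b → Quot.mk X.rel a = Quot.mk X.rel b := fun a b h => Quot.sound h
  have h1 : ∀ x y, Quot.mk S.surf.rel x = Quot.mk S.surf.rel y →
      Quot.mk X.rel (.inl (.inl x)) = Quot.mk X.rel (.inl (.inl y)) := fun x y h =>
    congrArg (Quot.lift (fun x => Quot.mk X.rel (.inl (.inl x)))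
      (fun x y hxy => Quot.sound (.left (.left hxy)))) h
  have h2 : ∀ x y, Quot.mk T.surf.rel x = Quot.mk T.surf.rel y →
      Quot.mk X.rel (.inr (.inl x)) = Quot.mk X.rel (.inr (.inl y)) := fun x y h =>
    congrArg (Quot.lift (fun x => Quot.mk X.rel (.inr (.inl x)))
      (fun x y hxy => Quot.sound (.right (.left hxy)))) h
  have hmid : ∀ p, Quot.mk X.rel (.inl (.inl (S.surf.tgt (w'.graph.tgt p)))) =
      Quot.mk X.rel (.inr (.inl (T.surf.tgt (v'.graph.src p)))) := fun p =>
    ((h1 _ _ (S.wall.2 p)).symm.trans (hrel _ _ (.src p))).trans (h2 _ _ (T.wall.1 p))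
  refine Surf.SameType.of_maps (S := X)
    (T := ((S.hcomp T).comp (S'.hcomp T')).surf) (Equiv.sumSumSumComm _ _ _ _)
    (Equiv.sumSumSumComm _ _ _ _) ?_ ?_ ?_ ?_ ?_ ?_ ?_ ?_
  · intro a b h
    refine Quot.sound ?_
    cases h with
    | left h =>
      cases h with
      | left h => exact .left (.left h)
      | right h => exact .right (.left h)
      | glue p =>
        exact Surf.CompRel.glue (S := (S.hcomp T).surf) (T := (S'.hcomp T').surf)
          (show w'.Pt ⊕ v'.Pt from .inl p)
    | right h =>
      cases h with
      | left h => exact .left (.right h)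
      | right h => exact .right (.right h)
      | glue p =>
        exact Surf.CompRel.glue (S := (S.hcomp T).surf) (T := (S'.hcomp T').surf)
          (show w'.Pt ⊕ v'.Pt from .inr p)
    | src p => exact .left (.src p)
    | tgt p => exact .right (.tgt p)
  · intro a b h
    cases h with
    | left h =>
      cases h with
      | left h => exact hrel _ _ (.left (.left h))
      | right h => exact hrel _ _ (.right (.left h))
      | src p => exact hrel _ _ (.src p)
      | tgt p => exact hmid p
    | right h =>
      cases h with
      | left h => exact hrel _ _ (.left (.right h))
      | right h => exact hrel _ _ (.right (.right h))
      | src p =>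
        exact ((hrel _ _ (.left (.glue _))).symm.trans (hmid p)).trans (hrel _ _ (.right (.glue _)))
      | tgt p => exact hrel _ _ (.tgt p)
    | glue p =>
      rcases p with p | p
      · exact hrel _ _ (.left (.glue p))
      · exact hrel _ _ (.right (.glue p))
  · rintro ((a | a) | (a | a)) <;> rfl
  · rintro ((a | a) | (a | a)) <;> rfl
  · rintro (p | p) <;> rfl
  · rintro (p | p) <;> rfl
  · exact congrArg (Finsupp.mapDomain _) (hz _ _ _ _)
  · exact congrArg (Finsupp.mapDomain _) (hz _ _ _ _)


/-! ### Linear combinations of cobordisms and local relations -/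

/-- Formal linear combinations of cobordisms. The variable `X` of the coefficient ring is the
deformation parameter `α`. -/
abbrev Free {n m : ℕ} (w w' : Diag n m) : Type := Cb w w' →₀ ℤ[X]

/-- The bilinear extension of a binary operation. -/
def bilin {A B C : Type} (op : A → B → C) :
    (A →₀ ℤ[X]) →ₗ[ℤ[X]] (B →₀ ℤ[X]) →ₗ[ℤ[X]] (C →₀ ℤ[X]) :=
  Finsupp.linearCombination ℤ[X] fun a => Finsupp.lmapDomain ℤ[X] ℤ[X] (op a)

theorem bilin_single {A B C : Type} (op : A → B → C) (a : A) (b : B) (r s : ℤ[X]) :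
    bilin op (Finsupp.single a r) (Finsupp.single b s) = Finsupp.single (op a b) (r * s) := by
  simp [bilin, Finsupp.linearCombination_single, Finsupp.mapDomain_single]

/-- A cobordism as a linear combination. -/
def of {n m : ℕ} {w w' : Diag n m} (S : Cb w w') : Free w w' := Finsupp.single S 1

/-- Composition of linear combinations of cobordisms. -/
def Free.comp {n m : ℕ} {w w' w'' : Diag n m} :
    Free w w' →ₗ[ℤ[X]] Free w' w'' →ₗ[ℤ[X]] Free w w'' := bilin Cb.comp

/-- Gluing of linear combinations of cobordisms along vertical intervals. -/
def Free.hcomp {n m l : ℕ} {w w' : Diag n m} {v v' : Diag m l} :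
    Free w w' →ₗ[ℤ[X]] Free v v' →ₗ[ℤ[X]] Free (w.comp v) (w'.comp v') := bilin Cb.hcomp

/-- Disjoint union with a vertical disk on the right. -/
def Free.strand {n m : ℕ} {w w' : Diag n m} :
    Free w w' →ₗ[ℤ[X]] Free w.strand w'.strand := Finsupp.lmapDomain ℤ[X] ℤ[X] Cb.strand

/-- `n` vertical strands and a circle in the `i`-th gap. -/
abbrev circle (n : ℕ) (i : Fin (n + 1)) : Diag n n := .comp (.cup n i) (.cap n i)

/-- A sample point on that circle. -/
def circlePt (n : ℕ) (i : Fin (n + 1)) : (circle n i).Pt :=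
  .inl (⟨i.1, by omega⟩ : Fin (n + 2))

/-- The identity cobordism of the circle with one dot on the cylinder over the circle. -/
abbrev circleDot (n : ℕ) (i : Fin (n + 1)) : Cb (circle n i) (circle n i) :=
  .dot _ (circlePt n i)

/-- The linear combinations of cobordisms that vanish in Bar-Natan's category: the smallest
family of submodules which is closed under composition and gluing, and which contains the
differences of cobordisms of the same topological type and the local relations. -/
inductive Rel : {n m : ℕ} → {w w' : Diag n m} → Free w w' → Prop
  | zero {n m : ℕ} {w w' : Diag n m} : Rel (0 : Free w w')
  | add {n m : ℕ} {w w' : Diag n m} {f g : Free w w'} : Rel f → Rel g → Rel (f + g)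
  | smul {n m : ℕ} {w w' : Diag n m} (r : ℤ[X]) {f : Free w w'} : Rel f → Rel (r • f)
  | comp_left {n m : ℕ} {w w' w'' : Diag n m} {f : Free w w'} (hf : Rel f) (g : Free w' w'') :
      Rel (Free.comp f g)
  | comp_right {n m : ℕ} {w w' w'' : Diag n m} (f : Free w w') {g : Free w' w''} (hg : Rel g) :
      Rel (Free.comp f g)
  | hcomp_left {n m l : ℕ} {w w' : Diag n m} {v v' : Diag m l} {f : Free w w'} (hf : Rel f)
      (g : Free v v') : Rel (Free.hcomp f g)
  | hcomp_right {n m l : ℕ} {w w' : Diag n m} {v v' : Diag m l} (f : Free w w') {g : Free v v'}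
      (hg : Rel g) : Rel (Free.hcomp f g)
  | strand {n m : ℕ} {w w' : Diag n m} {f : Free w w'} (hf : Rel f) : Rel (Free.strand f)
  | sameType {n m : ℕ} {w w' : Diag n m} {S T : Cb w w'} (h : S.SameType T) : Rel (of S - of T)
  /-- a sphere is zero -/
  | sphere (n : ℕ) (i : Fin (n + 1)) : Rel (of ((Cb.birth n i).comp (.death n i)))
  /-- a sphere with one dot is one -/
  | sphereDot (n : ℕ) (i : Fin (n + 1)) :
      Rel (of ((Cb.birth n i).comp ((circleDot n i).comp (.death n i))) - of (.id (.id n)))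
  /-- a sphere with two dots is zero -/
  | sphereDotDot (n : ℕ) (i : Fin (n + 1)) :
      Rel (of ((Cb.birth n i).comp ((circleDot n i).comp ((circleDot n i).comp (.death n i)))))
  /-- a sphere with three dots is `α` -/
  | sphereDotDotDot (n : ℕ) (i : Fin (n + 1)) :
      Rel (of ((Cb.birth n i).comp
        ((circleDot n i).comp ((circleDot n i).comp ((circleDot n i).comp (.death n i))))) -
          (Polynomial.X : ℤ[X]) • of (.id (.id n)))
  /-- neck cutting -/
  | neck (n : ℕ) (i : Fin (n + 1)) :
      Rel (of (.id (circle n i)) - (of (((circleDot n i).comp (.death n i)).comp (.birth n i)) +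
        of ((Cb.death n i).comp ((Cb.birth n i).comp (circleDot n i)))))

/-- The submodule of the linear combinations that vanish. -/
def relSubmodule {n m : ℕ} (w w' : Diag n m) : Submodule ℤ[X] (Free w w') where
  carrier := {f | Rel f}
  zero_mem' := .zero
  add_mem' := .add
  smul_mem' r _ h := .smul r h

/-- Morphisms of all degrees between diagrams. -/
abbrev CobHom {n m : ℕ} (w w' : Diag n m) : Type := Free w w' ⧸ relSubmodule w w'

/-- The morphism given by a linear combination of cobordisms. -/
def mk {n m : ℕ} {w w' : Diag n m} (f : Free w w') : CobHom w w' := Submodule.Quotient.mk f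

theorem mk_surjective {n m : ℕ} {w w' : Diag n m} : Function.Surjective (mk (w := w) (w' := w')) :=
  Submodule.Quotient.mk_surjective _

theorem mk_of_eq {n m : ℕ} {w w' : Diag n m} {S T : Cb w w'} (h : S.SameType T) (r : ℤ[X]) :
    mk (Finsupp.single S r) = mk (Finsupp.single T r) := by
  refine (Submodule.Quotient.eq _).2 ?_
  have := Rel.smul r (Rel.sameType h)
  rwa [smul_sub, of, of, Finsupp.smul_single, Finsupp.smul_single, smul_eq_mul, mul_one] at this

/-- A bilinear map descends to quotients. -/
def quotBilin {M N P : Type} [AddCommGroup M] [AddCommGroup N] [AddCommGroup P] [Module ℤ[X] M]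
    [Module ℤ[X] N] [Module ℤ[X] P] (p : Submodule ℤ[X] M) (q : Submodule ℤ[X] N)
    (r : Submodule ℤ[X] P) (B : M →ₗ[ℤ[X]] N →ₗ[ℤ[X]] P) (hp : ∀ f ∈ p, ∀ g, B f g ∈ r)
    (hq : ∀ f, ∀ g ∈ q, B f g ∈ r) : (M ⧸ p) →ₗ[ℤ[X]] (N ⧸ q) →ₗ[ℤ[X]] (P ⧸ r) :=
  p.liftQ
    { toFun := fun f => q.mapQ r (B f) fun g hg => hq f g hg
      map_add' := fun f f' => by ext g; simp
      map_smul' := fun c f => by ext g; simp }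
    (fun f hf => by
      refine LinearMap.mem_ker.2 (LinearMap.ext fun g => ?_)
      obtain ⟨g, rfl⟩ := Submodule.Quotient.mk_surjective _ g
      exact (Submodule.Quotient.mk_eq_zero _).2 (hp f hf g))

/-- Composition of morphisms of all degrees. -/
def CobHom.comp {n m : ℕ} {w w' w'' : Diag n m} :
    CobHom w w' →ₗ[ℤ[X]] CobHom w' w'' →ₗ[ℤ[X]] CobHom w w'' :=
  quotBilin _ _ _ Free.comp (fun _ hf g => Rel.comp_left hf g) (fun f _ hg => Rel.comp_right f hg)

/-- Gluing of morphisms along vertical intervals. -/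
def CobHom.hcomp {n m l : ℕ} {w w' : Diag n m} {v v' : Diag m l} :
    CobHom w w' →ₗ[ℤ[X]] CobHom v v' →ₗ[ℤ[X]] CobHom (w.comp v) (w'.comp v') :=
  quotBilin _ _ _ Free.hcomp (fun _ hf g => Rel.hcomp_left hf g)
    (fun f _ hg => Rel.hcomp_right f hg)

/-- Disjoint union of a morphism with a vertical disk on the right. -/
def CobHom.strand {n m : ℕ} {w w' : Diag n m} :
    CobHom w w' →ₗ[ℤ[X]] CobHom w.strand w'.strand :=
  Submodule.mapQ _ _ Free.strand fun _ hf => Rel.strand hf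

/-- The identity morphism. -/
def CobHom.id {n m : ℕ} (w : Diag n m) : CobHom w w := mk (of (.id w))

theorem CobHom.comp_mk {n m : ℕ} {w w' w'' : Diag n m} (S : Cb w w') (T : Cb w' w'')
    (r s : ℤ[X]) : CobHom.comp (mk (Finsupp.single S r)) (mk (Finsupp.single T s)) =
      mk (Finsupp.single (S.comp T) (r * s)) :=
  congrArg mk (bilin_single _ _ _ _ _)

theorem CobHom.hcomp_mk {n m l : ℕ} {w w' : Diag n m} {v v' : Diag m l} (S : Cb w w')
    (T : Cb v v') (r s : ℤ[X]) : CobHom.hcomp (mk (Finsupp.single S r)) (mk (Finsupp.single T s)) =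
      mk (Finsupp.single (S.hcomp T) (r * s)) :=
  congrArg mk (bilin_single _ _ _ _ _)

theorem CobHom.strand_mk {n m : ℕ} {w w' : Diag n m} (S : Cb w w') (r : ℤ[X]) :
    CobHom.strand (mk (Finsupp.single S r)) = mk (Finsupp.single S.strand r) :=
  congrArg mk (Finsupp.mapDomain_single)

theorem mk_add {n m : ℕ} {w w' : Diag n m} (f g : Free w w') : mk (f + g) = mk f + mk g := rfl

/-- Induction over the generators of the modules of morphisms. -/
theorem CobHom.induct {n m : ℕ} {w w' : Diag n m} {P : CobHom w w' → Prop} (f : CobHom w w')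
    (zero : P 0) (add : ∀ f g, P f → P g → P (f + g))
    (single : ∀ S r, P (mk (Finsupp.single S r))) : P f := by
  obtain ⟨f, rfl⟩ := mk_surjective f
  induction f using Finsupp.induction_linear with
  | zero => exact zero
  | add f g hf hg => exact add _ _ hf hg
  | single S r => exact single S r

theorem CobHom.id_comp {n m : ℕ} {w w' : Diag n m} (f : CobHom w w') :
    CobHom.comp (CobHom.id w) f = f := by
  induction f using CobHom.induct with
  | zero => simp
  | add f g hf hg => rw [map_add, hf, hg]
  | single S r =>
    rw [CobHom.id, of, CobHom.comp_mk, one_mul]; exact mk_of_eq S.id_comp_sameType r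

theorem CobHom.comp_id {n m : ℕ} {w w' : Diag n m} (f : CobHom w w') :
    CobHom.comp f (CobHom.id w') = f := by
  induction f using CobHom.induct with
  | zero => simp
  | add f g hf hg => rw [map_add, LinearMap.add_apply, hf, hg]
  | single S r =>
    rw [CobHom.id, of, CobHom.comp_mk, mul_one]; exact mk_of_eq S.comp_id_sameType r

theorem CobHom.assoc {n m : ℕ} {w₁ w₂ w₃ w₄ : Diag n m} (f : CobHom w₁ w₂) (g : CobHom w₂ w₃)
    (h : CobHom w₃ w₄) : CobHom.comp (CobHom.comp f g) h = CobHom.comp f (CobHom.comp g h) := by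
  induction f using CobHom.induct with
  | zero => simp
  | add f f' hf hf' => simp only [map_add, LinearMap.add_apply, hf, hf']
  | single S r =>
    induction g using CobHom.induct with
    | zero => simp
    | add g g' hg hg' => simp only [map_add, LinearMap.add_apply, hg, hg']
    | single T s =>
      induction h using CobHom.induct with
      | zero => simp
      | add h h' hh hh' => simp only [map_add, hh, hh']
      | single U t =>
        simp only [CobHom.comp_mk, mul_assoc]; exact mk_of_eq (Cb.assoc_sameType S T U) _

theorem CobHom.hcomp_id {n m l : ℕ} (w : Diag n m) (v : Diag m l) :
    CobHom.hcomp (CobHom.id w) (CobHom.id v) = CobHom.id (w.comp v) := by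
  rw [CobHom.id, CobHom.id, of, of, CobHom.hcomp_mk, mul_one]
  exact mk_of_eq (Cb.hcomp_id_sameType w v) 1

theorem CobHom.interchange {n m l : ℕ} {w w' w'' : Diag n m} {v v' v'' : Diag m l}
    (f : CobHom w w') (f' : CobHom w' w'') (g : CobHom v v') (g' : CobHom v' v'') :
    CobHom.hcomp (CobHom.comp f f') (CobHom.comp g g') =
      CobHom.comp (CobHom.hcomp f g) (CobHom.hcomp f' g') := by
  induction f using CobHom.induct with
  | zero => simp
  | add a b ha hb => simp only [map_add, LinearMap.add_apply, ha, hb]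
  | single S r =>
    induction f' using CobHom.induct with
    | zero => simp
    | add a b ha hb => simp only [map_add, LinearMap.add_apply, ha, hb]
    | single S' r' =>
      induction g using CobHom.induct with
      | zero => simp
      | add a b ha hb => simp only [map_add, LinearMap.add_apply, ha, hb]
      | single T s =>
        induction g' using CobHom.induct with
        | zero => simp
        | add a b ha hb => simp only [map_add, ha, hb]
        | single T' s' =>
          simp only [CobHom.comp_mk, CobHom.hcomp_mk, mul_mul_mul_comm]
          exact mk_of_eq (Cb.interchange_sameType S S' T T') _

theorem CobHom.strand_id {n m : ℕ} (w : Diag n m) :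
    CobHom.strand (CobHom.id w) = CobHom.id w.strand := CobHom.strand_mk _ _

theorem CobHom.strand_comp {n m : ℕ} {w w' w'' : Diag n m} (f : CobHom w w')
    (g : CobHom w' w'') :
    CobHom.strand (CobHom.comp f g) = CobHom.comp (CobHom.strand f) (CobHom.strand g) := by
  induction f using CobHom.induct with
  | zero => simp
  | add a b ha hb => simp only [map_add, LinearMap.add_apply, ha, hb]
  | single S r =>
    induction g using CobHom.induct with
    | zero => simp
    | add a b ha hb => simp only [map_add, ha, hb]
    | single T s => simp only [CobHom.comp_mk, CobHom.strand_mk]; rfl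

/-! ### Degrees -/

/-- The morphisms of topological degree `d`. The parameter `α`, which is the value of a sphere with
three dots, has degree `-4`. -/
def CobHom.degPart {n m : ℕ} (w w' : Diag n m) (d : ℤ) : AddSubgroup (CobHom w w') :=
  AddSubgroup.closure
    {f | ∃ (S : Cb w w') (k : ℕ), S.deg - 4 * k = d ∧
      f = mk (Finsupp.single S ((Polynomial.X : ℤ[X]) ^ k))}

theorem CobHom.id_mem {n m : ℕ} (w : Diag n m) : CobHom.id w ∈ CobHom.degPart w w 0 :=
  AddSubgroup.subset_closure ⟨.id w, 0, rfl, rfl⟩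

theorem CobHom.comp_mem {n m : ℕ} {w w' w'' : Diag n m} {d e c : ℤ} {f : CobHom w w'}
    {g : CobHom w' w''} (hf : f ∈ CobHom.degPart w w' d) (hg : g ∈ CobHom.degPart w' w'' e)
    (h : d + e = c) : CobHom.comp f g ∈ CobHom.degPart w w'' c := by
  induction hf using AddSubgroup.closure_induction with
  | mem f hf =>
    obtain ⟨S, k, hS, rfl⟩ := hf
    induction hg using AddSubgroup.closure_induction with
    | mem g hg =>
      obtain ⟨T, l, hT, rfl⟩ := hg
      rw [CobHom.comp_mk, ← pow_add]
      refine AddSubgroup.subset_closure ⟨S.comp T, k + l, ?_, rfl⟩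
      simp only [Cb.deg]; push_cast; linarith
    | zero => rw [map_zero]; exact zero_mem _
    | add g g' _ _ h1 h2 => rw [map_add]; exact add_mem h1 h2
    | neg g _ h1 => rw [map_neg]; exact neg_mem h1
  | zero => rw [map_zero, LinearMap.zero_apply]; exact zero_mem _
  | add f f' _ _ h1 h2 => rw [map_add, LinearMap.add_apply]; exact add_mem h1 h2
  | neg f _ h1 => rw [map_neg, LinearMap.neg_apply]; exact neg_mem h1

theorem CobHom.hcomp_mem {n m l : ℕ} {w w' : Diag n m} {v v' : Diag m l} {d e c : ℤ}
    {f : CobHom w w'} {g : CobHom v v'} (hf : f ∈ CobHom.degPart w w' d)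
    (hg : g ∈ CobHom.degPart v v' e) (h : d + e = c) :
    CobHom.hcomp f g ∈ CobHom.degPart (w.comp v) (w'.comp v') c := by
  induction hf using AddSubgroup.closure_induction with
  | mem f hf =>
    obtain ⟨S, k, hS, rfl⟩ := hf
    induction hg using AddSubgroup.closure_induction with
    | mem g hg =>
      obtain ⟨T, l, hT, rfl⟩ := hg
      rw [CobHom.hcomp_mk, ← pow_add]
      refine AddSubgroup.subset_closure ⟨S.hcomp T, k + l, ?_, rfl⟩
      simp only [Cb.deg]; push_cast; linarith
    | zero => rw [map_zero]; exact zero_mem _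
    | add g g' _ _ h1 h2 => rw [map_add]; exact add_mem h1 h2
    | neg g _ h1 => rw [map_neg]; exact neg_mem h1
  | zero => rw [map_zero, LinearMap.zero_apply]; exact zero_mem _
  | add f f' _ _ h1 h2 => rw [map_add, LinearMap.add_apply]; exact add_mem h1 h2
  | neg f _ h1 => rw [map_neg, LinearMap.neg_apply]; exact neg_mem h1

theorem Cb.deg_strand {n m : ℕ} {w w' : Diag n m} (S : Cb w w') : S.strand.deg = S.deg := by
  induction S with
  | comp S T hS hT => simp only [Cb.strand, Cb.deg, hS, hT]
  | hcomp S T hS hT => simp only [Cb.strand, Cb.deg, hS, hT]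
  | _ => rfl

theorem CobHom.strand_mem {n m : ℕ} {w w' : Diag n m} {d : ℤ} {f : CobHom w w'}
    (hf : f ∈ CobHom.degPart w w' d) : CobHom.strand f ∈ CobHom.degPart w.strand w'.strand d := by
  induction hf using AddSubgroup.closure_induction with
  | mem f hf =>
    obtain ⟨S, k, hS, rfl⟩ := hf
    rw [CobHom.strand_mk]
    exact AddSubgroup.subset_closure ⟨S.strand, k, by rw [Cb.deg_strand, hS], rfl⟩
  | zero => rw [map_zero]; exact zero_mem _
  | add f g _ _ h1 h2 => rw [map_add]; exact add_mem h1 h2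
  | neg f _ h => rw [map_neg]; exact neg_mem h

/-! ### Bar-Natan's category -/

/-- Objects of Bar-Natan's category: formally `q`-graded diagrams. -/
structure Cob (n m : ℕ) : Type where
  q : ℤ
  diag : Diag n m

namespace Cob

variable {n m l : ℕ}

/-- Morphisms from `q^i A` to `q^j B` are the linear combinations of cobordisms `S` with
`deg S = deg_t S + (j - i) = 0`. -/
instance : Category.{0} (Cob n m) where
  Hom A B := CobHom.degPart A.diag B.diag (A.q - B.q)
  id A := ⟨CobHom.id A.diag, by rw [sub_self]; exact CobHom.id_mem _⟩
  comp f g := ⟨CobHom.comp f.1 g.1, CobHom.comp_mem f.2 g.2 (by ring)⟩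
  id_comp f := Subtype.ext (CobHom.id_comp f.1)
  comp_id f := Subtype.ext (CobHom.comp_id f.1)
  assoc f g h := Subtype.ext (CobHom.assoc f.1 g.1 h.1)

instance (A B : Cob n m) : AddCommGroup (A ⟶ B) :=
  inferInstanceAs (AddCommGroup (CobHom.degPart A.diag B.diag (A.q - B.q)))

instance : Preadditive (Cob n m) where
  add_comp _ _ _ f f' g := Subtype.ext (by
    exact (congrArg (fun F => F g.1) (map_add CobHom.comp f.1 f'.1)))
  comp_add _ _ _ f g g' := Subtype.ext (map_add (CobHom.comp f.1) g.1 g'.1)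

/-- The object `q^j 1`, where `1` is the identity diagram. -/
def one (n : ℕ) (j : ℤ) : Cob n n := ⟨j, .id n⟩

/-- The tensor product of objects: gluing of diagrams. -/
def tensorObj (A : Cob n m) (B : Cob m l) : Cob n l := ⟨A.q + B.q, A.diag.comp B.diag⟩

/-- The tensor product of morphisms: gluing of cobordisms. -/
def tensorHom {A A' : Cob n m} {B B' : Cob m l} (f : A ⟶ A') (g : B ⟶ B') :
    tensorObj A B ⟶ tensorObj A' B' :=
  ⟨CobHom.hcomp f.1 g.1, CobHom.hcomp_mem f.2 g.2 (by simp only [tensorObj]; ring)⟩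

theorem tensorHom_id (A : Cob n m) (B : Cob m l) :
    tensorHom (𝟙 A) (𝟙 B) = 𝟙 (tensorObj A B) :=
  Subtype.ext (CobHom.hcomp_id A.diag B.diag)

theorem tensorHom_comp {A A' A'' : Cob n m} {B B' B'' : Cob m l} (f : A ⟶ A') (f' : A' ⟶ A'')
    (g : B ⟶ B') (g' : B' ⟶ B'') :
    tensorHom (f ≫ f') (g ≫ g') = tensorHom f g ≫ tensorHom f' g' :=
  Subtype.ext (CobHom.interchange f.1 f'.1 g.1 g'.1)

/-- The tensor product of morphisms is biadditive. -/
def tensorHomAdd (A A' : Cob n m) (B B' : Cob m l) :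
    (A ⟶ A') →+ (B ⟶ B') →+ (tensorObj A B ⟶ tensorObj A' B') :=
  AddMonoidHom.mk' (fun f => AddMonoidHom.mk' (fun g => tensorHom f g)
      (fun g g' => Subtype.ext (map_add (CobHom.hcomp f.1) g.1 g'.1)))
    (fun f f' => AddMonoidHom.ext fun g => Subtype.ext
      (congrArg (fun F => F g.1) (map_add CobHom.hcomp f.1 f'.1)))

theorem tensorHomAdd_apply {A A' : Cob n m} {B B' : Cob m l} (f : A ⟶ A') (g : B ⟶ B') :
    tensorHomAdd A A' B B' f g = tensorHom f g := rfl

/-- The functor `- ⊔ 1`, which adds a vertical strand on the right. -/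
def strand (n m : ℕ) : Cob n m ⥤ Cob (n + 1) (m + 1) where
  obj A := ⟨A.q, A.diag.strand⟩
  map f := ⟨CobHom.strand f.1, CobHom.strand_mem f.2⟩
  map_id A := Subtype.ext (CobHom.strand_id A.diag)
  map_comp f g := Subtype.ext (CobHom.strand_comp f.1 g.1)

instance : (strand n m).Additive where
  map_add {_ _ f g} := Subtype.ext (map_add CobHom.strand f.1 g.1)

end Cob

/-! ### Formal direct sums -/

/-- The tensor product of matrices of morphisms. -/
def matTensorHom {n m l : ℕ} {M M' : Mat_ (Cob n m)} {N N' : Mat_ (Cob m l)} (f : M ⟶ M')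
    (g : N ⟶ N') :
    (⟨M.ι × N.ι, fun p => Cob.tensorObj (M.X p.1) (N.X p.2)⟩ : Mat_ (Cob n l)) ⟶
      ⟨M'.ι × N'.ι, fun p => Cob.tensorObj (M'.X p.1) (N'.X p.2)⟩ :=
  fun p p' => Cob.tensorHom (f p.1 p'.1) (g p.2 p'.2)

theorem matTensorHom_id {n m l : ℕ} (M : Mat_ (Cob n m)) (N : Mat_ (Cob m l)) :
    matTensorHom (𝟙 M) (𝟙 N) = 𝟙 _ := by
  ext ⟨i, j⟩ ⟨i', j'⟩
  by_cases hi : i = i'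
  · subst hi
    by_cases hj : j = j'
    · subst hj
      simp only [matTensorHom, Mat_.id_apply_self]
      exact Cob.tensorHom_id _ _
    · rw [Mat_.id_apply_of_ne _ _ _ (fun h => hj (congrArg Prod.snd h))]
      simp only [matTensorHom, Mat_.id_apply_of_ne _ _ _ hj]
      exact map_zero (Cob.tensorHomAdd _ _ _ _ _)
  · rw [Mat_.id_apply_of_ne _ _ _ (fun h => hi (congrArg Prod.fst h))]
    simp only [matTensorHom, Mat_.id_apply_of_ne _ _ _ hi]
    exact DFunLike.congr_fun (map_zero (Cob.tensorHomAdd _ _ _ _)) _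

theorem matTensorHom_comp {n m l : ℕ} {M M' M'' : Mat_ (Cob n m)} {N N' N'' : Mat_ (Cob m l)}
    (f : M ⟶ M') (f' : M' ⟶ M'') (g : N ⟶ N') (g' : N' ⟶ N'') :
    matTensorHom (f ≫ f') (g ≫ g') = matTensorHom f g ≫ matTensorHom f' g' := by
  ext ⟨i, j⟩ ⟨i', j'⟩
  rw [Mat_.comp_apply]
  simp only [matTensorHom, Mat_.comp_apply, ← Cob.tensorHom_comp]
  simp only [← Cob.tensorHomAdd_apply, map_sum, AddMonoidHom.finsetSum_apply]
  rw [Fintype.sum_prod_type, Finset.sum_comm]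

theorem matTensorHom_add_left {n m l : ℕ} {M M' : Mat_ (Cob n m)} {N N' : Mat_ (Cob m l)}
    (f f' : M ⟶ M') (g : N ⟶ N') :
    matTensorHom (f + f') g = matTensorHom f g + matTensorHom f' g := by
  ext p p'
  exact DFunLike.congr_fun (map_add (Cob.tensorHomAdd _ _ _ _) _ _) _

theorem matTensorHom_add_right {n m l : ℕ} {M M' : Mat_ (Cob n m)} {N N' : Mat_ (Cob m l)}
    (f : M ⟶ M') (g g' : N ⟶ N') :
    matTensorHom f (g + g') = matTensorHom f g + matTensorHom f g' := by
  ext p p'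
  exact map_add (Cob.tensorHomAdd _ _ _ _ _) _ _

/-- The tensor product on finite formal direct sums, as a bifunctor. -/
def matTensor (n m l : ℕ) : Mat_ (Cob n m) ⥤ Mat_ (Cob m l) ⥤ Mat_ (Cob n l) where
  obj M :=
    { obj := fun N => ⟨M.ι × N.ι, fun p => Cob.tensorObj (M.X p.1) (N.X p.2)⟩
      map := fun g => matTensorHom (𝟙 M) g
      map_id := fun N => matTensorHom_id M N
      map_comp := fun g g' => by rw [← matTensorHom_comp, Category.id_comp] }
  map f :=
    { app := fun N => matTensorHom f (𝟙 N)
      naturality := fun N N' g => by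
        rw [← matTensorHom_comp, ← matTensorHom_comp]
        simp only [Category.id_comp, Category.comp_id] }
  map_id M := by ext N : 2; exact matTensorHom_id M N
  map_comp f f' := by
    ext N : 2
    exact (congrArg _ (Category.comp_id (𝟙 N)).symm).trans (matTensorHom_comp f f' (𝟙 N) (𝟙 N))

instance (n m l : ℕ) : (matTensor n m l).Additive where
  map_add {_ _ f g} := by ext N : 2; exact matTensorHom_add_left f g (𝟙 N)

instance (n m l : ℕ) (M : Mat_ (Cob n m)) : ((matTensor n m l).obj M).Additive where
  map_add {_ _ f g} := matTensorHom_add_right (𝟙 M) f g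

/-! ### Complexes -/

/-- A coproduct exists if there are finite coproducts and all but finitely many objects are
zero. -/
theorem hasCoproduct_of_finite {C : Type*} [Category C] [HasZeroMorphisms C]
    [HasFiniteCoproducts C] {J : Type} (f : J → C) (s : Set J) (hs : s.Finite)
    (h : ∀ j, j ∉ s → IsZero (f j)) : HasCoproduct f := by
  classical
  have := hs.to_subtype
  let c : Cofan f := Cofan.mk (∐ fun j : s => f j)
    (fun j => if hj : j ∈ s then Sigma.ι (fun j : s => f j) ⟨j, hj⟩ else 0)
  refine ⟨⟨c, Cofan.IsColimit.mk c (fun t => Limits.Sigma.desc fun j : s => t.inj j.1) ?_ ?_⟩⟩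
  · intro t j
    by_cases hj : j ∈ s
    · simp [c, hj]
    · exact (h j hj).eq_of_src _ _
  · intro t m hm
    refine Limits.Sigma.hom_ext (f := fun j : s => f j) m _ fun j => ?_
    have := hm j.1
    simp only [c, Cofan.mk_pt, cofan_mk_inj, j.2, dite_true] at this
    simpa using this

/-- Cochain complexes of finite formal direct sums of objects of Bar-Natan's category which are
bounded below, with diagrams that have `n` and `m` endpoints. -/
structure BKom (n m : ℕ) where
  K : CochainComplex (Mat_ (Cob n m)) ℤ
  bdd : ∃ N : ℤ, ∀ i < N, IsZero (K.X i)

/-- The category `Kom(n)`. -/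
abbrev Kom (n : ℕ) := BKom n n

namespace BKom

variable {n m l : ℕ}

instance hasTensor (A : BKom n m) (B : BKom m l) :
    HomologicalComplex.HasMapBifunctor A.K B.K (matTensor n m l) (ComplexShape.up ℤ) := by
  intro k
  obtain ⟨N, hN⟩ := A.bdd
  obtain ⟨N', hN'⟩ := B.bdd
  refine hasCoproduct_of_finite _ {p | N ≤ p.1.1 ∧ N' ≤ p.1.2} ?_ ?_
  · refine Set.Finite.of_injOn (f := fun p => p.1.1) (t := Set.Icc N (k - N')) ?_ ?_
      (Set.finite_Icc _ _)
    · rintro ⟨⟨p, q⟩, hp⟩ ⟨h1, h2⟩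
      have hp : p + q = k := hp
      simp only [Set.mem_Icc] at *
      omega
    · rintro ⟨⟨p, q⟩, hp⟩ _ ⟨⟨p', q'⟩, hp'⟩ _ h
      have hp : p + q = k := hp
      have hp' : p' + q' = k := hp'
      simp only at h
      subst h
      obtain rfl : q = q' := by omega
      rfl
  · rintro ⟨⟨p, q⟩, hp⟩ h
    rcases not_and_or.1 h with h | h
    · have := hN p (not_le.1 h)
      exact (Functor.map_isZero (matTensor n m l) this).obj _
    · have := hN' q (not_le.1 h)
      exact Functor.map_isZero ((matTensor n m l).obj _) this

/-- The tensor product of complexes: the total complex of the double complex. -/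
def tensor (A : BKom n m) (B : BKom m l) : BKom n l where
  K := HomologicalComplex.mapBifunctor A.K B.K (matTensor n m l) (ComplexShape.up ℤ)
  bdd := by
    obtain ⟨N, hN⟩ := A.bdd
    obtain ⟨N', hN'⟩ := B.bdd
    refine ⟨N + N', fun k hk => ?_⟩
    rw [IsZero.iff_id_eq_zero]
    refine HomologicalComplex.mapBifunctor.hom_ext fun p q hp => ?_
    have hp : p + q = k := hp
    refine IsZero.eq_of_src ?_ _ _
    by_cases h : p < N
    · exact (Functor.map_isZero (matTensor n m l) (hN p h)).obj _
    · exact Functor.map_isZero ((matTensor n m l).obj _) (hN' q (by omega))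

instance (n m : ℕ) : (Cob.strand n m).mapMat_.Additive where
  map_add {_ _ f g} := by
    ext i j
    exact (Cob.strand n m).map_add

/-- The functor `- ⊔ 1` on complexes. -/
def strand (A : BKom n m) : BKom (n + 1) (m + 1) where
  K := ((Cob.strand n m).mapMat_.mapHomologicalComplex _).obj A.K
  bdd := by
    obtain ⟨N, hN⟩ := A.bdd
    exact ⟨N, fun k hk => Functor.map_isZero (Cob.strand n m).mapMat_ (hN k hk)⟩

/-- The functor `- ⊔ 1^k` on complexes. -/
def strands (A : BKom n m) : (k : ℕ) → BKom (n + k) (m + k)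
  | 0 => A
  | k + 1 => (A.strands k).strand

/-- A finite formal direct sum of objects, as a complex concentrated in degree zero. -/
def single (M : Mat_ (Cob n m)) : BKom n m where
  K := (HomologicalComplex.single _ (ComplexShape.up ℤ) 0).obj M
  bdd := ⟨0, fun i hi => HomologicalComplex.isZero_single_obj_X _ _ _ _ (by omega)⟩

/-- Homotopy equivalence of complexes. -/
def Equivalent (A B : BKom n m) : Prop := Nonempty (HomotopyEquiv A.K B.K)

/-- A complex is contractible if it is homotopy equivalent to the zero complex. -/
def Contractible (A : BKom n m) : Prop :=
  Nonempty (HomotopyEquiv A.K (0 : CochainComplex (Mat_ (Cob n m)) ℤ))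

end BKom

/-- The object `q^j 1` as a one-term direct sum. -/
def matOne (n : ℕ) (j : ℤ) : Mat_ (Cob n n) := (Mat_.embedding _).obj (Cob.one n j)

/-- The generator `e_i` as a complex concentrated in degree zero. -/
def genComplex (n : ℕ) (i : Fin (n - 1)) : Kom n :=
  .single ((Mat_.embedding _).obj ⟨0, Diag.gen n i⟩)

instance (n m : ℕ) : HasBinaryBiproducts (Mat_ (Cob n m)) :=
  hasBinaryBiproducts_of_finite_biproducts _

/-- Universal projectors. All morphisms of `Cob n n` have degree zero, so that the differentials
are matrices of degree zero maps. Since isomorphisms have degree zero as well, it is stated for all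
shifts `q^j 1` of the identity diagram that they are not summands in positive degrees. -/
structure IsUniversalProjector {n : ℕ} (P : Kom n) : Prop where
  zero_of_neg : ∀ k : ℤ, k < 0 → IsZero (P.K.X k)
  q_nonneg : ∀ k : ℤ, 0 < k → ∀ s : (P.K.X k).ι, 0 ≤ ((P.K.X k).X s).q
  zero_iso : Nonempty (P.K.X 0 ≅ matOne n 0)
  no_identity : ∀ k : ℤ, 0 < k → ∀ (j : ℤ) (D : Mat_ (Cob n n)),
    IsEmpty (P.K.X k ≅ matOne n j ⊞ D)
  tensor_gen : ∀ i : Fin (n - 1), (P.tensor (genComplex n i)).Contractible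
  gen_tensor : ∀ i : Fin (n - 1), ((genComplex n i).tensor P).Contractible

end BarNatan

end

/-! Write `P` for `D` with vertical strands added. The tensor product of `C` and `P` is the total
complex of a double complex whose column of index `q` is `C` tensored with the object `P.K.X q`. The
column of index zero is `C` tensored with the identity diagram, that is `C` itself. If every column
of positive index is contractible, then the total complex is homotopy equivalent to the column of
index zero. Hence it suffices that `C` kills all objects `P.K.X q` with `q > 0`. The other side is
the mirror image, obtained from the same argument for the flipped bifunctor.

Why the columns are contractible: every diagram is isomorphic in Bar-Natan's category to a finite
direct sum of shifted diagrams in normal form, all caps before all cups. To get there, a cap is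
moved past a cup. The two commute if they are far apart, cancel if they are adjacent, and form a
circle if they face each other, and a circle is a sum of two shifted copies of the identity by neck
cutting. A normal form with as many endpoints on either side is the identity or a turnback, which
begins with a cap and ends with a cup. Since a universal projector has no identity summand in
positive degree, its terms there are sums of turnbacks (`IsUniversalProjector.isProjectorLike`).
This property survives the addition of strands on the right. Finally, `C` kills each cap because a
shifted cap is a retract of a generator followed by that cap, the composite being the cap with a
circle (`kills_cap`). So `C` kills everything that begins with a cap (`kills_of_startsCap`); cups on
the other side are treated in the same way.

The homological part is `tot_homotopyEquiv`. The column homotopies need not be compatible with the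
maps between columns. Their sum `s` therefore satisfies `ds + sd = 1 + N` on the positive columns
only up to an error `N` that raises the column index by one. As both complexes are bounded below,
`N` is nilpotent in each degree, so `ds + sd` is invertible there, and
`homotopyEquiv_of_contraction` applies. The rest of the file supplies the associators, unitors,
planar isotopies and extensions to direct sums on which these arguments depend. -/

/-! ### Homological algebra -/

/-! ### Contracting the kernel of a degreewise split projection -/

section Deformation

variable {V : Type*} [Category* V] [Preadditive V]

theorem isIso_id_add_of_pow_eq_zero {X : V} (N : X ⟶ X) (r : ℕ) (h : (End.of N) ^ r = 0) :
    IsIso (𝟙 X + N) :=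
  (isUnit_iff_isIso (1 + End.of N : End X)).1 (IsNilpotent.isUnit_one_add ⟨r, h⟩)

/-- A degreewise split epimorphism of complexes is a homotopy equivalence if its kernel carries
maps `s` of degree `-1` such that `ds + sd` is invertible on the kernel. -/
theorem homotopyEquiv_of_contraction {T B : CochainComplex V ℤ} (π : T ⟶ B)
    (σ : ∀ i, B.X i ⟶ T.X i) (hσ : ∀ i, σ i ≫ π.f i = 𝟙 _) (s : ∀ i j, T.X i ⟶ T.X j)
    (hs : ∀ i j, ¬ (ComplexShape.up ℤ).Rel j i → s i j = 0) (hsπ : ∀ i j, s i j ≫ π.f j = 0)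
    (hu : ∀ i, IsIso (π.f i ≫ σ i + (𝟙 _ - π.f i ≫ σ i) ≫ (Homotopy.nullHomotopicMap s).f i)) :
    Nonempty (HomotopyEquiv T B) := by
  let G := Homotopy.nullHomotopicMap s
  have hGπ : ∀ i, G.f i ≫ π.f i = 0 := fun i => by
    have : G ≫ π = 0 := by
      rw [Homotopy.nullHomotopicMap_comp]
      ext i
      simp [Homotopy.nullHomotopicMap, hsπ, dNext, prevD]
    exact congrArg (fun f => f.f i) this
  -- In each degree `e` is the idempotent onto the kernel of `π`. The map `u` is the identity on the
  -- image of `σ` and equals `G = ds + sd` on the kernel, so it commutes with `e`.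
  let e : ∀ i, T.X i ⟶ T.X i := fun i => 𝟙 _ - π.f i ≫ σ i
  let u : ∀ i, T.X i ⟶ T.X i := fun i => π.f i ≫ σ i + e i ≫ G.f i
  have : ∀ i, IsIso (u i) := hu
  have heπ : ∀ i, e i ≫ π.f i = 0 := fun i => by simp [e, hσ]
  have hee : ∀ i, e i ≫ e i = e i := fun i => by
    conv_lhs => arg 2; simp only [e]
    rw [Preadditive.comp_sub, reassoc_of% heπ]; simp
  have heu : ∀ i, e i ≫ u i = e i ≫ G.f i := fun i => by
    simp only [u, Preadditive.comp_add, reassoc_of% heπ, reassoc_of% hee]; simp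
  have hue : ∀ i, u i ≫ e i = e i ≫ G.f i := fun i => by
    conv_lhs => arg 2; simp only [e]
    simp only [u, Preadditive.comp_sub, Preadditive.add_comp, Category.assoc, reassoc_of% hσ,
      reassoc_of% hGπ]
    simp
  have hinv : ∀ i, e i ≫ inv (u i) = inv (u i) ≫ e i := fun i => by
    rw [IsIso.comp_inv_eq, Category.assoc, heu, ← hue, IsIso.inv_hom_id_assoc]
  -- The kernel of `π` is a subcomplex. On it `u` agrees with the chain map `G`, so its inverse
  -- commutes with the differential there too.
  have hed : ∀ i j, e i ≫ T.d i j ≫ e j = e i ≫ T.d i j := fun i j => by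
    conv_lhs => arg 2; arg 2; simp only [e]
    rw [Preadditive.comp_sub, Preadditive.comp_sub, ← π.comm_assoc, reassoc_of% heπ]; simp
  have heud : ∀ i j, e i ≫ u i ≫ T.d i j = e i ≫ T.d i j ≫ u j := fun i j => by
    rw [reassoc_of% heu, G.comm, ← reassoc_of% hed, ← heu, reassoc_of% hed]
  have hdinv : ∀ i j, e i ≫ T.d i j ≫ inv (u j) = e i ≫ inv (u i) ≫ T.d i j := fun i j => by
    rw [← cancel_epi (u i), reassoc_of% hue, ← reassoc_of% heu, reassoc_of% heud,
      IsIso.hom_inv_id, Category.comp_id, ← Category.assoc (e i) (inv _), hinv,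
      Category.assoc, IsIso.hom_inv_id_assoc]
  -- Division of `s` by `ds + sd` on the kernel yields a true contraction of the kernel, extended by
  -- zero on the image of `σ`.
  let H : ∀ i j, T.X i ⟶ T.X j := fun i j => e i ≫ inv (u i) ≫ s i j
  let N := Homotopy.nullHomotopicMap H
  have hNf : ∀ (t : ∀ i j, T.X i ⟶ T.X j) (i : ℤ), (Homotopy.nullHomotopicMap t).f i =
      T.d i (i + 1) ≫ t (i + 1) i + t i (i - 1) ≫ T.d (i - 1) i := fun t i =>
    Homotopy.nullHomotopicMap_f (c := ComplexShape.up ℤ) (by simp) (by simp) t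
  have heN : ∀ i, e i ≫ N.f i = e i := fun i => by
    have h1 : e i ≫ N.f i = inv (u i) ≫ e i ≫ G.f i := by
      simp only [N, G, hNf, H, Preadditive.comp_add, Category.assoc, reassoc_of% hed,
        reassoc_of% hdinv, reassoc_of% hee, reassoc_of% hinv]
    rw [h1, ← hue, IsIso.inv_hom_id_assoc]
  have hNπ : N ≫ π = 0 := by
    rw [Homotopy.nullHomotopicMap_comp]
    ext i
    simp [Homotopy.nullHomotopicMap, hsπ, H, dNext, prevD]
  -- Since `N` is the identity on the kernel of `π`, `Φ` vanishes there and factors through `π`; the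
  -- factor `τ` is the homotopy inverse.
  let Φ : T ⟶ T := 𝟙 T - N
  have heΦ : ∀ i, e i ≫ Φ.f i = 0 := fun i => by simp [Φ, heN]
  have hΦ : ∀ i, π.f i ≫ σ i ≫ Φ.f i = Φ.f i := fun i => by
    have := heΦ i
    simp only [e, Preadditive.sub_comp, Category.id_comp, sub_eq_zero, Category.assoc] at this
    exact this.symm
  have hΦπ : Φ ≫ π = π := by simp [Φ, hNπ]
  let τ : B ⟶ T :=
    { f := fun i => σ i ≫ Φ.f i
      comm' := fun i j _ => by
        -- The section `σ` need not be a chain map, but its defect lies in the kernel of `π`, where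
        -- `Φ` is zero.
        have h : σ i ≫ T.d i j = B.d i j ≫ σ j + σ i ≫ T.d i j ≫ e j := by
          simp only [e, Preadditive.comp_sub, Category.comp_id]
          rw [← π.comm_assoc, reassoc_of% hσ]; abel
        rw [Category.assoc, Φ.comm, ← Category.assoc, h, Preadditive.add_comp]
        simp only [Category.assoc, heΦ, comp_zero, add_zero] }
  have hπτ : π ≫ τ = Φ := by ext i; exact hΦ i
  have hτπ : τ ≫ π = 𝟙 B := by
    ext i
    have := congrArg (fun f => f.f i) hΦπ
    simp only [HomologicalComplex.comp_f] at this
    simp [τ, this, hσ]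
  have hNh : Homotopy N 0 := Homotopy.nullHomotopy H fun i j hij => by simp [H, hs i j hij]
  have hΦh : Homotopy Φ (𝟙 T) :=
    (Homotopy.equivSubZero.symm ((Homotopy.ofEq (by simp [Φ])).trans hNh)).symm
  exact ⟨⟨π, τ, (Homotopy.ofEq hπτ).trans hΦh, Homotopy.ofEq hτπ⟩⟩

theorem homotopy_id_zero_comm {K : CochainComplex V ℤ} (h : Homotopy (𝟙 K) 0) (p : ℤ) :
    K.d p (p + 1) ≫ h.hom (p + 1) p + h.hom p (p - 1) ≫ K.d (p - 1) p = 𝟙 (K.X p) := by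
  have := h.comm p
  rw [dNext_eq h.hom (show (ComplexShape.up ℤ).Rel p (p + 1) by simp),
    prevD_eq h.hom (show (ComplexShape.up ℤ).Rel (p - 1) p by simp)] at this
  simpa using this.symm

end Deformation

/-! ### Total complexes with contractible columns -/

section Total

variable {A B V : Type*} [Category* A] [Category* B] [Category* V]
  [Preadditive A] [Preadditive B] [Preadditive V] (F : A ⥤ B ⥤ V)

instance [F.Additive] : ∀ M : B, (F.flip.obj M).Additive := fun M =>
  { map_add := fun {_ _ f g} => congrArg (fun α => α.app M) (F.map_add (f := f) (g := g)) }

instance [∀ M, (F.obj M).Additive] : F.flip.Additive :=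
  { map_add := fun {_ _ f g} => by ext M; exact (F.obj M).map_add }

variable [F.Additive]

/-- The complex obtained from a complex by fixing the second argument of a bifunctor. -/
noncomputable abbrev colComplex (K : CochainComplex A ℤ) (M : B) : CochainComplex V ℤ :=
  ((F.flip.obj M).mapHomologicalComplex (ComplexShape.up ℤ)).obj K

variable {F} {K : CochainComplex A ℤ}

/-- The component of a homotopy on a column. -/
noncomputable def colHom {M : B} (h : Homotopy (𝟙 (colComplex F K M)) 0) (p p' : ℤ) :
    (F.obj (K.X p)).obj M ⟶ (F.obj (K.X p')).obj M := h.hom p p'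

theorem colHom_comm {M : B} (h : Homotopy (𝟙 (colComplex F K M)) 0) (p : ℤ) :
    (F.map (K.d p (p + 1))).app M ≫ colHom h (p + 1) p +
      colHom h p (p - 1) ≫ (F.map (K.d (p - 1) p)).app M = 𝟙 _ :=
  homotopy_id_zero_comm h p

variable [∀ M, (F.obj M).Additive]

variable (F) (K) (L : CochainComplex B ℤ)
  [HomologicalComplex.HasMapBifunctor K L F (ComplexShape.up ℤ)]

open HomologicalComplex

/-- The total complex of a bifunctor applied to two complexes. -/
noncomputable abbrev tot : CochainComplex V ℤ := mapBifunctor K L F (ComplexShape.up ℤ)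

/-- The inclusion of a summand of the total complex. -/
noncomputable abbrev ιTot (p q n : ℤ) (h : p + q = n) :
    (F.obj (K.X p)).obj (L.X q) ⟶ (tot F K L).X n :=
  ιMapBifunctor K L F (ComplexShape.up ℤ) p q n h

/-- The first differential enters with sign one. The sign of the second only matters as a unit, and
is left unspecified. -/
theorem exists_ιTot_d {p q n p' q' n' : ℤ} (h : p + q = n) (hp : p + 1 = p') (hq : q + 1 = q')
    (hn : n + 1 = n') : ∃ ε : ℤˣ, ιTot F K L p q n h ≫ (tot F K L).d n n' =
      (F.map (K.d p p')).app (L.X q) ≫ ιTot F K L p' q n' (by omega) +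
        ε • (F.obj (K.X p)).map (L.d q q') ≫ ιTot F K L p q' n' (by omega) := by
  refine ⟨ComplexShape.ε₂ (ComplexShape.up ℤ) (ComplexShape.up ℤ) (ComplexShape.up ℤ) (p, q), ?_⟩
  rw [mapBifunctor.d_eq, Preadditive.comp_add, mapBifunctor.ι_D₁, mapBifunctor.ι_D₂,
    mapBifunctor.d₁_eq K L F (ComplexShape.up ℤ) (show (ComplexShape.up ℤ).Rel p p' from hp) q
      n' (show p' + q = n' by omega),
    mapBifunctor.d₂_eq K L F (ComplexShape.up ℤ) p (show (ComplexShape.up ℤ).Rel q q' from hq)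
      n' (show p + q' = n' by omega)]
  exact congrArg (· + _) (one_smul _ _)

variable {F K L} in
/-- Morphisms from the total complex, given by their components. -/
noncomputable def totDesc {Y : V} {n : ℤ}
    (f : ∀ p q : ℤ, p + q = n → ((F.obj (K.X p)).obj (L.X q) ⟶ Y)) : (tot F K L).X n ⟶ Y :=
  mapBifunctorDesc f

variable {F K L} in
theorem ιTot_desc {Y : V} {n : ℤ}
    (f : ∀ p q : ℤ, p + q = n → ((F.obj (K.X p)).obj (L.X q) ⟶ Y)) (p q : ℤ) (h : p + q = n) :
    ιTot F K L p q n h ≫ totDesc f = f p q h :=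
  ι_mapBifunctorDesc (K₁ := K) (K₂ := L) (F := F) (c := ComplexShape.up ℤ)
    (fun p q h => f p q h) p q h

variable {F K L} in
theorem tot_hom_ext {Y : V} {n : ℤ} {f g : (tot F K L).X n ⟶ Y}
    (H : ∀ p q h, ιTot F K L p q n h ≫ f = ιTot F K L p q n h ≫ g) : f = g :=
  mapBifunctor.hom_ext H

/-- The projection of the total complex to the column of index zero, in one degree. -/
noncomputable def totProjX (n : ℤ) : (tot F K L).X n ⟶ (F.obj (K.X n)).obj (L.X 0) :=
  totDesc fun p q h => if hq : q = 0 then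
    eqToHom (by obtain rfl : p = n := by omega
                subst hq; rfl) else 0

theorem ιTot_proj_zero (n : ℤ) (h : n + 0 = n) : ιTot F K L n 0 n h ≫ totProjX F K L n = 𝟙 _ := by
  rw [totProjX, ιTot_desc, dif_pos rfl, eqToHom_refl]

theorem ιTot_proj_of_ne {p q n : ℤ} (h : p + q = n) (hq : q ≠ 0) :
    ιTot F K L p q n h ≫ totProjX F K L n = 0 := by
  rw [totProjX, ιTot_desc, dif_neg hq]

/-- The total differential never lowers `q`, so the summands with `q > 0` form a subcomplex. As
there are none with `q < 0`, the quotient is the column of index zero. -/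
theorem totProjX_comm (hL : ∀ q < 0, IsZero (L.X q)) (n n' : ℤ) (hn : n + 1 = n') :
    totProjX F K L n ≫ (F.map (K.d n n')).app (L.X 0) =
      (tot F K L).d n n' ≫ totProjX F K L n' := by
  refine tot_hom_ext fun p q h => ?_
  obtain ⟨ε, hε⟩ := exists_ιTot_d F K L h rfl rfl hn
  rw [← Category.assoc (ιTot F K L p q n h) ((tot F K L).d n n'), hε,
    Preadditive.add_comp, Category.assoc, Linear.units_smul_comp, Category.assoc]
  by_cases hq : q = 0
  · subst hq
    obtain rfl : p = n := by omega
    subst hn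
    rw [← Category.assoc, ιTot_proj_zero, ιTot_proj_zero, ιTot_proj_of_ne F K L _ (by omega)]
    simp
  · rcases lt_or_ge q 0 with hq' | hq'
    · exact ((F.obj (K.X p)).map_isZero (hL q hq')).eq_of_src _ _
    · rw [← Category.assoc, ιTot_proj_of_ne F K L _ hq, ιTot_proj_of_ne F K L _ hq,
        ιTot_proj_of_ne F K L _ (by omega)]
      simp

/-- The projection of the total complex to the column of index zero. -/
noncomputable def totProj (hL : ∀ q < 0, IsZero (L.X q)) :
    tot F K L ⟶ colComplex F K (L.X 0) where
  f n := totProjX F K L n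
  comm' n n' hn := totProjX_comm F K L hL n n' hn

section Contraction

variable (h : ∀ q : ℤ, 0 < q → Homotopy (𝟙 (colComplex F K (L.X q))) 0)

variable {F K L}

/-- The sum of homotopies on the columns of positive index, as maps on the total complex. -/
noncomputable def totHom (i j : ℤ) : (tot F K L).X i ⟶ (tot F K L).X j :=
  totDesc fun p q hpq => if hj : j + 1 = i ∧ 0 < q then
    colHom (h q hj.2) p (p - 1) ≫ ιTot F K L (p - 1) q j (by omega) else 0

theorem ιTot_hom {p q i : ℤ} (p' j : ℤ) (hpq : p + q = i) (hpq' : p' + q = j) (hp : p' + 1 = p)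
    (hq : 0 < q) : ιTot F K L p q i hpq ≫ totHom h i j =
      colHom (h q hq) p p' ≫ ιTot F K L p' q j hpq' := by
  obtain rfl : p' = p - 1 := by omega
  rw [totHom, ιTot_desc, dif_pos ⟨by omega, hq⟩]

/-- Within a column, `ds + sd` is the identity. The remaining terms combine a column homotopy with
the second differential; there is no reason for them to cancel, but all of them land in the single
summand of index `(p - 1, q + 1)`. -/
theorem exists_ιTot_nullHomotopicMap {p q n : ℤ} (hpq : p + q = n) (hq : 0 < q) :
    ∃ x, ιTot F K L p q n hpq ≫ (Homotopy.nullHomotopicMap (totHom h)).f n =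
      ιTot F K L p q n hpq + x ≫ ιTot F K L (p - 1) (q + 1) n (by omega) := by
  rw [Homotopy.nullHomotopicMap_f (c := ComplexShape.up ℤ) (k₂ := n - 1) (k₀ := n + 1)
    (by simp) (by simp)]
  obtain ⟨ε, hε⟩ := exists_ιTot_d F K L hpq rfl rfl rfl
  obtain ⟨ε', hε'⟩ := exists_ιTot_d F K L (show p - 1 + q = n - 1 by omega)
    (show p - 1 + 1 = p by omega) rfl (show n - 1 + 1 = n by omega)
  refine ⟨ε • (F.obj (K.X p)).map (L.d q (q + 1)) ≫ colHom (h (q + 1) (by omega)) p (p - 1) +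
    colHom (h q hq) p (p - 1) ≫ (ε' • (F.obj (K.X (p - 1))).map (L.d q (q + 1))), ?_⟩
  rw [Preadditive.comp_add, reassoc_of% hε, Preadditive.add_comp, Category.assoc,
    Linear.units_smul_comp, Category.assoc,
    ιTot_hom h p n (by omega) hpq (by omega) hq,
    ιTot_hom h (p - 1) n (by omega) (by omega) (by omega) (by omega),
    ← Category.assoc (ιTot F K L p q n hpq), ιTot_hom h (p - 1) (n - 1) hpq (by omega) (by omega) hq, Category.assoc, hε']
  have hc := colHom_comm (h q hq) p
  conv_rhs => rw [← Category.id_comp (ιTot F K L p q n hpq), ← hc]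
  simp only [Preadditive.add_comp, Preadditive.comp_add, Category.assoc, Linear.units_smul_comp,
    Linear.comp_units_smul]
  abel

theorem totHom_proj (i j : ℤ) : totHom h i j ≫ totProjX F K L j = 0 := by
  refine tot_hom_ext fun p q hpq => ?_
  rw [← Category.assoc, totHom, ιTot_desc, comp_zero]
  split_ifs with hj
  · rw [Category.assoc, ιTot_proj_of_ne F K L _ (by omega), comp_zero]
  · rw [zero_comp]

/-- If all columns of positive index are contractible and there are no columns of negative index,
then the total complex is homotopy equivalent to the column of index zero. -/
theorem tot_homotopyEquiv (hK : ∃ N, ∀ p < N, IsZero (K.X p)) (hL : ∀ q < 0, IsZero (L.X q))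
    (h : ∀ q : ℤ, 0 < q → Nonempty (Homotopy (𝟙 (colComplex F K (L.X q))) 0)) :
    Nonempty (HomotopyEquiv (tot F K L) (colComplex F K (L.X 0))) := by
  have h : ∀ q : ℤ, 0 < q → Homotopy (𝟙 (colComplex F K (L.X q))) 0 := fun q hq => (h q hq).some
  obtain ⟨M, hM⟩ := hK
  refine homotopyEquiv_of_contraction (totProj F K L hL)
    (fun n => ιTot F K L n 0 n (add_zero n)) (fun n => ιTot_proj_zero F K L n _) (totHom h)
    (fun i j hij => tot_hom_ext fun p q hpq => ?_) (totHom_proj h) (fun n => ?_)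
  · rw [totHom, ιTot_desc, dif_neg fun hj => hij hj.1, comp_zero]
  change IsIso (totProjX F K L n ≫ ιTot F K L n 0 n (add_zero n) +
    (𝟙 _ - totProjX F K L n ≫ ιTot F K L n 0 n (add_zero n)) ≫ _)
  set e : (tot F K L).X n ⟶ (tot F K L).X n :=
    𝟙 _ - totProjX F K L n ≫ ιTot F K L n 0 n (add_zero n) with he
  -- The map to be inverted is `𝟙 + N`: the error on the positive columns, extended by zero to the
  -- column of index zero.
  set N : (tot F K L).X n ⟶ (tot F K L).X n :=
    e ≫ ((Homotopy.nullHomotopicMap (totHom h)).f n - 𝟙 _) with hN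
  have hNι : ∀ p q (hpq : p + q = n), ∃ x, ιTot F K L p q n hpq ≫ N =
      x ≫ ιTot F K L (p - 1) (q + 1) n (by omega) := fun p q hpq => by
    rcases lt_trichotomy q 0 with hq | rfl | hq
    · exact ⟨0, ((F.obj (K.X p)).map_isZero (hL q hq)).eq_of_src _ _⟩
    · obtain rfl : p = n := by omega
      refine ⟨0, ?_⟩
      rw [hN, he, ← Category.assoc, Preadditive.comp_sub (ιTot F K L p 0 p hpq),
        ← Category.assoc (ιTot F K L p 0 p hpq), ιTot_proj_zero]
      simp
    · obtain ⟨x, hx⟩ := exists_ιTot_nullHomotopicMap h hpq hq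
      refine ⟨x, ?_⟩
      rw [hN, he, ← Category.assoc, Preadditive.comp_sub (ιTot F K L p q n hpq),
        ← Category.assoc (ιTot F K L p q n hpq),
        ιTot_proj_of_ne F K L _ (by omega), zero_comp, sub_zero, Category.comp_id,
        Preadditive.comp_sub, hx]
      simp
  have hpow : ∀ (r : ℕ) p q p' q' (hpq : p + q = n) (hp : p' + r = p) (hq : q + r = q'),
      ∃ x, ιTot F K L p q n hpq ≫ ((End.of N ^ r : End _) : (tot F K L).X n ⟶ (tot F K L).X n) =
        x ≫ ιTot F K L p' q' n (by omega) := by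
    intro r
    induction r with
    | zero =>
      intro p q p' q' hpq hp hq
      obtain rfl : p' = p := by simpa using hp
      obtain rfl : q = q' := by simpa using hq
      exact ⟨𝟙 _, (Category.comp_id _).trans (Category.id_comp _).symm⟩
    | succ r ih =>
      intro p q p' q' hpq hp hq
      push_cast at hp hq
      obtain ⟨x, hx⟩ := hNι p q hpq
      obtain ⟨y, hy⟩ := ih (p - 1) (q + 1) p' q' (by omega) (by omega) (by omega)
      refine ⟨x ≫ y, ?_⟩
      rw [pow_succ, Category.assoc, ← hy, ← Category.assoc, ← hx, Category.assoc]
      rfl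
  -- A nonzero summand has `q ≥ 0`, hence `p ≤ n`. The power `N ^ r` moves it to first index `p - r
  -- ≤ n - r < M`, where `K` is zero.
  obtain ⟨r, hr⟩ : ∃ r : ℕ, n - r < M := ⟨(n - M + 1).toNat, by omega⟩
  have hNr : End.of N ^ r = 0 := by
    refine tot_hom_ext fun p q hpq => ?_
    rcases lt_or_ge q 0 with hq | hq
    · exact ((F.obj (K.X p)).map_isZero (hL q hq)).eq_of_src _ _
    · obtain ⟨x, hx⟩ := hpow r p q (p - r) (q + r) hpq (by omega) rfl
      refine hx.trans ?_
      have : IsZero ((F.obj (K.X (p - r))).obj (L.X (q + r))) :=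
        (F.flip.obj _).map_isZero (hM (p - r) (by omega))
      rw [this.eq_of_src (ιTot F K L (p - r) (q + r) n _) 0, comp_zero]
      exact comp_zero.symm
  have hu : totProjX F K L n ≫ ιTot F K L n 0 n (add_zero n) +
      e ≫ (Homotopy.nullHomotopicMap (totHom h)).f n = 𝟙 _ + N := by
    rw [hN, Preadditive.comp_sub, he]
    simp only [Category.comp_id]
    abel
  rw [hu]
  exact isIso_id_add_of_pow_eq_zero N r hNr

end Contraction

end Total

/-! ### Null complexes and objects killed by a complex -/

section Null

variable {A B V W : Type*} [Category* A] [Category* B] [Category* V] [Category* W]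
  [Preadditive A] [Preadditive B] [Preadditive V] [Preadditive W]

/-- A complex is null if its identity is homotopic to zero. -/
def IsNull (K : CochainComplex V ℤ) : Prop := Nonempty (Homotopy (𝟙 K) 0)

/-- The identity of `K` is homotopic to a map that factors through the identity of `L`. Requiring `i
≫ r` to be the identity only up to homotopy covers homotopy equivalences as well as honest retracts.
-/
theorem IsNull.of_retract {K L : CochainComplex V ℤ} (i : K ⟶ L) (r : L ⟶ K) (h : Homotopy (i ≫ r) (𝟙 K))
    (hL : IsNull L) : IsNull K :=
  hL.elim fun hL => ⟨h.symm.trans ((Homotopy.ofEq (by simp)).trans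
    (((hL.compRight r).compLeft i).trans (Homotopy.ofEq (by simp))))⟩

theorem IsNull.of_homotopyEquiv {K L : CochainComplex V ℤ} (e : HomotopyEquiv K L)
    (hL : IsNull L) : IsNull K := hL.of_retract e.hom e.inv e.homotopyHomInvId

theorem isNull_zero [HasZeroObject V] : IsNull (0 : CochainComplex V ℤ) :=
  ⟨Homotopy.ofEq ((isZero_zero _).eq_of_src _ _)⟩

theorem IsNull.map {K : CochainComplex V ℤ} (hK : IsNull K) (G : V ⥤ W) [G.Additive] :
    IsNull ((G.mapHomologicalComplex _).obj K) :=
  hK.elim fun h => ⟨(Homotopy.ofEq (by simp)).trans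
    ((G.mapHomotopy h).trans (Homotopy.ofEq (by simp)))⟩

theorem IsNull.of_natIso {G H : A ⥤ V} [G.Additive] [H.Additive] (e : G ≅ H)
    {K : CochainComplex A ℤ} (hK : IsNull ((G.mapHomologicalComplex _).obj K)) :
    IsNull ((H.mapHomologicalComplex _).obj K) :=
  hK.of_homotopyEquiv
    (HomotopyEquiv.ofIso ((NatIso.mapHomologicalComplex e (ComplexShape.up ℤ)).symm.app K))

variable (F : A ⥤ B ⥤ V) [F.Additive] (K : CochainComplex A ℤ)

/-- The morphism of complexes induced by a morphism in the second argument of a bifunctor. -/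
noncomputable def colMap {M N : B} (f : M ⟶ N) : colComplex F K M ⟶ colComplex F K N :=
  (NatTrans.mapHomologicalComplex (F.flip.map f) (ComplexShape.up ℤ)).app K

theorem colMap_comp {M N P : B} (f : M ⟶ N) (g : N ⟶ P) :
    colMap F K (f ≫ g) = colMap F K f ≫ colMap F K g := by
  ext i; exact (F.obj (K.X i)).map_comp f g

theorem colMap_id (M : B) : colMap F K (𝟙 M) = 𝟙 _ := by
  ext i; exact (F.obj (K.X i)).map_id M

variable {F K}

/-- The bifunctor, with second argument fixed to `M`, sends the complex `K` to a null complex. -/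
def Kills (F : A ⥤ B ⥤ V) [F.Additive] (K : CochainComplex A ℤ) (M : B) : Prop :=
  IsNull (colComplex F K M)

theorem Kills.of_retract {M N : B} (i : M ⟶ N) (r : N ⟶ M) (h : i ≫ r = 𝟙 M) (hN : Kills F K N) :
    Kills F K M :=
  IsNull.of_retract (colMap F K i) (colMap F K r)
    (Homotopy.ofEq (by rw [← colMap_comp, h, colMap_id])) hN

theorem Kills.of_iso {M N : B} (e : M ≅ N) (hN : Kills F K N) : Kills F K M :=
  hN.of_retract e.hom e.inv e.hom_inv_id

variable [∀ M, (F.obj M).Additive]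

theorem colMap_sum {M N : B} {J : Type*} (s : Finset J) (f : J → (M ⟶ N)) :
    colMap F K (∑ j ∈ s, f j) = ∑ j ∈ s, colMap F K (f j) := by
  ext i
  exact ((F.obj (K.X i)).map_sum f s).trans
    (map_sum (HomologicalComplex.Hom.fAddMonoidHom i) (fun j => colMap F K (f j)) s).symm

/-- The identity of the biproduct is a finite sum of maps `π ≫ ι`, each of which factors through a
null complex after `colMap`; the null homotopies are added up. -/
theorem Kills.biproduct {J : Type} [Finite J] (f : J → B) [HasBiproduct f]
    (h : ∀ j, Kills F K (f j)) : Kills F K (⨁ f) := by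
  have := Fintype.ofFinite J
  have hs : ∀ s : Finset J, Nonempty (Homotopy
      (∑ j ∈ s, colMap F K (biproduct.π f j ≫ biproduct.ι f j)) 0) := fun s => by
    classical
    induction s using Finset.induction_on with
    | empty => exact ⟨Homotopy.ofEq Finset.sum_empty⟩
    | insert j s hj ih =>
      obtain ⟨ih⟩ := ih
      obtain ⟨hj'⟩ := h j
      refine ⟨(Homotopy.ofEq (Finset.sum_insert hj)).trans
        (((Homotopy.add ?_ ih)).trans (Homotopy.ofEq (add_zero 0)))⟩
      exact (Homotopy.ofEq (by rw [colMap_comp, Category.id_comp])).trans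
        (((hj'.compRight (colMap F K (biproduct.ι f j))).compLeft
          (colMap F K (biproduct.π f j))).trans (Homotopy.ofEq (by simp)))
  obtain ⟨t⟩ := hs Finset.univ
  refine ⟨(Homotopy.ofEq ?_).trans t⟩
  exact (colMap_id F K (⨁ f)).symm.trans
    ((congrArg (colMap F K) biproduct.total.symm).trans (colMap_sum _ _))

end Null

/-! ### Additive functors on categories of matrices -/

section Matrices

variable {C D : Type*} [Category* C] [Preadditive C] [Category* D] [Preadditive D]

namespace CategoryTheory.Mat_

/-- The projection of a formal direct sum to a summand. -/
noncomputable def proj (M : Mat_ C) (i : M.ι) : M ⟶ (embedding C).obj (M.X i) :=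
  M.isoBiproductEmbedding.hom ≫ biproduct.π (fun i => (embedding C).obj (M.X i)) i

/-- The inclusion of a summand of a formal direct sum. -/
noncomputable def incl (M : Mat_ C) (i : M.ι) : (embedding C).obj (M.X i) ⟶ M :=
  biproduct.ι (fun i => (embedding C).obj (M.X i)) i ≫ M.isoBiproductEmbedding.inv

theorem proj_incl_total (M : Mat_ C) : ∑ i, M.proj i ≫ M.incl i = 𝟙 M := by
  have h := biproduct.total (f := fun i => (embedding C).obj (M.X i))
  rw [← M.isoBiproductEmbedding.hom_inv_id, ← Category.comp_id M.isoBiproductEmbedding.hom, ← h,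
    Preadditive.comp_sum, Preadditive.sum_comp]
  simp only [proj, incl, Category.assoc]

theorem sum_map_proj_incl (G : Mat_ C ⥤ D) [G.Additive] (M : Mat_ C) :
    ∑ i, G.map (M.proj i) ≫ G.map (M.incl i) = 𝟙 (G.obj M) := by
  rw [← G.map_id, ← proj_incl_total, G.map_sum]
  simp only [G.map_comp]

variable {G H L : Mat_ C ⥤ D} [G.Additive] [H.Additive] [L.Additive]

/-- A natural transformation between additive functors on a category of matrices, from its
restriction. -/
noncomputable def natTransOfEmbedding
    (α : ∀ X, G.obj ((embedding C).obj X) ⟶ H.obj ((embedding C).obj X))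
    (hα : ∀ {X Y : C} (g : (embedding C).obj X ⟶ (embedding C).obj Y),
      G.map g ≫ α Y = α X ≫ H.map g) : G ⟶ H where
  app M := ∑ i, G.map (M.proj i) ≫ α (M.X i) ≫ H.map (M.incl i)
  naturality M N f := by
    -- Expanding `f` over the summands of source and target reduces naturality to the entries of
    -- `f`, which are maps between one-term sums, where `hα` applies.
    have h1 : G.map f = ∑ i, G.map (M.proj i) ≫ G.map (M.incl i ≫ f) := by
      rw [← Category.id_comp (G.map f), ← sum_map_proj_incl, Preadditive.sum_comp]
      simp only [G.map_comp, Category.assoc]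
    have h2 : H.map f = ∑ j, H.map (f ≫ N.proj j) ≫ H.map (N.incl j) := by
      rw [← Category.comp_id (H.map f), ← sum_map_proj_incl, Preadditive.comp_sum]
      simp only [H.map_comp, Category.assoc]
    conv_lhs => rw [h1]
    conv_rhs => rw [h2]
    simp only [Preadditive.sum_comp, Preadditive.comp_sum]
    refine Finset.sum_congr rfl fun j _ => ?_
    refine Finset.sum_congr rfl fun i _ => ?_
    have := hα ((M.incl i ≫ f) ≫ N.proj j)
    rw [G.map_comp, Category.assoc] at this
    calc (G.map (M.proj i) ≫ G.map (M.incl i ≫ f)) ≫ G.map (N.proj j) ≫ α _ ≫ H.map (N.incl j)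
      _ = G.map (M.proj i) ≫ (G.map (M.incl i ≫ f) ≫ G.map (N.proj j) ≫ α _) ≫
          H.map (N.incl j) := by simp only [Category.assoc]
      _ = _ := by rw [this]; simp only [Category.assoc, H.map_comp]

theorem natTransOfEmbedding_app_embedding
    (α : ∀ X, G.obj ((embedding C).obj X) ⟶ H.obj ((embedding C).obj X))
    (hα : ∀ {X Y : C} (g : (embedding C).obj X ⟶ (embedding C).obj Y),
      G.map g ≫ α Y = α X ≫ H.map g) (X : C) :
    (natTransOfEmbedding α hα).app ((embedding C).obj X) = α X := by
  have h : ∀ P I : (embedding C).obj X ⟶ (embedding C).obj X,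
      G.map P ≫ α X ≫ H.map I = α X ≫ H.map P ≫ H.map I := fun P I => by
    rw [← Category.assoc, hα, Category.assoc]
  refine (Finset.sum_congr (s₁ := Finset.univ) rfl fun i _ =>
    h (((embedding C).obj X).proj i) (((embedding C).obj X).incl i)).trans ?_
  rw [← Preadditive.comp_sum]
  exact (congrArg (α X ≫ ·) (sum_map_proj_incl H _)).trans (Category.comp_id _)

theorem natTransOfEmbedding_comp_eq_id
    (α : ∀ X, G.obj ((embedding C).obj X) ⟶ H.obj ((embedding C).obj X))
    (hα : ∀ {X Y : C} (g : (embedding C).obj X ⟶ (embedding C).obj Y),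
      G.map g ≫ α Y = α X ≫ H.map g)
    (β : ∀ X, H.obj ((embedding C).obj X) ⟶ G.obj ((embedding C).obj X))
    (hβ : ∀ {X Y : C} (g : (embedding C).obj X ⟶ (embedding C).obj Y),
      H.map g ≫ β Y = β X ≫ G.map g) (h : ∀ X, α X ≫ β X = 𝟙 _) :
    natTransOfEmbedding α hα ≫ natTransOfEmbedding β hβ = 𝟙 G := by
  ext M
  refine (Preadditive.comp_sum _ _ _).trans ((Finset.sum_congr rfl fun i _ => ?_).trans
    (sum_map_proj_incl G M))
  rw [← Category.assoc, ← (natTransOfEmbedding α hα).naturality, natTransOfEmbedding_app_embedding,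
    Category.assoc, reassoc_of% h]

/-- Additive functors on a category of matrices are isomorphic if their restrictions are. -/
noncomputable def natIsoOfEmbedding
    (e : ∀ X, G.obj ((embedding C).obj X) ≅ H.obj ((embedding C).obj X))
    (he : ∀ {X Y : C} (g : X ⟶ Y), G.map ((embedding C).map g) ≫ (e Y).hom =
      (e X).hom ≫ H.map ((embedding C).map g)) : G ≅ H :=
  -- A matrix with one entry is, definitionally, the image under the embedding of that entry.
  have h1 : ∀ {X Y : C} (g : (embedding C).obj X ⟶ (embedding C).obj Y),
      G.map g ≫ (e Y).hom = (e X).hom ≫ H.map g := fun g => he (g PUnit.unit PUnit.unit)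
  have h2 : ∀ {X Y : C} (g : (embedding C).obj X ⟶ (embedding C).obj Y),
      H.map g ≫ (e Y).inv = (e X).inv ≫ G.map g := fun g => by
    rw [Iso.comp_inv_eq, Category.assoc, h1, Iso.inv_hom_id_assoc]
  { hom := natTransOfEmbedding (fun X => (e X).hom) h1
    inv := natTransOfEmbedding (fun X => (e X).inv) h2
    hom_inv_id := natTransOfEmbedding_comp_eq_id _ _ _ _ fun X => (e X).hom_inv_id
    inv_hom_id := natTransOfEmbedding_comp_eq_id _ _ _ _ fun X => (e X).inv_hom_id }

end CategoryTheory.Mat_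

/-- A binary biproduct as a biproduct over `Bool`. -/
noncomputable def biprodIsoBool [HasBinaryBiproducts D] [HasFiniteBiproducts D] (M N : D) :
    M ⊞ N ≅ ⨁ fun j : Bool => cond j M N :=
  let b : Bicone fun j : Bool => cond j M N :=
    { pt := M ⊞ N
      π := fun j => match j with
        | true => biprod.fst
        | false => biprod.snd
      ι := fun j => match j with
        | true => biprod.inl
        | false => biprod.inr
      ι_π := by rintro (_ | _) (_ | _) <;> simp }
  biproduct.uniqueUpToIso (b := b) _ (isBilimitOfTotal b (by simp [b, biprod.total]))

end Matrices

/-! ### Direct sums generated by a class of diagrams -/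

namespace BarNatan

variable {n m l : ℕ}

/-- The finite direct sums of objects whose diagrams have a property. -/
inductive Spanned (P : Diag n m → Prop) : Mat_ (Cob n m) → Prop
  | of (q : ℤ) (w : Diag n m) (h : P w) : Spanned P ((Mat_.embedding _).obj ⟨q, w⟩)
  | sum {J : Type} [Finite J] {M : Mat_ (Cob n m)} (f : J → Mat_ (Cob n m)) (e : M ≅ ⨁ f)
      (h : ∀ j, Spanned P (f j)) : Spanned P M

theorem Spanned.of_iso {P : Diag n m → Prop} {M N : Mat_ (Cob n m)} (e : M ≅ N)
    (h : Spanned P N) : Spanned P M :=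
  .sum (fun _ : Unit => N) (e ≪≫ (biproductUniqueIso (fun _ : Unit => N)).symm) fun _ => h

theorem Spanned.biprod {P : Diag n m → Prop} {M N : Mat_ (Cob n m)}
    (hM : Spanned P M) (hN : Spanned P N) : Spanned P (M ⊞ N) :=
  .sum (fun j : Bool => cond j M N) (biprodIsoBool M N) fun j => by cases j <;> assumption

theorem Spanned.of_forall {P : Diag n m → Prop} (M : Mat_ (Cob n m))
    (h : ∀ i, Spanned P ((Mat_.embedding _).obj (M.X i))) : Spanned P M :=
  .sum _ (Mat_.isoBiproductEmbedding M) h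

/-- An additive functor preserves spanned objects if it does so on diagrams. -/
theorem Spanned.map {n' m' : ℕ} {P : Diag n m → Prop} {Q : Diag n' m' → Prop}
    (G : Mat_ (Cob n m) ⥤ Mat_ (Cob n' m')) [G.Additive]
    (hG : ∀ q w, P w → Spanned Q (G.obj ((Mat_.embedding _).obj ⟨q, w⟩))) {M : Mat_ (Cob n m)}
    (h : Spanned P M) : Spanned Q (G.obj M) := by
  induction h with
  | of q w h => exact hG q w h
  | sum f e h ih => exact .sum _ (G.mapIso e ≪≫ G.mapBiproduct f) ih

end BarNatan

/-! ### Composition of combinatorial surfaces with cylinders and walls -/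

namespace BarNatan

namespace Surf

variable {n m l k : ℕ}

theorem SameType.symm {G G' : Graph n m} {S T : Surf G G'} (h : S.SameType T) : T.SameType S := by
  obtain ⟨e, h1, h2, h3, h4⟩ := h
  refine ⟨e.symm, fun p => ?_, fun p => ?_, fun c => ?_, fun c => ?_⟩
  · rw [← h1, e.symm_apply_apply]
  · rw [← h2, e.symm_apply_apply]
  · rw [h3, e.apply_symm_apply]
  · rw [h4, e.apply_symm_apply]

theorem SameType.trans {G G' : Graph n m} {S T U : Surf G G'} (h : S.SameType T)
    (h' : T.SameType U) : S.SameType U := by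
  obtain ⟨e, h1, h2, h3, h4⟩ := h
  obtain ⟨e', h1', h2', h3', h4'⟩ := h'
  exact ⟨e.trans e', fun p => (congrArg e' (h1 p)).trans (h1' p),
    fun p => (congrArg e' (h2 p)).trans (h2' p), fun c => (h3 c).trans (h3' _),
    fun c => (h4 c).trans (h4' _)⟩

/-- Change of the identifications of the boundary. -/
def reparam {G G' H H' : Graph n m} (S : Surf G G') (f : H.Pt → G.Pt) (g : H'.Pt → G'.Pt) :
    Surf H H' :=
  ⟨S.Pt, fun p => S.src (f p), fun p => S.tgt (g p), S.rel, S.wt, S.dots⟩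

/-- A trace is a cylinder, so attaching it does not change the surface but only the way in which its
boundary is named. The map `κ` pushes the sample points of the cylinder to the common boundary `G'`.
-/
theorem trace_comp_sameType {G G' G'' : Graph n m} (S : Surf G' G'') {Pt : Type}
    (src : G.Pt → Pt) (tgt : G'.Pt → Pt) (rel : Pt → Pt → Prop) (κ : Pt → G'.Pt)
    (hrel : ∀ a b, rel a b →
      Quot.mk S.rel (S.src (κ a)) = Quot.mk S.rel (S.src (κ b)))
    (hκ : ∀ p, Quot.mk S.rel (S.src (κ (tgt p))) = Quot.mk S.rel (S.src p))
    (hκ' : ∀ x, Quot.mk rel (tgt (κ x)) = Quot.mk rel x) :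
    ((trace G G' Pt src tgt rel).comp S).SameType (S.reparam (fun p => κ (src p)) fun p => p) := by
  have hz : ∀ {M : Type} [AddCommMonoid M] (s : S.Pt →₀ M),
      (((0 : Pt →₀ M).mapDomain Sum.inl + s.mapDomain Sum.inr).mapDomain
        (Sum.elim (fun x => S.src (κ x)) fun x => x)) = s := by
    intro M _ s
    rw [mapDomain_sum, Finsupp.mapDomain_zero, zero_add]; exact Finsupp.mapDomain_id
  have hl : ∀ x y, Quot.mk rel x = Quot.mk rel y →
      Quot.mk (CompRel (trace G G' Pt src tgt rel) S) (.inl x) = Quot.mk _ (.inl y) := fun x y h =>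
    congrArg (Quot.lift (fun x => Quot.mk (CompRel (trace G G' Pt src tgt rel) S) (.inl x))
      (fun x y hxy => Quot.sound (.left hxy))) h
  refine SameType.of_maps (S := (trace G G' Pt src tgt rel).comp S)
    (Sum.elim (fun x => S.src (κ x)) fun x => x) .inr ?_ ?_ ?_ ?_ ?_ ?_ ?_ ?_
  · intro a b h
    cases h with
    | left h => exact hrel _ _ h
    | right h => exact Quot.sound h
    | glue p => exact hκ p
  · intro a b h; exact Quot.sound (.right h)
  · rintro (a | a)
    · exact (Quot.sound (.glue (κ a))).symm.trans (hl _ _ (hκ' a))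
    · rfl
  · intro a; rfl
  · intro p; rfl
  · intro p; rfl
  · exact congrArg (Finsupp.mapDomain _) (hz _)
  · exact congrArg (Finsupp.mapDomain _) (hz _)

theorem comp_trace_sameType {G G' G'' : Graph n m} (S : Surf G G') {Pt : Type}
    (src : G'.Pt → Pt) (tgt : G''.Pt → Pt) (rel : Pt → Pt → Prop) (κ : Pt → G'.Pt)
    (hrel : ∀ a b, rel a b →
      Quot.mk S.rel (S.tgt (κ a)) = Quot.mk S.rel (S.tgt (κ b)))
    (hκ : ∀ p, Quot.mk S.rel (S.tgt (κ (src p))) = Quot.mk S.rel (S.tgt p))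
    (hκ' : ∀ x, Quot.mk rel (src (κ x)) = Quot.mk rel x) :
    (S.comp (trace G' G'' Pt src tgt rel)).SameType (S.reparam (fun p => p) fun p => κ (tgt p)) := by
  have hz : ∀ {M : Type} [AddCommMonoid M] (s : S.Pt →₀ M),
      ((s.mapDomain Sum.inl + (0 : Pt →₀ M).mapDomain Sum.inr).mapDomain
        (Sum.elim (fun x => x) fun x => S.tgt (κ x))) = s := by
    intro M _ s
    rw [mapDomain_sum, Finsupp.mapDomain_zero, add_zero]; exact Finsupp.mapDomain_id
  have hr : ∀ x y, Quot.mk rel x = Quot.mk rel y →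
      Quot.mk (CompRel S (trace G' G'' Pt src tgt rel)) (.inr x) = Quot.mk _ (.inr y) :=
    fun x y h =>
      congrArg (Quot.lift (fun x => Quot.mk (CompRel S (trace G' G'' Pt src tgt rel)) (.inr x))
        (fun x y hxy => Quot.sound (.right hxy))) h
  refine SameType.of_maps (S := S.comp (trace G' G'' Pt src tgt rel))
    (Sum.elim (fun x => x) fun x => S.tgt (κ x)) .inl ?_ ?_ ?_ ?_ ?_ ?_ ?_ ?_
  · intro a b h
    cases h with
    | left h => exact Quot.sound h
    | right h => exact hrel _ _ h
    | glue p => exact (hκ p).symm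
  · intro a b h; exact Quot.sound (.left h)
  · rintro (a | a)
    · rfl
    · exact (Quot.sound (.glue (κ a))).trans (hr _ _ (hκ' a))
  · intro a; rfl
  · intro p; rfl
  · intro p; rfl
  · exact congrArg (Finsupp.mapDomain _) (hz _)
  · exact congrArg (Finsupp.mapDomain _) (hz _)

/-- Two walls without critical points cancel, if no diagram has closed components and the diagrams
connect the endpoints in the same way. -/
theorem wall_comp_wall_sameType {G G' : Graph n m} (φ : G'.Pt → G.Pt)
    (hrel : ∀ a b, G'.rel a b → Quot.mk G.rel (φ a) = Quot.mk G.rel (φ b))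
    (hsrc : ∀ p, Quot.mk G.rel (φ (G'.src p)) = Quot.mk G.rel (G.src p))
    (htgt : ∀ p, Quot.mk G.rel (φ (G'.tgt p)) = Quot.mk G.rel (G.tgt p))
    (hG : ∀ x, (∃ p, Quot.mk G.rel x = Quot.mk G.rel (G.src p)) ∨
      ∃ p, Quot.mk G.rel x = Quot.mk G.rel (G.tgt p))
    (hG' : ∀ x, (∃ p, Quot.mk G'.rel x = Quot.mk G'.rel (G'.src p)) ∨
      ∃ p, Quot.mk G'.rel x = Quot.mk G'.rel (G'.tgt p)) :
    ((wall G G' 0).comp (wall G' G 0)).SameType (cyl G 0) := by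
  let X := (wall G G' 0).comp (wall G' G 0)
  have hs : ∀ a b, X.rel a b → Quot.mk X.rel a = Quot.mk X.rel b := fun a b h => Quot.sound h
  have h1 : ∀ x y, Quot.mk G.rel x = Quot.mk G.rel y →
      Quot.mk X.rel (.inl (.inl x)) = Quot.mk X.rel (.inl (.inl y)) := fun x y h =>
    congrArg (Quot.lift (fun x => Quot.mk X.rel (.inl (.inl x)))
      (fun x y hxy => hs _ _ (.left (.left hxy)))) h
  have h2 : ∀ x y, Quot.mk G'.rel x = Quot.mk G'.rel y →
      Quot.mk X.rel (.inl (.inr x)) = Quot.mk X.rel (.inl (.inr y)) := fun x y h =>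
    congrArg (Quot.lift (fun x => Quot.mk X.rel (.inl (.inr x)))
      (fun x y hxy => hs _ _ (.left (.right hxy)))) h
  have h4 : ∀ x y, Quot.mk G.rel x = Quot.mk G.rel y →
      Quot.mk X.rel (.inr (.inr x)) = Quot.mk X.rel (.inr (.inr y)) := fun x y h =>
    congrArg (Quot.lift (fun x => Quot.mk X.rel (.inr (.inr x)))
      (fun x y hxy => hs _ _ (.right (.right hxy)))) h
  have hφ : ∀ x y, Quot.mk G'.rel x = Quot.mk G'.rel y →
      Quot.mk G.rel (φ x) = Quot.mk G.rel (φ y) := fun x y h =>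
    congrArg (Quot.lift (fun x => Quot.mk G.rel (φ x)) hrel) h
  have hglue : ∀ x : G'.Pt, Quot.mk X.rel (.inl (.inr x)) = Quot.mk X.rel (.inr (.inl x)) :=
    fun x => hs _ _ (.glue x)
  -- A component without endpoints would lie in a wall component of its own. By `hG'` there is none,
  -- so every point of `G'` can be moved to an endpoint and across the vertical interval over it.
  have hmid : ∀ x : G'.Pt, Quot.mk X.rel (.inl (.inl (φ x))) = Quot.mk X.rel (.inl (.inr x)) := by
    intro x
    rcases hG' x with ⟨p, hp⟩ | ⟨p, hp⟩
    · exact ((h1 _ _ ((hφ _ _ hp).trans (hsrc p))).trans (hs _ _ (.left (.src p)))).trans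
        (h2 _ _ hp).symm
    · exact ((h1 _ _ ((hφ _ _ hp).trans (htgt p))).trans (hs _ _ (.left (.tgt p)))).trans
        (h2 _ _ hp).symm
  have hend : ∀ x : G.Pt, Quot.mk X.rel (.inl (.inl x)) = Quot.mk X.rel (.inr (.inr x)) := by
    intro x
    rcases hG x with ⟨p, hp⟩ | ⟨p, hp⟩
    · exact (h1 _ _ hp).trans ((hs _ _ (.left (.src p))).trans
        ((hglue _).trans ((hs _ _ (.right (.src p))).trans (h4 _ _ hp).symm)))
    · exact (h1 _ _ hp).trans ((hs _ _ (.left (.tgt p))).trans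
        ((hglue _).trans ((hs _ _ (.right (.tgt p))).trans (h4 _ _ hp).symm)))
  have hz : ∀ {M : Type} [AddCommMonoid M] (f : (G.Pt ⊕ G'.Pt) ⊕ (G'.Pt ⊕ G.Pt) → G.Pt),
      ((0 : G.Pt ⊕ G'.Pt →₀ M).mapDomain Sum.inl +
        (0 : G'.Pt ⊕ G.Pt →₀ M).mapDomain Sum.inr).mapDomain f = 0 := by
    intro M _ f
    rw [Finsupp.mapDomain_zero, Finsupp.mapDomain_zero, add_zero, Finsupp.mapDomain_zero]
  refine SameType.of_maps (S := X) (T := cyl G 0)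
    (Sum.elim (Sum.elim (fun x => x) φ) (Sum.elim φ fun x => x)) (fun x => .inl (.inl x))
    ?_ ?_ ?_ ?_ ?_ ?_ ?_ ?_
  · intro a b h
    cases h with
    | left h =>
      cases h with
      | left h => exact Quot.sound h
      | right h => exact hrel _ _ h
      | src p => exact (hsrc p).symm
      | tgt p => exact (htgt p).symm
    | right h =>
      cases h with
      | left h => exact hrel _ _ h
      | right h => exact Quot.sound h
      | src p => exact hsrc p
      | tgt p => exact htgt p
    | glue p => rfl
  · intro a b h; exact hs _ _ (.left (.left h))
  · rintro ((x | x) | (x | x))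
    · rfl
    · exact hmid x
    · exact (hmid x).trans (hglue x)
    · exact hend x
  · intro x; rfl
  · intro p; rfl
  · intro p; rfl
  · exact congrArg (Finsupp.mapDomain _) (hz _)
  · exact congrArg (Finsupp.mapDomain _) (hz _)

end Surf

variable {n m l k : ℕ}

/-! ### Associators and unitors -/

theorem assocRel {a : Diag n m} {b : Diag m l} {c : Diag l k} {x y}
    (h : ((a.comp b).comp c).graph.rel x y) :
    (a.comp (b.comp c)).graph.rel (Equiv.sumAssoc _ _ _ x) (Equiv.sumAssoc _ _ _ y) := by
  cases h with
  | left h =>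
    cases h with
    | left h => exact .left h
    | right h => exact .right (.left h)
    | glue p => exact .glue p
  | right h => exact .right (.right h)
  | glue p => exact .right (.glue p)

/-- This checks that sliding the identity strands onto the first line of `w` respects components; it
is the compatibility required of `κ` for the left unitor. -/
theorem idCompRel {w w' : Diag n m} (S : Cb w w') {x y} (h : ((Diag.id n).comp w).graph.rel x y) :
    Quot.mk S.surf.rel (S.surf.src (Sum.elim w.graph.src (fun x => x) x)) =
      Quot.mk S.surf.rel (S.surf.src (Sum.elim w.graph.src (fun x => x) y)) := by
  cases h with
  | left h => exact h.elim
  | right h => exact S.src_tgt_rel.1 _ _ h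
  | glue p => rfl

theorem compIdRel {w w' : Diag n m} (S : Cb w w') {x y} (h : (w.comp (Diag.id m)).graph.rel x y) :
    Quot.mk S.surf.rel (S.surf.src (Sum.elim (fun x => x) w.graph.tgt x)) =
      Quot.mk S.surf.rel (S.surf.src (Sum.elim (fun x => x) w.graph.tgt y)) := by
  cases h with
  | left h => exact S.src_tgt_rel.1 _ _ h
  | right h => exact h.elim
  | glue p => rfl

theorem Cb.assoc_comp_sameType {a : Diag n m} {b : Diag m l} {c : Diag l k} {w : Diag n k}
    (T : Cb (a.comp (b.comp c)) w) : ((Cb.assoc a b c).comp T).surf.SameType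
      (T.surf.reparam (Equiv.sumAssoc a.Pt b.Pt c.Pt) fun p => p) :=
  Surf.trace_comp_sameType T.surf (G := ((a.comp b).comp c).graph) (fun p => p)
    (Equiv.sumAssoc a.Pt b.Pt c.Pt).symm ((a.comp b).comp c).graph.rel (Equiv.sumAssoc _ _ _)
    (fun _ _ h => T.src_tgt_rel.1 _ _ (assocRel h))
    (fun p => congrArg (fun p => Quot.mk _ (T.surf.src p)) (Equiv.apply_symm_apply _ p))
    (fun p => congrArg _ (Equiv.symm_apply_apply _ p))

theorem Cb.comp_assoc_sameType {a : Diag n m} {b : Diag m l} {c : Diag l k} {w : Diag n k}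
    (T : Cb w ((a.comp b).comp c)) : (T.comp (Cb.assoc a b c)).surf.SameType
      (T.surf.reparam (fun p => p) (Equiv.sumAssoc a.Pt b.Pt c.Pt).symm) :=
  Surf.comp_trace_sameType T.surf (G'' := (a.comp (b.comp c)).graph) (fun p => p)
    (Equiv.sumAssoc a.Pt b.Pt c.Pt).symm ((a.comp b).comp c).graph.rel (fun p => p)
    (fun _ _ h => T.src_tgt_rel.2 _ _ h) (fun _ => rfl) (fun _ => rfl)

theorem Cb.assocInv_comp_sameType {a : Diag n m} {b : Diag m l} {c : Diag l k} {w : Diag n k}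
    (T : Cb ((a.comp b).comp c) w) : ((Cb.assocInv a b c).comp T).surf.SameType
      (T.surf.reparam (Equiv.sumAssoc a.Pt b.Pt c.Pt).symm fun p => p) :=
  Surf.trace_comp_sameType T.surf (G := (a.comp (b.comp c)).graph)
    (Equiv.sumAssoc a.Pt b.Pt c.Pt).symm (fun p => p) ((a.comp b).comp c).graph.rel (fun p => p)
    (fun _ _ h => T.src_tgt_rel.1 _ _ h) (fun _ => rfl) (fun _ => rfl)

theorem Cb.idComp_comp_sameType {a w : Diag n m} (T : Cb a w) :
    ((Cb.idComp a).comp T).surf.SameType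
      (T.surf.reparam (H := ((Diag.id n).comp a).graph) (Sum.elim a.graph.src fun p => p)
        fun p => p) :=
  Surf.trace_comp_sameType T.surf (G := ((Diag.id n).comp a).graph) (fun p => p)
    .inr ((Diag.id n).comp a).graph.rel (Sum.elim a.graph.src fun p => p)
    (fun _ _ h => idCompRel T h) (fun _ => rfl) (by
      rintro (x | x)
      · exact (Quot.sound (.glue x)).symm
      · rfl)

theorem Cb.comp_idComp_sameType {a w : Diag n m} (T : Cb w ((Diag.id n).comp a)) :
    (T.comp (Cb.idComp a)).surf.SameType (T.surf.reparam (fun p => p) .inr) :=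
  Surf.comp_trace_sameType T.surf (G'' := a.graph) (fun p => p)
    .inr ((Diag.id n).comp a).graph.rel (fun p => p)
    (fun _ _ h => T.src_tgt_rel.2 _ _ h) (fun _ => rfl) (fun _ => rfl)

theorem Cb.idCompInv_comp_sameType {a w : Diag n m} (T : Cb ((Diag.id n).comp a) w) :
    ((Cb.idCompInv a).comp T).surf.SameType (T.surf.reparam .inr fun p => p) :=
  Surf.trace_comp_sameType T.surf (G := a.graph)
    (Sum.inr : a.Pt → (Diag.id n).Pt ⊕ a.Pt) (fun p => p)
    ((Diag.id n).comp a).graph.rel (fun p => p)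
    (fun _ _ h => T.src_tgt_rel.1 _ _ h) (fun _ => rfl) (fun _ => rfl)

theorem Cb.compId_comp_sameType {a w : Diag n m} (T : Cb a w) :
    ((Cb.compId a).comp T).surf.SameType
      (T.surf.reparam (H := (a.comp (Diag.id m)).graph) (Sum.elim (fun p => p) a.graph.tgt)
        fun p => p) :=
  Surf.trace_comp_sameType T.surf (G := (a.comp (Diag.id m)).graph) (fun p => p)
    .inl (a.comp (Diag.id m)).graph.rel (Sum.elim (fun p => p) a.graph.tgt)
    (fun _ _ h => compIdRel T h) (fun _ => rfl) (by
      rintro (x | x)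
      · rfl
      · exact Quot.sound (.glue x))

theorem Cb.comp_compId_sameType {a w : Diag n m} (T : Cb w (a.comp (Diag.id m))) :
    (T.comp (Cb.compId a)).surf.SameType (T.surf.reparam (fun p => p) .inl) :=
  Surf.comp_trace_sameType T.surf (G'' := a.graph) (fun p => p)
    .inl (a.comp (Diag.id m)).graph.rel (fun p => p)
    (fun _ _ h => T.src_tgt_rel.2 _ _ h) (fun _ => rfl) (fun _ => rfl)

theorem Cb.compIdInv_comp_sameType {a w : Diag n m} (T : Cb (a.comp (Diag.id m)) w) :
    ((Cb.compIdInv a).comp T).surf.SameType (T.surf.reparam .inl fun p => p) :=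
  Surf.trace_comp_sameType T.surf (G := a.graph)
    (Sum.inl : a.Pt → a.Pt ⊕ (Diag.id m).Pt) (fun p => p)
    (a.comp (Diag.id m)).graph.rel (fun p => p)
    (fun _ _ h => T.src_tgt_rel.1 _ _ h) (fun _ => rfl) (fun _ => rfl)

theorem Cb.assoc_comp_assocInv (a : Diag n m) (b : Diag m l) (c : Diag l k) :
    ((Cb.assoc a b c).comp (.assocInv a b c)).SameType (.id _) := by
  refine (Cb.assoc_comp_sameType _).trans ?_
  refine Surf.SameType.of_maps (fun x => x) (fun x => x) (fun x y h => Quot.sound h)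
    (fun x y h => Quot.sound h) (fun x => rfl) (fun x => rfl) (fun p => ?_) (fun p => rfl) rfl rfl
  exact congrArg _ (Equiv.symm_apply_apply _ p)

theorem Cb.assocInv_comp_assoc (a : Diag n m) (b : Diag m l) (c : Diag l k) :
    ((Cb.assocInv a b c).comp (.assoc a b c)).SameType (.id _) := by
  refine (Cb.assocInv_comp_sameType _).trans ?_
  refine Surf.SameType.of_maps (Equiv.sumAssoc _ _ _) (Equiv.sumAssoc _ _ _).symm
    (fun x y h => Quot.sound (assocRel (a := a) (b := b) (c := c) h)) (fun x y h => ?_)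
    (fun x => congrArg _ (Equiv.symm_apply_apply _ x))
    (fun x => congrArg _ (Equiv.apply_symm_apply _ x)) 
    (fun x => congrArg _ (Equiv.apply_symm_apply _ x))
    (fun x => congrArg _ (Equiv.apply_symm_apply _ x)) rfl rfl
  exact (Cb.assoc a b c).src_tgt_rel.2 x y h

/-- Once the associator cylinders are absorbed on both sides, what remains are the two ways of
bracketing the same three surfaces, with the same gluing intervals. -/
theorem Cb.assoc_naturality {a a' : Diag n m} {b b' : Diag m l} {c c' : Diag l k} (S : Cb a a')
    (T : Cb b b') (U : Cb c c') :
    (((S.hcomp T).hcomp U).comp (.assoc a' b' c')).SameType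
      ((Cb.assoc a b c).comp (S.hcomp (T.hcomp U))) := by
  refine (Cb.comp_assoc_sameType _).trans (Surf.SameType.trans ?_ (Cb.assoc_comp_sameType _).symm)
  · have hz : ∀ {A B C M : Type} [AddCommMonoid M] (s : A →₀ M) (t : B →₀ M) (u : C →₀ M),
        ((s.mapDomain Sum.inl + t.mapDomain Sum.inr).mapDomain Sum.inl +
          u.mapDomain Sum.inr).mapDomain (Equiv.sumAssoc A B C) =
        s.mapDomain Sum.inl + (t.mapDomain Sum.inl + u.mapDomain Sum.inr).mapDomain Sum.inr := by
      intro A B C M _ s t u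
      rw [Surf.mapDomain_sum, Surf.mapDomain_sum, Surf.mapDomain_sum, add_assoc]; rfl
    refine Surf.SameType.of_maps (Equiv.sumAssoc _ _ _) (Equiv.sumAssoc _ _ _).symm
      (fun x y h => Quot.sound ?_) (fun x y h => Quot.sound ?_)
      (fun x => congrArg _ (Equiv.symm_apply_apply _ x))
      (fun x => congrArg _ (Equiv.apply_symm_apply _ x)) (fun p => ?_) (fun p => ?_)
      (congrArg (Finsupp.mapDomain _) (hz _ _ _)) (congrArg (Finsupp.mapDomain _) (hz _ _ _))
    · cases h with
      | left h =>
        cases h with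
        | left h => exact .left h
        | right h => exact .right (.left h)
        | src p => exact .src p
        | tgt p => exact .tgt p
      | right h => exact .right (.right h)
      | src p => exact .right (.src p)
      | tgt p => exact .right (.tgt p)
    · cases h with
      | left h => exact .left (.left h)
      | right h =>
        cases h with
        | left h => exact .left (.right h)
        | right h => exact .right h
        | src p => exact .src p
        | tgt p => exact .tgt p
      | src p => exact .left (.src p)
      | tgt p => exact .left (.tgt p)
    · rcases p with (p | p) | p <;> rfl
    · rcases p with p | p | p <;> rfl

theorem Cb.idComp_comp_idCompInv (a : Diag n m) :
    ((Cb.idComp a).comp (.idCompInv a)).SameType (.id _) := by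
  refine (Cb.idComp_comp_sameType _).trans ?_
  refine Surf.SameType.of_maps (fun x => x) (fun x => x) (fun x y h => Quot.sound h)
    (fun x y h => Quot.sound h) (fun x => rfl) (fun x => rfl) (fun x => ?_) (fun p => rfl) rfl rfl
  rcases x with x | x
  · exact (Quot.sound (.glue x)).symm
  · rfl

theorem Cb.idCompInv_comp_idComp (a : Diag n m) :
    ((Cb.idCompInv a).comp (.idComp a)).SameType (.id _) := by
  refine (Cb.idCompInv_comp_sameType _).trans ?_
  refine Surf.SameType.of_maps (Sum.elim a.graph.src (fun x => x)) .inr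
    (fun x y h => idCompRel (.id a) h) (fun x y h => Quot.sound (.right h)) (fun x => ?_)
    (fun x => rfl) (fun p => rfl) (fun p => rfl) rfl rfl
  rcases x with x | x
  · exact (Quot.sound (.glue x)).symm
  · rfl

theorem Cb.idComp_naturality {a a' : Diag n m} (S : Cb a a') :
    (((Cb.id (.id n)).hcomp S).comp (.idComp a')).SameType ((Cb.idComp a).comp S) := by
  refine (Cb.comp_idComp_sameType _).trans (Surf.SameType.trans ?_ (Cb.idComp_comp_sameType S).symm)
  · have hz : ∀ {A B M : Type} [AddCommMonoid M] (f : A → B) (s : B →₀ M),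
        ((0 : A →₀ M).mapDomain Sum.inl + s.mapDomain Sum.inr).mapDomain
          (Sum.elim f fun x => x) = s := by
      intro A B M _ f s
      rw [Surf.mapDomain_sum, Finsupp.mapDomain_zero, zero_add]; exact Finsupp.mapDomain_id
    refine Surf.SameType.of_maps (Sum.elim (fun p => S.surf.src (a.graph.src p)) fun x => x) .inr
      (fun x y h => ?_) (fun x y h => Quot.sound (.right h)) (fun x => ?_) (fun x => rfl)
      (fun p => ?_) (fun p => rfl)
      (congrArg (Finsupp.mapDomain _) (hz _ _)) (congrArg (Finsupp.mapDomain _) (hz _ _))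
    · cases h with
      | left h => exact h.elim
      | right h => exact Quot.sound h
      | src p => rfl
      -- The strip over an identity strand is glued to `S` at both ends. It can be collapsed onto
      -- `S` because `S` contains the vertical interval over that endpoint.
      | tgt p => exact S.wall.1 p
    · rcases x with x | x
      · exact (Quot.sound (.src x)).symm
      · rfl
    · rcases p with p | p <;> rfl

theorem Cb.compId_comp_compIdInv (a : Diag n m) :
    ((Cb.compId a).comp (.compIdInv a)).SameType (.id _) := by
  refine (Cb.compId_comp_sameType _).trans ?_
  refine Surf.SameType.of_maps (fun x => x) (fun x => x) (fun x y h => Quot.sound h)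
    (fun x y h => Quot.sound h) (fun x => rfl) (fun x => rfl) (fun x => ?_) (fun p => rfl) rfl rfl
  rcases x with x | x
  · rfl
  · exact Quot.sound (.glue x)

theorem Cb.compIdInv_comp_compId (a : Diag n m) :
    ((Cb.compIdInv a).comp (.compId a)).SameType (.id _) := by
  refine (Cb.compIdInv_comp_sameType _).trans ?_
  refine Surf.SameType.of_maps (Sum.elim (fun x => x) a.graph.tgt) .inl
    (fun x y h => compIdRel (.id a) h) (fun x y h => Quot.sound (.left h)) (fun x => ?_)
    (fun x => rfl) (fun p => rfl) (fun p => rfl) rfl rfl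
  rcases x with x | x
  · rfl
  · exact Quot.sound (.glue x)

theorem Cb.compId_naturality {a a' : Diag n m} (S : Cb a a') :
    ((S.hcomp (Cb.id (.id m))).comp (.compId a')).SameType ((Cb.compId a).comp S) := by
  refine (Cb.comp_compId_sameType _).trans (Surf.SameType.trans ?_ (Cb.compId_comp_sameType S).symm)
  · have hz : ∀ {A B M : Type} [AddCommMonoid M] (f : B → A) (s : A →₀ M),
        (s.mapDomain Sum.inl + (0 : B →₀ M).mapDomain Sum.inr).mapDomain
          (Sum.elim (fun x => x) f) = s := by
      intro A B M _ f s
      rw [Surf.mapDomain_sum, Finsupp.mapDomain_zero, add_zero]; exact Finsupp.mapDomain_id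
    refine Surf.SameType.of_maps (Sum.elim (fun x => x) fun p => S.surf.src (a.graph.tgt p)) .inl
      (fun x y h => ?_) (fun x y h => Quot.sound (.left h)) (fun x => ?_) (fun x => rfl)
      (fun p => ?_) (fun p => rfl)
      (congrArg (Finsupp.mapDomain _) (hz _ _)) (congrArg (Finsupp.mapDomain _) (hz _ _))
    · cases h with
      | left h => exact Quot.sound h
      | right h => exact h.elim
      | src p => rfl
      | tgt p => exact (S.wall.2 p).symm
    · rcases x with x | x
      · rfl
      · exact Quot.sound (.src x)
    · rcases p with p | p <;> rfl

end BarNatan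

namespace BarNatan

/-! ### Invertibility of the traces of planar isotopies -/

theorem skipTwo_val {n : ℕ} (i : Fin (n + 1)) (p : Fin n) :
    (skipTwo i p).1 = if p.1 < i.1 then p.1 else p.1 + 2 := by
  unfold skipTwo; split_ifs <;> rfl

theorem exists_skipTwo_eq {n : ℕ} (i : Fin (n + 1)) (a : Fin (n + 2)) (h : a.1 ≠ i.1)
    (h' : a.1 ≠ i.1 + 1) : ∃ p, skipTwo i p = a := by
  by_cases hlt : a.1 < i.1
  · exact ⟨⟨a.1, by omega⟩, Fin.ext (by rw [skipTwo_val, if_pos hlt])⟩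
  · refine ⟨⟨a.1 - 2, by omega⟩, Fin.ext ?_⟩
    rw [skipTwo_val, if_neg (by simp only; omega)]; simp only; omega

/-- The components of the diagram `cup a` followed by `cap b`. -/
abbrev CupCapComp (n : ℕ) (a b : Fin (n + 1)) : Type :=
  Quot ((Diag.cup n a).comp (.cap n b)).graph.rel

/-- The component of a point on the middle line. -/
def cupCapMk {n : ℕ} (a b : Fin (n + 1)) (x : Fin (n + 2)) : CupCapComp n a b :=
  Quot.mk _ (.inl x)

theorem cupCapMk_inr {n : ℕ} (a b : Fin (n + 1)) (x : Fin (n + 2)) :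
    Quot.mk ((Diag.cup n a).comp (.cap n b)).graph.rel (.inr x) = cupCapMk a b x :=
  (Quot.sound (.glue x)).symm

theorem cupCapMk_cup {n : ℕ} {a b : Fin (n + 1)} {x y : Fin (n + 2)} (hx : x.1 = a.1)
    (hy : y.1 = a.1 + 1) : cupCapMk a b x = cupCapMk a b y := Quot.sound (.left ⟨hx, hy⟩)

theorem cupCapMk_cap {n : ℕ} {a b : Fin (n + 1)} {x y : Fin (n + 2)} (hx : x.1 = b.1)
    (hy : y.1 = b.1 + 1) : cupCapMk a b x = cupCapMk a b y :=
  (cupCapMk_inr a b x).symm.trans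
    ((Quot.sound (.right ⟨hx, hy⟩)).trans (cupCapMk_inr a b y))

/-- No circle arises when `a ≠ b`. A point of the middle line that misses one of the two arcs
continues to an outer line. If it lies on both arcs, its partner on the cup is not on the cap and so
continues to the second line. -/
theorem exists_cupCapMk_eq {n : ℕ} {a b : Fin (n + 1)} (hab : a ≠ b)
    (x : ((Diag.cup n a).comp (.cap n b)).Pt) :
    (∃ p, Quot.mk ((Diag.cup n a).comp (.cap n b)).graph.rel x =
      Quot.mk _ (((Diag.cup n a).comp (.cap n b)).graph.src p)) ∨
    ∃ p, Quot.mk ((Diag.cup n a).comp (.cap n b)).graph.rel x =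
      Quot.mk _ (((Diag.cup n a).comp (.cap n b)).graph.tgt p) := by
  have hab' : a.1 ≠ b.1 := fun h => hab (Fin.ext h)
  obtain ⟨y, hy⟩ : ∃ y, Quot.mk ((Diag.cup n a).comp (.cap n b)).graph.rel x =
      cupCapMk a b y := by
    rcases x with x | x
    · exact ⟨x, rfl⟩
    · exact ⟨x, cupCapMk_inr a b x⟩
  have main : ∀ y : Fin (n + 2), (∃ p, cupCapMk a b y = cupCapMk a b (skipTwo a p)) ∨
      ∃ p, cupCapMk a b y = cupCapMk a b (skipTwo b p) := by
    intro y
    by_cases h1 : y.1 ≠ a.1 ∧ y.1 ≠ a.1 + 1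
    · obtain ⟨p, rfl⟩ := exists_skipTwo_eq a y h1.1 h1.2
      exact .inl ⟨p, rfl⟩
    · by_cases h2 : y.1 ≠ b.1 ∧ y.1 ≠ b.1 + 1
      · obtain ⟨p, rfl⟩ := exists_skipTwo_eq b y h2.1 h2.2
        exact .inr ⟨p, rfl⟩
      · refine .inr ?_
        rcases (show y.1 = a.1 ∨ y.1 = a.1 + 1 by omega) with h | h
        · obtain ⟨p, hp⟩ := exists_skipTwo_eq b (⟨a.1 + 1, by omega⟩ : Fin (n + 2))
            (by simp only; omega) (by simp only; omega)
          exact ⟨p, by rw [hp]; exact cupCapMk_cup h rfl⟩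
        · obtain ⟨p, hp⟩ := exists_skipTwo_eq b (⟨a.1, by omega⟩ : Fin (n + 2))
            (by simp only; omega) (by simp only; omega)
          exact ⟨p, by rw [hp]; exact (cupCapMk_cup rfl h).symm⟩
  rw [hy]
  rcases main y with ⟨p, hp⟩ | ⟨p, hp⟩
  · exact .inl ⟨p, hp⟩
  · exact .inr ⟨p, hp.trans (cupCapMk_inr a b _).symm⟩

/-- The map collapsing an arc that moves back and forth. -/
def collapse {n : ℕ} (i : Fin (n + 1)) (x : Fin (n + 3)) : Fin (n + 1) :=
  if h : x.1 ≤ i.1 then ⟨x.1, by omega⟩ else ⟨max i.1 (x.1 - 2), by omega⟩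

theorem collapse_val {n : ℕ} (i : Fin (n + 1)) (x : Fin (n + 3)) :
    (collapse i x).1 = if x.1 ≤ i.1 then x.1 else max i.1 (x.1 - 2) := by
  unfold collapse; split_ifs <;> rfl

theorem collapse_eq {n k : ℕ} {i : Fin (n + 1)} {x y : Fin (n + 3)}
    (hk : k = i.1 ∨ k = i.1 + 1) (hx : x.1 = k) (hy : y.1 = k + 1) :
    collapse i x = collapse i y := by
  refine Fin.ext ?_
  rw [collapse_val, collapse_val]
  split_ifs <;> omega

theorem zigzag_aux {n : ℕ} (i : Fin (n + 1)) (a b : Fin (n + 2))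
    (hab : a.1 = i.1 ∧ b.1 = i.1 + 1 ∨ a.1 = i.1 + 1 ∧ b.1 = i.1) :
    ((Surf.wall ((Diag.cup (n + 1) a).comp (.cap (n + 1) b)).graph (Diag.id (n + 1)).graph 0).comp
      (Surf.wall (Diag.id (n + 1)).graph ((Diag.cup (n + 1) a).comp (.cap (n + 1) b)).graph
        0)).SameType (.cyl _ 0) ∧
    ((Surf.wall (Diag.id (n + 1)).graph ((Diag.cup (n + 1) a).comp (.cap (n + 1) b)).graph 0).comp
      (Surf.wall ((Diag.cup (n + 1) a).comp (.cap (n + 1) b)).graph (Diag.id (n + 1)).graph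
        0)).SameType (.cyl _ 0) := by
  have hne : a ≠ b := fun h => by subst h; omega
  constructor
  · refine Surf.wall_comp_wall_sameType (G := ((Diag.cup (n + 1) a).comp (.cap (n + 1) b)).graph)
      (G' := (Diag.id (n + 1)).graph) (fun p => .inl (skipTwo a p)) (fun _ _ h => h.elim)
      (fun p => rfl) (fun p => ?_) (exists_cupCapMk_eq hne) (fun x => .inl ⟨x, rfl⟩)
    refine Eq.trans ?_ (cupCapMk_inr a b _).symm
    change cupCapMk a b (skipTwo a p) = cupCapMk a b (skipTwo b p)
    -- The two `skipTwo` maps differ only at `p = i`. There the values are `i` and `i + 2`, which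
    -- the cup and the cap connect through the point `i + 1`.
    by_cases hp : p.1 = i.1
    · have e1 := skipTwo_val a p
      have e2 := skipTwo_val b p
      rcases hab with ⟨ha, hb⟩ | ⟨ha, hb⟩
      · rw [if_neg (by omega)] at e1
        rw [if_pos (by omega)] at e2
        exact (cupCapMk_cap (x := ⟨i.1 + 1, by omega⟩) hb.symm (by omega)).symm.trans
          (cupCapMk_cup (by omega) (by simp only; omega)).symm
      · rw [if_pos (by omega)] at e1
        rw [if_neg (by omega)] at e2
        exact (cupCapMk_cap (y := ⟨i.1 + 1, by omega⟩) (by omega) (by simp only; omega)).trans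
          (cupCapMk_cup (by simp only; omega) (by omega))
    · congr 1
      ext
      rw [skipTwo_val, skipTwo_val]
      split_ifs <;> omega
  · refine Surf.wall_comp_wall_sameType (G := (Diag.id (n + 1)).graph)
      (G' := ((Diag.cup (n + 1) a).comp (.cap (n + 1) b)).graph)
      (Sum.elim (collapse i) (collapse i)) (fun x y h => ?_) (fun p => ?_) (fun p => ?_)
      (fun x => .inl ⟨x, rfl⟩) (exists_cupCapMk_eq hne)
    · refine congrArg _ ?_
      cases h with
      | left h =>
        exact collapse_eq (by omega) h.1 h.2
      | right h =>
        exact collapse_eq (by omega) h.1 h.2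
      | glue p => rfl
    · refine congrArg _ (Fin.ext ?_)
      change (collapse i (skipTwo a p)).1 = p.1
      rw [collapse_val, skipTwo_val]
      split_ifs <;> omega
    · refine congrArg _ (Fin.ext ?_)
      change (collapse i (skipTwo b p)).1 = p.1
      rw [collapse_val, skipTwo_val]
      split_ifs <;> omega

theorem exists_capCup_eq {n : ℕ} (a b : Fin (n + 1)) (x : ((Diag.cap n a).comp (.cup n b)).Pt) :
    (∃ p, Quot.mk ((Diag.cap n a).comp (.cup n b)).graph.rel x =
      Quot.mk _ (((Diag.cap n a).comp (.cup n b)).graph.src p)) ∨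
    ∃ p, Quot.mk ((Diag.cap n a).comp (.cup n b)).graph.rel x =
      Quot.mk _ (((Diag.cap n a).comp (.cup n b)).graph.tgt p) := by
  rcases x with x | x
  · exact .inl ⟨x, rfl⟩
  · exact .inr ⟨x, rfl⟩

theorem capCup_glue {n : ℕ} {a b : Fin (n + 1)} {x y : Fin (n + 2)} (p : ℕ) (hp : p < n)
    (hx : x.1 = if p < a.1 then p else p + 2) (hy : y.1 = if p < b.1 then p else p + 2) :
    Quot.mk ((Diag.cap n a).comp (.cup n b)).graph.rel (.inl x) = Quot.mk _ (.inr y) := by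
  obtain rfl : x = skipTwo a ⟨p, hp⟩ := Fin.ext (hx.trans (skipTwo_val a (⟨p, hp⟩ : Fin n)).symm)
  obtain rfl : y = skipTwo b ⟨p, hp⟩ := Fin.ext (hy.trans (skipTwo_val b (⟨p, hp⟩ : Fin n)).symm)
  exact Quot.sound (.glue _)

/-- The map to `S` which is `g` on the points `c`, `c + 1` and `f` on the other points. -/
def exchange {n : ℕ} {S : Type} (c : ℕ) (f g : Fin (n + 2) → S) (x : Fin (n + 4))
    (hc : c ≤ n) : S :=
  if h : x.1 < c then f ⟨x.1, by omega⟩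
  else if h' : x.1 ≤ c + 1 then g ⟨x.1, by omega⟩ else f ⟨x.1 - 2, by omega⟩

theorem exchange_inside {n : ℕ} {S : Type} {c : ℕ} {f g : Fin (n + 2) → S} {x : Fin (n + 4)}
    {hc : c ≤ n} (y : Fin (n + 2)) (hx : c ≤ x.1 ∧ x.1 ≤ c + 1) (hy : y.1 = x.1) :
    exchange c f g x hc = g y := by
  unfold exchange
  rw [dif_neg (by omega), dif_pos hx.2]
  exact congrArg g (Fin.ext hy.symm)

theorem exchange_outside {n : ℕ} {S : Type} {c : ℕ} {f g : Fin (n + 2) → S} {x : Fin (n + 4)}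
    {hc : c ≤ n} (y : Fin (n + 2)) (hx : x.1 = if y.1 < c then y.1 else y.1 + 2) :
    exchange c f g x hc = f y := by
  unfold exchange
  by_cases h : y.1 < c
  · rw [if_pos h] at hx
    rw [dif_pos (by omega)]
    exact congrArg f (Fin.ext hx)
  · rw [if_neg h] at hx
    rw [dif_neg (by omega), dif_neg (by omega)]
    exact congrArg f (Fin.ext (by simp only; omega))

theorem skipTwo_lt {n : ℕ} {i : Fin (n + 1)} {p : Fin n} (h : p.1 < i.1) :
    (skipTwo i p).1 = p.1 := by rw [skipTwo_val, if_pos h]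

theorem skipTwo_ge {n : ℕ} {i : Fin (n + 1)} {p : Fin n} (h : i.1 ≤ p.1) :
    (skipTwo i p).1 = p.1 + 2 := by rw [skipTwo_val, if_neg (by omega)]

theorem skipTwo_eq_of_lt {n : ℕ} {i : Fin (n + 1)} {p : Fin n} {c : ℕ} (h : p.1 = c)
    (hc : c < i.1) : (skipTwo i p).1 = c := by rw [skipTwo_lt (by omega), h]

theorem skipTwo_eq_of_ge {n : ℕ} {i : Fin (n + 1)} {p : Fin n} {c : ℕ} (h : p.1 = c)
    (hc : i.1 ≤ c) : (skipTwo i p).1 = c + 2 := by rw [skipTwo_ge (by omega), h]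

/-- A distant cup and cap can be exchanged because they use disjoint pairs of points. One comparison
map embeds both outer lines into the middle line of `n + 4` points by `skipTwo`. The other,
`exchange`, sends the ends of the cup to the second line and all other points, including the ends of
the cap, to the first line. -/
theorem cupCap_aux {n : ℕ} (i j : Fin (n + 1)) (hij : i ≤ j) (a b : Fin (n + 3))
    (ha : a.1 = i.1) (hb : b.1 = j.1 + 2) :
    ((Surf.wall ((Diag.cup (n + 2) a).comp (.cap (n + 2) b)).graph
        ((Diag.cap n j).comp (.cup n i)).graph 0).comp
      (Surf.wall ((Diag.cap n j).comp (.cup n i)).graph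
        ((Diag.cup (n + 2) a).comp (.cap (n + 2) b)).graph 0)).SameType (.cyl _ 0) ∧
    ((Surf.wall ((Diag.cap n j).comp (.cup n i)).graph
        ((Diag.cup (n + 2) a).comp (.cap (n + 2) b)).graph 0).comp
      (Surf.wall ((Diag.cup (n + 2) a).comp (.cap (n + 2) b)).graph
        ((Diag.cap n j).comp (.cup n i)).graph 0)).SameType (.cyl _ 0) := by
  have hij : i.1 ≤ j.1 := hij
  have hne : a ≠ b := fun h => by subst h; omega
  constructor
  · refine Surf.wall_comp_wall_sameType
      (G := ((Diag.cup (n + 2) a).comp (.cap (n + 2) b)).graph)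
      (G' := ((Diag.cap n j).comp (.cup n i)).graph)
      (Sum.map (skipTwo a) (skipTwo b)) (fun x y h => ?_) (fun p => rfl) (fun p => rfl)
      (exists_cupCapMk_eq hne) (exists_capCup_eq j i)
    cases h with
    | left h =>
      exact cupCapMk_cap ((skipTwo_eq_of_ge h.1 (by omega)).trans hb.symm)
        ((skipTwo_eq_of_ge h.2 (by omega)).trans (by omega))
    | right h =>
      exact (cupCapMk_inr a b _).trans ((cupCapMk_cup
        ((skipTwo_eq_of_lt h.1 (by omega)).trans ha.symm)
        ((skipTwo_eq_of_lt h.2 (by omega)).trans (by omega))).trans (cupCapMk_inr a b _).symm)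
    | glue p =>
      refine Eq.trans ?_ (cupCapMk_inr a b _).symm
      refine congrArg (cupCapMk a b) (Fin.ext ?_)
      change (skipTwo a (skipTwo j p)).1 = (skipTwo b (skipTwo i p)).1
      simp only [skipTwo_val]
      split_ifs <;> omega
  · refine Surf.wall_comp_wall_sameType
      (G := ((Diag.cap n j).comp (.cup n i)).graph)
      (G' := ((Diag.cup (n + 2) a).comp (.cap (n + 2) b)).graph)
      (fun x => exchange (S := Fin (n + 2) ⊕ Fin (n + 2)) i.1 .inl .inr
        (Sum.elim (fun x => x) (fun x => x) x) (by omega))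
      (fun x y h => ?_) (fun p => ?_) (fun p => ?_)
      (exists_capCup_eq j i) (exists_cupCapMk_eq hne)
    · have key : ∀ x y : Fin (n + 4), (x.1 = a.1 ∧ y.1 = a.1 + 1 ∨ x.1 = b.1 ∧ y.1 = b.1 + 1) →
          Quot.mk ((Diag.cap n j).comp (.cup n i)).graph.rel
            (exchange (S := Fin (n + 2) ⊕ Fin (n + 2)) i.1 .inl .inr x (by omega)) =
          Quot.mk ((Diag.cap n j).comp (.cup n i)).graph.rel
            (exchange (S := Fin (n + 2) ⊕ Fin (n + 2)) i.1 .inl .inr y (by omega)) := by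
        rintro x y (⟨hx, hy⟩ | ⟨hx, hy⟩)
        · rw [exchange_inside ⟨i.1, by omega⟩ (by omega) (by simp only; omega),
            exchange_inside ⟨i.1 + 1, by omega⟩ (by omega) (by simp only; omega)]
          exact Quot.sound (.right ⟨rfl, rfl⟩)
        · rw [exchange_outside ⟨j.1, by omega⟩ (by rw [if_neg (by simp only; omega)]; simp only; omega),
            exchange_outside ⟨j.1 + 1, by omega⟩
              (by rw [if_neg (by simp only; omega)]; simp only; omega)]
          exact Quot.sound (.left ⟨rfl, rfl⟩)
      cases h with
      | left h => exact key _ _ (.inl h)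
      | right h => exact key _ _ (.inr h)
      | glue p => rfl
    · refine congrArg _ (exchange_outside p ?_)
      exact (skipTwo_val a p).trans (by rw [ha])
    · change Quot.mk ((Diag.cap n j).comp (.cup n i)).graph.rel
        (exchange (S := Fin (n + 2) ⊕ Fin (n + 2)) i.1 .inl .inr (skipTwo b p) (by omega)) =
          Quot.mk ((Diag.cap n j).comp (.cup n i)).graph.rel (.inr p)
      have hp := skipTwo_val b p
      -- The ends of the cup are already sent to the second line. Any other endpoint is sent to the
      -- first line and reaches its position by a through strand; the cases locate it relative to
      -- cup and cap.
      by_cases h : i.1 ≤ p.1 ∧ p.1 ≤ i.1 + 1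
      · rw [if_pos (by omega)] at hp
        exact congrArg _ (exchange_inside p (by omega) hp.symm)
      · by_cases h' : p.1 < i.1
        · rw [if_pos (by omega)] at hp
          rw [exchange_outside p (by rw [if_pos h', hp])]
          exact capCup_glue p.1 (by omega) (by rw [if_pos (by omega)]) (by rw [if_pos (by omega)])
        · by_cases h'' : p.1 < j.1 + 2
          · rw [if_pos (by omega)] at hp
            rw [exchange_outside ⟨p.1 - 2, by omega⟩
              (by rw [hp, if_neg (by simp only; omega)]; simp only; omega)]
            exact capCup_glue (p.1 - 2) (by omega) (by rw [if_pos (by omega)])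
              (by rw [if_neg (by omega)]; omega)
          · rw [if_neg (by omega)] at hp
            rw [exchange_outside p (by rw [hp, if_neg (by omega)])]
            exact capCup_glue (p.1 - 2) (by omega) (by rw [if_neg (by omega)]; omega)
              (by rw [if_neg (by omega)]; omega)

/-- This is the mirror case, with the cap to the left of the cup, so the two lines change roles in
`exchange`. -/
theorem capCup_aux {n : ℕ} (i j : Fin (n + 1)) (hij : i ≤ j) (a b : Fin (n + 3))
    (ha : a.1 = i.1) (hb : b.1 = j.1 + 2) :
    ((Surf.wall ((Diag.cup (n + 2) b).comp (.cap (n + 2) a)).graph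
        ((Diag.cap n i).comp (.cup n j)).graph 0).comp
      (Surf.wall ((Diag.cap n i).comp (.cup n j)).graph
        ((Diag.cup (n + 2) b).comp (.cap (n + 2) a)).graph 0)).SameType (.cyl _ 0) ∧
    ((Surf.wall ((Diag.cap n i).comp (.cup n j)).graph
        ((Diag.cup (n + 2) b).comp (.cap (n + 2) a)).graph 0).comp
      (Surf.wall ((Diag.cup (n + 2) b).comp (.cap (n + 2) a)).graph
        ((Diag.cap n i).comp (.cup n j)).graph 0)).SameType (.cyl _ 0) := by
  have hij : i.1 ≤ j.1 := hij
  have hne : b ≠ a := fun h => by subst h; omega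
  constructor
  · refine Surf.wall_comp_wall_sameType
      (G := ((Diag.cup (n + 2) b).comp (.cap (n + 2) a)).graph)
      (G' := ((Diag.cap n i).comp (.cup n j)).graph)
      (Sum.map (skipTwo b) (skipTwo a)) (fun x y h => ?_) (fun p => rfl) (fun p => rfl)
      (exists_cupCapMk_eq hne) (exists_capCup_eq i j)
    cases h with
    | left h =>
      exact cupCapMk_cap ((skipTwo_eq_of_lt h.1 (by omega)).trans ha.symm)
        ((skipTwo_eq_of_lt h.2 (by omega)).trans (by omega))
    | right h =>
      exact (cupCapMk_inr b a _).trans ((cupCapMk_cup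
        ((skipTwo_eq_of_ge h.1 (by omega)).trans hb.symm)
        ((skipTwo_eq_of_ge h.2 (by omega)).trans (by omega))).trans (cupCapMk_inr b a _).symm)
    | glue p =>
      refine Eq.trans ?_ (cupCapMk_inr b a _).symm
      refine congrArg (cupCapMk b a) (Fin.ext ?_)
      change (skipTwo b (skipTwo i p)).1 = (skipTwo a (skipTwo j p)).1
      simp only [skipTwo_val]
      split_ifs <;> omega
  · refine Surf.wall_comp_wall_sameType
      (G := ((Diag.cap n i).comp (.cup n j)).graph)
      (G' := ((Diag.cup (n + 2) b).comp (.cap (n + 2) a)).graph)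
      (fun x => exchange (S := Fin (n + 2) ⊕ Fin (n + 2)) i.1 .inr .inl
        (Sum.elim (fun x => x) (fun x => x) x) (by omega))
      (fun x y h => ?_) (fun p => ?_) (fun p => ?_)
      (exists_capCup_eq i j) (exists_cupCapMk_eq hne)
    · have key : ∀ x y : Fin (n + 4), (x.1 = a.1 ∧ y.1 = a.1 + 1 ∨ x.1 = b.1 ∧ y.1 = b.1 + 1) →
          Quot.mk ((Diag.cap n i).comp (.cup n j)).graph.rel
            (exchange (S := Fin (n + 2) ⊕ Fin (n + 2)) i.1 .inr .inl x (by omega)) =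
          Quot.mk ((Diag.cap n i).comp (.cup n j)).graph.rel
            (exchange (S := Fin (n + 2) ⊕ Fin (n + 2)) i.1 .inr .inl y (by omega)) := by
        rintro x y (⟨hx, hy⟩ | ⟨hx, hy⟩)
        · rw [exchange_inside ⟨i.1, by omega⟩ (by omega) (by simp only; omega),
            exchange_inside ⟨i.1 + 1, by omega⟩ (by omega) (by simp only; omega)]
          exact Quot.sound (.left ⟨rfl, rfl⟩)
        · rw [exchange_outside ⟨j.1, by omega⟩ (by rw [if_neg (by simp only; omega)]; simp only; omega),
            exchange_outside ⟨j.1 + 1, by omega⟩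
              (by rw [if_neg (by simp only; omega)]; simp only; omega)]
          exact Quot.sound (.right ⟨rfl, rfl⟩)
      cases h with
      | left h => exact key _ _ (.inr h)
      | right h => exact key _ _ (.inl h)
      | glue p => rfl
    · change Quot.mk ((Diag.cap n i).comp (.cup n j)).graph.rel
        (exchange (S := Fin (n + 2) ⊕ Fin (n + 2)) i.1 .inr .inl (skipTwo b p) (by omega)) =
          Quot.mk ((Diag.cap n i).comp (.cup n j)).graph.rel (.inl p)
      have hp := skipTwo_val b p
      by_cases h : i.1 ≤ p.1 ∧ p.1 ≤ i.1 + 1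
      · rw [if_pos (by omega)] at hp
        exact congrArg _ (exchange_inside p (by omega) hp.symm)
      · by_cases h' : p.1 < i.1
        · rw [if_pos (by omega)] at hp
          rw [exchange_outside p (by rw [if_pos h', hp])]
          exact (capCup_glue p.1 (by omega) (by rw [if_pos (by omega)])
            (by rw [if_pos (by omega)])).symm
        · by_cases h'' : p.1 < j.1 + 2
          · rw [if_pos (by omega)] at hp
            rw [exchange_outside ⟨p.1 - 2, by omega⟩
              (by rw [hp, if_neg (by simp only; omega)]; simp only; omega)]
            exact (capCup_glue (p.1 - 2) (by omega) (by rw [if_neg (by omega)]; omega)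
              (by rw [if_pos (by omega)])).symm
          · rw [if_neg (by omega)] at hp
            rw [exchange_outside p (by rw [hp, if_neg (by omega)])]
            exact (capCup_glue (p.1 - 2) (by omega) (by rw [if_neg (by omega)]; omega)
              (by rw [if_neg (by omega)]; omega)).symm
    · refine congrArg _ (exchange_outside p ?_)
      exact (skipTwo_val a p).trans (by rw [ha])

/-- The trace of a planar isotopy and the reversed trace are inverse up to topological type. -/
def Move.Invertible {n m : ℕ} {w w' : Diag n m} (μ : Move w w') : Prop :=
  ((Cb.move μ).comp (.moveInv μ)).SameType (.id w) ∧
    ((Cb.moveInv μ).comp (.move μ)).SameType (.id w')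

/-- The normal form only requires a cap to be moved past a cup in front of it, so these four kinds
of moves suffice. -/
theorem Move.zigzag_invertible (n : ℕ) (i : Fin (n + 1)) : (Move.zigzag n i).Invertible :=
  zigzag_aux i i.castSucc i.succ (.inl ⟨rfl, by simp⟩)

theorem Move.zagzig_invertible (n : ℕ) (i : Fin (n + 1)) : (Move.zagzig n i).Invertible :=
  zigzag_aux i i.succ i.castSucc (.inr ⟨by simp, rfl⟩)

theorem Move.cupCap_invertible (n : ℕ) (i j : Fin (n + 1)) (h : i ≤ j) :
    (Move.cupCap n i j h).Invertible :=
  cupCap_aux i j h i.castSucc.castSucc j.succ.succ rfl (by simp)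

theorem Move.capCup_invertible (n : ℕ) (i j : Fin (n + 1)) (h : i ≤ j) :
    (Move.capCup n i j h).Invertible :=
  capCup_aux i j h i.castSucc.castSucc j.succ.succ rfl (by simp)

end BarNatan

namespace BarNatan

variable {n m l k : ℕ}

/-! ### Structure isomorphisms of Bar-Natan's category -/

namespace CobHom

theorem comp_of {w w' w'' : Diag n m} (S : Cb w w') (T : Cb w' w'') :
    CobHom.comp (mk (of S)) (mk (of T)) = mk (of (S.comp T)) := by
  rw [of, of, comp_mk, mul_one]; rfl

theorem assoc_naturality {a a' : Diag n m} {b b' : Diag m l} {c c' : Diag l k} (f : CobHom a a')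
    (g : CobHom b b') (h : CobHom c c') :
    CobHom.comp (CobHom.hcomp (CobHom.hcomp f g) h) (mk (of (.assoc a' b' c'))) =
      CobHom.comp (mk (of (.assoc a b c))) (CobHom.hcomp f (CobHom.hcomp g h)) := by
  induction f using CobHom.induct with
  | zero => simp
  | add f f' hf hf' => simp only [map_add, LinearMap.add_apply, hf, hf']
  | single S r =>
    induction g using CobHom.induct with
    | zero => simp
    | add g g' hg hg' => simp only [map_add, LinearMap.add_apply, hg, hg']
    | single T s =>
      induction h using CobHom.induct with
      | zero => simp
      | add h h' hh hh' => simp only [map_add, LinearMap.add_apply, hh, hh']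
      | single U t =>
        simp only [of, CobHom.hcomp_mk, CobHom.comp_mk, mul_assoc, one_mul, mul_one]
        exact mk_of_eq (Cb.assoc_naturality S T U) _

theorem idComp_naturality {a a' : Diag n m} (f : CobHom a a') :
    CobHom.comp (CobHom.hcomp (CobHom.id (.id n)) f) (mk (of (.idComp a'))) =
      CobHom.comp (mk (of (.idComp a))) f := by
  induction f using CobHom.induct with
  | zero => simp
  | add f f' hf hf' => simp only [map_add, LinearMap.add_apply, hf, hf']
  | single S r =>
    simp only [of, CobHom.id, CobHom.hcomp_mk, CobHom.comp_mk, one_mul, mul_one]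
    exact mk_of_eq (Cb.idComp_naturality S) _

theorem compId_naturality {a a' : Diag n m} (f : CobHom a a') :
    CobHom.comp (CobHom.hcomp f (CobHom.id (.id m))) (mk (of (.compId a'))) =
      CobHom.comp (mk (of (.compId a))) f := by
  induction f using CobHom.induct with
  | zero => simp
  | add f f' hf hf' => simp only [map_add, LinearMap.add_apply, hf, hf']
  | single S r =>
    simp only [of, CobHom.id, CobHom.hcomp_mk, CobHom.comp_mk, one_mul, mul_one]
    exact mk_of_eq (Cb.compId_naturality S) _

end CobHom

namespace Cob

/-- The morphism given by a cobordism of the right degree. -/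
noncomputable def homOf {A B : Cob n m} (S : Cb A.diag B.diag) (h : S.deg = A.q - B.q) : A ⟶ B :=
  ⟨BarNatan.mk (of S), AddSubgroup.subset_closure ⟨S, 0, by simpa using h, rfl⟩⟩

/-- The isomorphism given by inverse cobordisms. -/
noncomputable def isoOf {A B : Cob n m} (S : Cb A.diag B.diag) (T : Cb B.diag A.diag) (hS : S.deg = A.q - B.q)
    (hT : T.deg = B.q - A.q) (h : (S.comp T).SameType (.id _)) (h' : (T.comp S).SameType (.id _)) :
    A ≅ B where
  hom := homOf S hS
  inv := homOf T hT
  hom_inv_id := Subtype.ext ((CobHom.comp_of S T).trans (mk_of_eq h 1))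
  inv_hom_id := Subtype.ext ((CobHom.comp_of T S).trans (mk_of_eq h' 1))

/-- The associator. -/
noncomputable def associator (A : Cob n m) (B : Cob m l) (C : Cob l k) :
    tensorObj (tensorObj A B) C ≅ tensorObj A (tensorObj B C) :=
  isoOf (.assoc A.diag B.diag C.diag) (.assocInv A.diag B.diag C.diag)
    (by simp only [Cb.deg, tensorObj]; ring) (by simp only [Cb.deg, tensorObj]; ring)
    (Cb.assoc_comp_assocInv _ _ _) (Cb.assocInv_comp_assoc _ _ _)

theorem associator_naturality {A A' : Cob n m} {B B' : Cob m l} {C C' : Cob l k} (f : A ⟶ A')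
    (g : B ⟶ B') (h : C ⟶ C') :
    tensorHom (tensorHom f g) h ≫ (associator A' B' C').hom =
      (associator A B C).hom ≫ tensorHom f (tensorHom g h) :=
  Subtype.ext (CobHom.assoc_naturality f.1 g.1 h.1)

/-- The left unitor. -/
noncomputable def leftUnitor (A : Cob n m) : tensorObj (one n 0) A ≅ A :=
  isoOf (.idComp A.diag) (.idCompInv A.diag) (by simp only [Cb.deg, tensorObj, one]; ring)
    (by simp only [Cb.deg, tensorObj, one]; ring) (Cb.idComp_comp_idCompInv _)
    (Cb.idCompInv_comp_idComp _)

theorem leftUnitor_naturality {A A' : Cob n m} (f : A ⟶ A') :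
    tensorHom (𝟙 (one n 0)) f ≫ (leftUnitor A').hom = (leftUnitor A).hom ≫ f :=
  Subtype.ext (CobHom.idComp_naturality f.1)

/-- The right unitor. -/
noncomputable def rightUnitor (A : Cob n m) : tensorObj A (one m 0) ≅ A :=
  isoOf (.compId A.diag) (.compIdInv A.diag) (by simp only [Cb.deg, tensorObj, one]; ring)
    (by simp only [Cb.deg, tensorObj, one]; ring) (Cb.compId_comp_compIdInv _)
    (Cb.compIdInv_comp_compId _)

theorem rightUnitor_naturality {A A' : Cob n m} (f : A ⟶ A') :
    tensorHom f (𝟙 (one m 0)) ≫ (rightUnitor A').hom = (rightUnitor A).hom ≫ f :=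
  Subtype.ext (CobHom.compId_naturality f.1)

/-- The isomorphism given by an invertible planar isotopy. -/
noncomputable def moveIso {w w' : Diag n m} {μ : Move w w'} (h : μ.Invertible) (q : ℤ) :
    (⟨q, w⟩ : Cob n m) ≅ ⟨q, w'⟩ :=
  isoOf (.move μ) (.moveInv μ) (by simp [Cb.deg]) (by simp [Cb.deg]) h.1 h.2

end Cob

/-! ### Matrices with one entry -/

section OneEntry

variable {C : Type} [Category.{0} C] [Preadditive C]

/-- The matrix all of whose entries are `f`. -/
noncomputable def constHom (I J : Type) [Fintype I] [Fintype J] {X Y : C} (f : X ⟶ Y) :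
    (⟨I, fun _ => X⟩ : Mat_ C) ⟶ ⟨J, fun _ => Y⟩ := fun _ _ => f

theorem constHom_comp (I J K : Type) [Fintype I] [Fintype J] [Fintype K] [Subsingleton J]
    [Nonempty J] {X Y Z : C}
    (f : X ⟶ Y) (g : Y ⟶ Z) : constHom I J f ≫ constHom J K g = constHom I K (f ≫ g) := by
  ext i k
  exact Fintype.sum_subsingleton _ (Classical.arbitrary J)

theorem constHom_id (I : Type) [Fintype I] [Subsingleton I] (X : C) :
    constHom I I (𝟙 X) = 𝟙 (Mat_.mk (C := C) I fun _ => X) := by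
  ext i j
  obtain rfl : i = j := Subsingleton.elim _ _
  exact (Mat_.id_apply_self (Mat_.mk (C := C) I fun _ => X) i).symm

/-- Isomorphisms between one-entry direct sums. -/
noncomputable def constIso (I J : Type) [Fintype I] [Fintype J] [Subsingleton I]
    [Subsingleton J] [Nonempty I] [Nonempty J] {X Y : C} (e : X ≅ Y) :
    (⟨I, fun _ => X⟩ : Mat_ C) ≅ ⟨J, fun _ => Y⟩ where
  hom := constHom I J e.hom
  inv := constHom J I e.inv
  hom_inv_id := by rw [constHom_comp, e.hom_inv_id, constHom_id]
  inv_hom_id := by rw [constHom_comp, e.inv_hom_id, constHom_id]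

end OneEntry

/-- A diagram with a degree shift as a one-term direct sum. -/
noncomputable abbrev shifted (q : ℤ) (w : Diag n m) : Mat_ (Cob n m) := (Mat_.embedding _).obj ⟨q, w⟩

/-- Gluing an object on the right. -/
noncomputable abbrev tensorRight (n : ℕ) (N : Mat_ (Cob m l)) : Mat_ (Cob n m) ⥤ Mat_ (Cob n l) :=
  (matTensor n m l).flip.obj N

/-- Gluing an object on the left. -/
noncomputable abbrev tensorLeft (l : ℕ) (M : Mat_ (Cob n m)) : Mat_ (Cob m l) ⥤ Mat_ (Cob n l) :=
  (matTensor n m l).obj M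

/-- Functoriality of the embedding presents the identity of a one-term sum as a constant matrix.
Gluings of one-term sums are then again constant matrices, over index types such as `PUnit × PUnit`.
-/
theorem tensorRight_map_constHom (I J : Type) [Fintype I] [Fintype J] {A A' : Cob n m} (f : A ⟶ A')
    (B : Cob m l) : (tensorRight n ((Mat_.embedding _).obj B)).map (constHom I J f) =
      constHom (I × PUnit) (J × PUnit) (Cob.tensorHom f (𝟙 B)) :=
  (congrArg (matTensorHom (constHom I J f))
    (CategoryTheory.Functor.map_id (Mat_.embedding (Cob m l)) B)).symm

theorem tensorLeft_map_constHom (I J : Type) [Fintype I] [Fintype J] (A : Cob n m) {B B' : Cob m l}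
    (g : B ⟶ B') : (tensorLeft l ((Mat_.embedding _).obj A)).map (constHom I J g) =
      constHom (PUnit × I) (PUnit × J) (Cob.tensorHom (𝟙 A) g) :=
  (congrArg (fun f => matTensorHom f (constHom I J g))
    (CategoryTheory.Functor.map_id (Mat_.embedding (Cob n m)) A)).symm

/-- Gluing of one-term direct sums. -/
noncomputable def tensorShifted (A : Cob n m) (B : Cob m l) :
    ((matTensor n m l).obj ((Mat_.embedding _).obj A)).obj ((Mat_.embedding _).obj B) ≅
      (Mat_.embedding _).obj (Cob.tensorObj A B) :=
  constIso (PUnit × PUnit) PUnit (Iso.refl (Cob.tensorObj A B))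

end BarNatan

namespace BarNatan

variable {n m l k : ℕ}

/-! ### Associativity and unit isomorphisms on direct sums -/

/-- Gluing on the right twice. -/
noncomputable def tensorRightComp (n : ℕ) (B : Cob m l) (C : Cob l k) :
    tensorRight n ((Mat_.embedding _).obj B) ⋙ tensorRight n ((Mat_.embedding _).obj C) ≅
      tensorRight n ((Mat_.embedding _).obj (Cob.tensorObj B C)) :=
  Mat_.natIsoOfEmbedding
    (fun A => constIso ((PUnit × PUnit) × PUnit) (PUnit × PUnit) (Cob.associator A B C))
    (fun {X Y} g => by
      -- These identities turn naturality into an equation between single entries, which is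
      -- naturality of the associator.
      have h1 := tensorRight_map_constHom PUnit PUnit g B
      have h2 := tensorRight_map_constHom (PUnit × PUnit) (PUnit × PUnit)
        (Cob.tensorHom g (𝟙 B)) C
      have h3 := tensorRight_map_constHom PUnit PUnit g (Cob.tensorObj B C)
      refine (congrArg (· ≫ constHom _ _ (Cob.associator Y B C).hom)
        ((congrArg (tensorRight n ((Mat_.embedding _).obj C)).map h1).trans h2)).trans ?_
      refine Eq.trans ?_ (congrArg (constHom _ _ (Cob.associator X B C).hom ≫ ·) h3).symm
      refine (constHom_comp _ _ _ _ _).trans (Eq.trans (congrArg (constHom _ _) ?_)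
        (constHom_comp ((PUnit × PUnit) × PUnit) (PUnit × PUnit) (PUnit × PUnit) _ _).symm)
      rw [← Cob.tensorHom_id]
      exact Cob.associator_naturality g (𝟙 B) (𝟙 C))

/-- Gluing on the left twice. -/
noncomputable def tensorLeftComp (k : ℕ) (A : Cob n m) (B : Cob m l) :
    tensorLeft k ((Mat_.embedding _).obj B) ⋙ tensorLeft k ((Mat_.embedding _).obj A) ≅
      tensorLeft k ((Mat_.embedding _).obj (Cob.tensorObj A B)) :=
  Mat_.natIsoOfEmbedding
    (fun C => constIso (PUnit × PUnit × PUnit) (PUnit × PUnit) (Cob.associator A B C).symm)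
    (fun {X Y} g => by
      have h1 := tensorLeft_map_constHom PUnit PUnit B g
      have h2 := tensorLeft_map_constHom (PUnit × PUnit) (PUnit × PUnit) A
        (Cob.tensorHom (𝟙 B) g)
      have h3 := tensorLeft_map_constHom PUnit PUnit (Cob.tensorObj A B) g
      refine (congrArg (· ≫ constHom _ _ (Cob.associator A B Y).inv)
        ((congrArg (tensorLeft k ((Mat_.embedding _).obj A)).map h1).trans h2)).trans ?_
      refine Eq.trans ?_ (congrArg (constHom _ _ (Cob.associator A B X).inv ≫ ·) h3).symm
      refine (constHom_comp _ _ _ _ _).trans (Eq.trans (congrArg (constHom _ _) ?_)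
        (constHom_comp (PUnit × PUnit × PUnit) (PUnit × PUnit) (PUnit × PUnit) _ _).symm)
      refine (Iso.comp_inv_eq _).2 ?_
      rw [← Cob.tensorHom_id]
      exact ((Iso.inv_comp_eq _).2 (Cob.associator_naturality (𝟙 A) (𝟙 B) g)).symm.trans
        (Category.assoc _ _ _).symm)

/-- Gluing the identity diagram on the right. -/
noncomputable def tensorRightOne (n m : ℕ) : tensorRight n (matOne m 0) ≅ 𝟭 (Mat_ (Cob n m)) :=
  Mat_.natIsoOfEmbedding (H := 𝟭 _)
    (fun A => constIso (PUnit × PUnit) PUnit (Cob.rightUnitor A))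
    (fun {X Y} g => by
      refine (congrArg (· ≫ constHom _ _ (Cob.rightUnitor Y).hom)
        (tensorRight_map_constHom PUnit PUnit g (Cob.one m 0))).trans ?_
      exact (constHom_comp _ _ _ _ _).trans ((congrArg (constHom _ _)
        (Cob.rightUnitor_naturality g)).trans (constHom_comp _ _ _ _ _).symm))

/-- Gluing the identity diagram on the left. -/
noncomputable def tensorLeftOne (n m : ℕ) : tensorLeft m (matOne n 0) ≅ 𝟭 (Mat_ (Cob n m)) :=
  Mat_.natIsoOfEmbedding (H := 𝟭 _)
    (fun A => constIso (PUnit × PUnit) PUnit (Cob.leftUnitor A))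
    (fun {X Y} g => by
      refine (congrArg (· ≫ constHom _ _ (Cob.leftUnitor Y).hom)
        (tensorLeft_map_constHom PUnit PUnit (Cob.one n 0) g)).trans ?_
      exact (constHom_comp _ _ _ _ _).trans ((congrArg (constHom _ _)
        (Cob.leftUnitor_naturality g)).trans (constHom_comp _ _ _ _ _).symm))

/-! ### Removal of circles -/

theorem mk_eq_of_rel {w w' : Diag n m} {f g : Free w w'} (h : Rel (f - g)) : mk f = mk g :=
  (Submodule.Quotient.eq _).2 h

theorem mk_eq_zero_of_rel {w w' : Diag n m} {f : Free w w'} (h : Rel f) : mk f = 0 :=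
  (Submodule.Quotient.mk_eq_zero _).2 h

namespace Cob

theorem homOf_comp_eq_id {A B : Cob n m} {S : Cb A.diag B.diag} {T : Cb B.diag A.diag}
    (hS : S.deg = A.q - B.q) (hT : T.deg = B.q - A.q)
    (h : BarNatan.mk (of (S.comp T)) = CobHom.id A.diag) : homOf S hS ≫ homOf T hT = 𝟙 A :=
  Subtype.ext ((CobHom.comp_of S T).trans h)

theorem homOf_comp_eq_zero {A B C : Cob n m} {S : Cb A.diag B.diag} {T : Cb B.diag C.diag}
    (hS : S.deg = A.q - B.q) (hT : T.deg = B.q - C.q)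
    (h : BarNatan.mk (of (S.comp T)) = 0) : homOf S hS ≫ homOf T hT = 0 :=
  Subtype.ext ((CobHom.comp_of S T).trans h)

/-- The disk bounding a circle. -/
noncomputable def death (q : ℤ) (n : ℕ) (i : Fin (n + 1)) :
    (⟨q, circle n i⟩ : Cob n n) ⟶ one n (q - 1) :=
  homOf (.death n i) (by simp [Cb.deg, one])

/-- The dotted disk bounding a circle. -/
noncomputable def dotDeath (q : ℤ) (n : ℕ) (i : Fin (n + 1)) :
    (⟨q, circle n i⟩ : Cob n n) ⟶ one n (q + 1) :=
  homOf ((circleDot n i).comp (.death n i)) (by simp [Cb.deg, one])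

/-- The disk that creates a circle. -/
noncomputable def birth (q : ℤ) (n : ℕ) (i : Fin (n + 1)) :
    one n (q + 1) ⟶ (⟨q, circle n i⟩ : Cob n n) :=
  homOf (.birth n i) (by simp [Cb.deg, one])

/-- The dotted disk that creates a circle. -/
noncomputable def birthDot (q : ℤ) (n : ℕ) (i : Fin (n + 1)) :
    one n (q - 1) ⟶ (⟨q, circle n i⟩ : Cob n n) :=
  homOf ((Cb.birth n i).comp (circleDot n i)) (by simp [Cb.deg, one])

/-- This identity and the four after it are the axioms of a direct sum decomposition of the circle.
They are the relations for spheres with at most two dots and neck cutting; the dot supplies the dual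
pairing. -/
theorem birth_dotDeath (q : ℤ) (n : ℕ) (i : Fin (n + 1)) : birth q n i ≫ dotDeath q n i = 𝟙 _ :=
  homOf_comp_eq_id _ _ (mk_eq_of_rel (.sphereDot n i))

theorem birth_death (q : ℤ) (n : ℕ) (i : Fin (n + 1)) : birth q n i ≫ death q n i = 0 :=
  homOf_comp_eq_zero _ _ (mk_eq_zero_of_rel (.sphere n i))

theorem birthDot_death (q : ℤ) (n : ℕ) (i : Fin (n + 1)) : birthDot q n i ≫ death q n i = 𝟙 _ :=
  homOf_comp_eq_id _ _ ((mk_of_eq (Cb.assoc_sameType _ _ _) 1).trans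
    (mk_eq_of_rel (.sphereDot n i)))

theorem birthDot_dotDeath (q : ℤ) (n : ℕ) (i : Fin (n + 1)) :
    birthDot q n i ≫ dotDeath q n i = 0 :=
  homOf_comp_eq_zero _ _ ((mk_of_eq (Cb.assoc_sameType _ _ _) 1).trans
    (mk_eq_zero_of_rel (.sphereDotDot n i)))

theorem neck (q : ℤ) (n : ℕ) (i : Fin (n + 1)) :
    dotDeath q n i ≫ birth q n i + death q n i ≫ birthDot q n i = 𝟙 _ :=
  Subtype.ext ((congrArg₂ (· + ·) (CobHom.comp_of _ _) (CobHom.comp_of _ _)).trans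
    (mk_eq_of_rel (.neck n i)).symm)

end Cob

/-- An additive functor sends a direct sum decomposition to a biproduct. -/
noncomputable def mapIsoBiprod {C D : Type*} [Category* C] [Category* D] [Preadditive C]
    [Preadditive D] [HasBinaryBiproducts D] (F : C ⥤ D) [F.Additive] {X A B : C} {a : X ⟶ A}
    {b : X ⟶ B} {a' : A ⟶ X} {b' : B ⟶ X} (haa : a' ≫ a = 𝟙 A) (hbb : b' ≫ b = 𝟙 B)
    (hab : a' ≫ b = 0) (hba : b' ≫ a = 0) (h : a ≫ a' + b ≫ b' = 𝟙 X) :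
    F.obj X ≅ F.obj A ⊞ F.obj B where
  hom := biprod.lift (F.map a) (F.map b)
  inv := biprod.desc (F.map a') (F.map b')
  hom_inv_id := by
    rw [biprod.lift_desc, ← F.map_comp, ← F.map_comp, ← F.map_add, h, F.map_id]
  inv_hom_id := by
    ext <;> simp [← F.map_comp, haa, hbb, hab, hba]

/-- A circle is the sum of two shifted copies of the empty diagram. -/
noncomputable def circleIso (q : ℤ) (n : ℕ) (i : Fin (n + 1)) :
    shifted q (circle n i) ≅ matOne n (q + 1) ⊞ matOne n (q - 1) :=
  mapIsoBiprod (Mat_.embedding (Cob n n)) (Cob.birth_dotDeath q n i) (Cob.birthDot_death q n i)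
    (Cob.birth_death q n i) (Cob.birthDot_dotDeath q n i) (Cob.neck q n i)

end BarNatan

namespace BarNatan

variable {n m l k : ℕ}

/-! ### Isomorphic diagrams -/

/-- Diagrams which are isomorphic in Bar-Natan's category. -/
def Diag.Isom (a b : Diag n m) : Prop := ∀ q, Nonempty ((⟨q, a⟩ : Cob n m) ≅ ⟨q, b⟩)

/-- The tensor product of isomorphisms. -/
noncomputable def Cob.tensorIso {A A' : Cob n m} {B B' : Cob m l} (e : A ≅ A') (f : B ≅ B') :
    Cob.tensorObj A B ≅ Cob.tensorObj A' B' where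
  hom := Cob.tensorHom e.hom f.hom
  inv := Cob.tensorHom e.inv f.inv
  hom_inv_id := by rw [← Cob.tensorHom_comp, e.hom_inv_id, f.hom_inv_id, Cob.tensorHom_id]
  inv_hom_id := by rw [← Cob.tensorHom_comp, e.inv_hom_id, f.inv_hom_id, Cob.tensorHom_id]

namespace Diag.Isom

theorem refl (a : Diag n m) : a.Isom a := fun _ => ⟨Iso.refl _⟩

theorem symm {a b : Diag n m} (h : a.Isom b) : b.Isom a := fun q => (h q).map Iso.symm

theorem trans {a b c : Diag n m} (h : a.Isom b) (h' : b.Isom c) : a.Isom c := fun q =>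
  (h q).elim fun e => (h' q).map e.trans

theorem comp {a a' : Diag n m} {b b' : Diag m l} (h : a.Isom a') (h' : b.Isom b') :
    (a.comp b).Isom (a'.comp b') := fun q => by
  obtain ⟨e⟩ := h q
  obtain ⟨f⟩ := h' 0
  have := Cob.tensorIso e f
  simp only [Cob.tensorObj, add_zero] at this
  exact ⟨this⟩

theorem assoc (a : Diag n m) (b : Diag m l) (c : Diag l k) :
    ((a.comp b).comp c).Isom (a.comp (b.comp c)) := fun _ =>
  ⟨Cob.isoOf (.assoc a b c) (.assocInv a b c) (by simp [Cb.deg]) (by simp [Cb.deg])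
    (Cb.assoc_comp_assocInv _ _ _) (Cb.assocInv_comp_assoc _ _ _)⟩

theorem idComp (a : Diag n m) : ((Diag.id n).comp a).Isom a := fun _ =>
  ⟨Cob.isoOf (.idComp a) (.idCompInv a) (by simp [Cb.deg]) (by simp [Cb.deg])
    (Cb.idComp_comp_idCompInv _) (Cb.idCompInv_comp_idComp _)⟩

theorem compId (a : Diag n m) : (a.comp (Diag.id m)).Isom a := fun _ =>
  ⟨Cob.isoOf (.compId a) (.compIdInv a) (by simp [Cb.deg]) (by simp [Cb.deg])
    (Cb.compId_comp_compIdInv _) (Cb.compIdInv_comp_compId _)⟩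

theorem move {a b : Diag n m} {μ : Move a b} (h : μ.Invertible) : a.Isom b := fun q =>
  ⟨Cob.moveIso h q⟩

/-- Isomorphic diagrams give isomorphic direct sums. -/
theorem shifted {a b : Diag n m} (h : a.Isom b) (q : ℤ) :
    Nonempty (shifted q a ≅ BarNatan.shifted q b) :=
  (h q).map (Mat_.embedding _).mapIso

end Diag.Isom

theorem shifted_comp_iso (q r s : ℤ) (h : q + r = s) (a : Diag n m) (b : Diag m l) :
    Nonempty (shifted s (a.comp b) ≅ ((matTensor n m l).obj (shifted q a)).obj (shifted r b)) := by
  subst h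
  exact ⟨(tensorShifted ⟨q, a⟩ ⟨r, b⟩).symm⟩

namespace Spanned

theorem of_isom {P : Diag n m → Prop} {a b : Diag n m} (h : a.Isom b) {q : ℤ}
    (hb : Spanned P (shifted q b)) : Spanned P (shifted q a) :=
  (h.shifted q).elim fun e => hb.of_iso e

/-- Gluing with `b` is an additive functor. All shifts have to be allowed in `hb`, since the removal
of circles changes them. -/
theorem comp_right {P : Diag n m → Prop} {Q : Diag n l → Prop} {q : ℤ} {a : Diag n m}
    (ha : Spanned P (shifted q a)) (b : Diag m l)
    (hb : ∀ q w, P w → Spanned Q (shifted q (w.comp b))) : Spanned Q (shifted q (a.comp b)) := by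
  obtain ⟨e⟩ := shifted_comp_iso q 0 q (add_zero q) a b
  refine of_iso e (ha.map (tensorRight n (shifted 0 b)) fun r w hw => ?_)
  obtain ⟨e⟩ := shifted_comp_iso r 0 r (add_zero r) w b
  exact of_iso e.symm (hb r w hw)

theorem comp_left {P : Diag m l → Prop} {Q : Diag n l → Prop} {q : ℤ} {b : Diag m l}
    (hb : Spanned P (shifted q b)) (a : Diag n m)
    (ha : ∀ q w, P w → Spanned Q (shifted q (a.comp w))) : Spanned Q (shifted q (a.comp b)) := by
  obtain ⟨e⟩ := shifted_comp_iso 0 q q (zero_add q) a b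
  refine of_iso e (hb.map (tensorLeft l (shifted 0 a)) fun r w hw => ?_)
  obtain ⟨e⟩ := shifted_comp_iso 0 r r (zero_add r) a w
  exact of_iso e.symm (ha r w hw)

theorem circle (q : ℤ) (n : ℕ) (i : Fin (n + 1)) :
    Spanned (· = Diag.id n) (shifted q (BarNatan.circle n i)) :=
  of_iso (circleIso q n i) (.biprod (.of _ _ rfl) (.of _ _ rfl))

end Spanned

/-! ### Normal form -/

/-- Words in caps. -/
inductive Caps : {n m : ℕ} → Diag n m → Prop
  | id (n : ℕ) : Caps (.id n)
  | snoc {n m : ℕ} {a : Diag n (m + 2)} (h : Caps a) (i : Fin (m + 1)) : Caps (a.comp (.cap m i))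

/-- Words in cups. -/
inductive Cups : {n m : ℕ} → Diag n m → Prop
  | id (n : ℕ) : Cups (.id n)
  | snoc {n m : ℕ} {b : Diag n m} (h : Cups b) (i : Fin (m + 1)) : Cups (b.comp (.cup m i))

/-- Diagrams with all caps before all cups. -/
def IsNormal (w : Diag n m) : Prop :=
  ∃ (l : ℕ) (a : Diag n l) (b : Diag l m), w = a.comp b ∧ Caps a ∧ Cups b

theorem Spanned.normal_comp_cup {w : Diag n m} (h : IsNormal w) (q : ℤ) (i : Fin (m + 1)) :
    Spanned IsNormal (shifted q (w.comp (.cup m i))) := by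
  obtain ⟨l, a, b, rfl, ha, hb⟩ := h
  exact .of_isom (.assoc _ _ _) (.of _ _ ⟨l, a, _, rfl, ha, hb.snoc i⟩)

/-- The cases are distance zero, one, and at least two between the gaps. The third needs two further
strands, hence the transport along `m' + 2 = m`. -/
theorem cup_comp_cap (m : ℕ) (i j : Fin (m + 1)) :
    i = j ∨ ((Diag.cup m j).comp (.cap m i)).Isom (.id m) ∨
      ∃ (m' : ℕ) (h : m' + 2 = m) (i' j' : Fin (m' + 1)), ((Diag.cup m j).comp (.cap m i)).Isom
        (h ▸ (Diag.cap m' i').comp (.cup m' j')) := by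
  rcases lt_trichotomy i.1 j.1 with h | h | h
  · refine .inr ?_
    by_cases h1 : j.1 = i.1 + 1
    · obtain ⟨m, rfl⟩ : ∃ m', m = m' + 1 := ⟨m - 1, by omega⟩
      obtain ⟨i, rfl⟩ : ∃ i' : Fin (m + 1), i = i'.castSucc := ⟨⟨i.1, by omega⟩, rfl⟩
      obtain rfl : j = i.succ := Fin.ext h1
      exact .inl (.move (Move.zagzig_invertible m i))
    · obtain ⟨m, rfl⟩ : ∃ m', m = m' + 2 := ⟨m - 2, by omega⟩
      obtain ⟨i, rfl⟩ : ∃ i' : Fin (m + 1), i = i'.castSucc.castSucc := ⟨⟨i.1, by omega⟩, rfl⟩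
      obtain ⟨j, rfl⟩ : ∃ j' : Fin (m + 1), j = j'.succ.succ :=
        ⟨⟨j.1 - 2, by omega⟩, Fin.ext (by simp; omega)⟩
      simp only [Fin.val_castSucc, Fin.val_succ] at h h1
      exact .inr ⟨m, rfl, i, j, .move (Move.capCup_invertible m i j
        (Fin.le_def.2 (by omega)))⟩
  · exact .inl (Fin.ext h)
  · refine .inr ?_
    by_cases h1 : i.1 = j.1 + 1
    · obtain ⟨m, rfl⟩ : ∃ m', m = m' + 1 := ⟨m - 1, by omega⟩
      obtain ⟨j, rfl⟩ : ∃ i' : Fin (m + 1), j = i'.castSucc := ⟨⟨j.1, by omega⟩, rfl⟩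
      obtain rfl : i = j.succ := Fin.ext h1
      exact .inl (.move (Move.zigzag_invertible m j))
    · obtain ⟨m, rfl⟩ : ∃ m', m = m' + 2 := ⟨m - 2, by omega⟩
      obtain ⟨j, rfl⟩ : ∃ i' : Fin (m + 1), j = i'.castSucc.castSucc := ⟨⟨j.1, by omega⟩, rfl⟩
      obtain ⟨i, rfl⟩ : ∃ j' : Fin (m + 1), i = j'.succ.succ :=
        ⟨⟨i.1 - 2, by omega⟩, Fin.ext (by simp; omega)⟩
      simp only [Fin.val_castSucc, Fin.val_succ] at h h1
      exact .inr ⟨m, rfl, i, j, .move (Move.cupCap_invertible m j i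
        (Fin.le_def.2 (by omega)))⟩

/-- The cap is pushed towards the first line past one cup after another, by induction on the word of
cups. The middle index `k` is kept separate from `m + 2` to make this induction possible. -/
theorem Spanned.caps_comp_cups_comp_cap {a : Diag n l} (ha : Caps a) {b : Diag l k} (hb : Cups b)
    (h : k = m + 2) (q : ℤ) (i : Fin (m + 1)) :
    Spanned IsNormal (shifted q (a.comp ((h ▸ b : Diag l (m + 2)).comp (.cap m i)))) := by
  induction hb generalizing m q with
  | id =>
    subst h
    exact .of_isom ((Diag.Isom.refl a).comp (.idComp _)) (.of_isom (Diag.Isom.compId _).symm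
      (.of _ _ ⟨m, _, _, rfl, ha.snoc i, .id m⟩))
  | @snoc k b hb j ih =>
    obtain rfl : k = m := by omega
    have hab : ∀ c : Diag k k, (a.comp (b.comp c)).Isom ((a.comp b).comp c) := fun c =>
      (Diag.Isom.assoc _ _ _).symm
    have hn : IsNormal (a.comp b) := ⟨_, a, b, rfl, ha, hb⟩
    refine .of_isom (((Diag.Isom.refl a).comp (.assoc _ _ _)).trans (hab _)) ?_
    rcases cup_comp_cap k i j with rfl | h | ⟨m, rfl, i', j', h⟩
    -- The last cup and the cap close up to a circle, which is replaced by shifted identities.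
    · exact (Spanned.circle q k i).comp_left _ fun r w hw => by
        subst hw
        exact .of_isom (.compId _) (.of _ _ hn)
    · exact .of_isom (((Diag.Isom.refl _).comp h).trans (.compId _)) (.of _ _ hn)
    · refine .of_isom (((Diag.Isom.refl _).comp h).trans
        ((Diag.Isom.assoc _ _ _).symm.trans ((Diag.Isom.assoc _ _ _).comp (.refl _)))) ?_
      -- The cap now faces the shorter word `b`, where the induction hypothesis applies; the
      -- exchanged cup is appended at the end.
      exact (ih rfl q i').comp_right _ fun r w hw => .normal_comp_cup hw r j'

theorem Spanned.normal_comp {w : Diag n m} (h : IsNormal w) (v : Diag m l) (q : ℤ) :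
    Spanned IsNormal (shifted q (w.comp v)) := by
  induction v generalizing q with
  | id m => exact .of_isom (.compId _) (.of _ _ h)
  | cup m i => exact .normal_comp_cup h q i
  | cap m i =>
    obtain ⟨l, a, b, rfl, ha, hb⟩ := h
    exact .of_isom (.assoc _ _ _) (.caps_comp_cups_comp_cap ha hb rfl q i)
  | comp v v' ih ih' =>
    exact .of_isom (Diag.Isom.assoc _ _ _).symm ((ih h q).comp_right _ fun r w hw => ih' hw r)

/-- Every object is a direct sum of diagrams in normal form. -/
theorem Spanned.normal (M : Mat_ (Cob n m)) : Spanned IsNormal M :=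
  .of_forall M fun i => .of_isom (a := (M.X i).diag)
    ((Diag.Isom.idComp _).symm.trans ((Diag.Isom.idComp _).symm.comp (.refl _)))
    (.normal_comp ⟨n, _, _, rfl, .id n, .id n⟩ _ _)

end BarNatan

/-! ### Objects killed by a complex -/

section Kills

variable {A B V : Type*} [Category* A] [Category* B] [Category* V]
  [Preadditive A] [Preadditive B] [Preadditive V] {F : A ⥤ B ⥤ V} [F.Additive]
  [∀ M, (F.obj M).Additive] {K : CochainComplex A ℤ}

theorem Kills.of_isZero {M : B} (hM : IsZero M) : Kills F K M :=
  ⟨Homotopy.ofEq (by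
    rw [← colMap_id, hM.eq_of_src (𝟙 M) 0]
    ext i
    exact (F.obj (K.X i)).map_zero _ _)⟩

variable [HasZeroObject B]

/-- If the tensor product with a single object is null, then the object is killed. -/
theorem Kills.of_single {M : B}
    [HomologicalComplex.HasMapBifunctor K
      ((HomologicalComplex.single B (ComplexShape.up ℤ) 0).obj M) F (ComplexShape.up ℤ)]
    (hK : ∃ N, ∀ p < N, IsZero (K.X p))
    (h : IsNull (tot F K ((HomologicalComplex.single B (ComplexShape.up ℤ) 0).obj M))) :
    Kills F K M := by
  obtain ⟨e⟩ := tot_homotopyEquiv (F := F) hK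
    (fun q hq => HomologicalComplex.isZero_single_obj_X _ _ M q hq.ne)
    (fun q hq => Kills.of_isZero (F := F) (K := K)
      (HomologicalComplex.isZero_single_obj_X _ _ M q hq.ne'))
  exact Kills.of_iso (HomologicalComplex.singleObjXSelf (ComplexShape.up ℤ) 0 M).symm
    (h.of_homotopyEquiv e.symm)

end Kills

namespace BarNatan

variable {n m l k : ℕ}

theorem Spanned.kills {C V : Type*} [Category* C] [Category* V] [Preadditive C] [Preadditive V]
    {F : C ⥤ Mat_ (Cob n m) ⥤ V} [F.Additive] [∀ M, (F.obj M).Additive] {K : CochainComplex C ℤ}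
    {P : Diag n m → Prop} (hP : ∀ q w, P w → Kills F K (shifted q w)) {M : Mat_ (Cob n m)}
    (h : Spanned P M) : Kills F K M := by
  induction h with
  | of q w h => exact hP q w h
  | sum f e _ ih => exact .of_iso e (.biproduct f ih)

/-- Gluing with `b` is additive and so preserves null homotopies, and by associativity gluing first
`a` and then `b` is gluing their composite. -/
theorem Kills.comp_right {K : CochainComplex (Mat_ (Cob n m)) ℤ} {q r s : ℤ} {a : Diag m l}
    (h : Kills (matTensor n m l) K (shifted q a)) (hs : q + r = s) (b : Diag l k) :
    Kills (matTensor n m k) K (shifted s (a.comp b)) := by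
  subst hs
  have := IsNull.map h (tensorRight n (shifted r b))
  exact IsNull.of_natIso (tensorRightComp n ⟨q, a⟩ ⟨r, b⟩) this

theorem Kills.comp_left {K : CochainComplex (Mat_ (Cob m l)) ℤ} {q r s : ℤ} {b : Diag k m}
    (h : Kills (matTensor k m l).flip K (shifted q b)) (hs : r + q = s) (a : Diag n k) :
    Kills (matTensor n m l).flip K (shifted s (a.comp b)) := by
  subst hs
  have := IsNull.map h (tensorLeft l (shifted r a))
  exact IsNull.of_natIso (tensorLeftComp l ⟨r, a⟩ ⟨q, b⟩) this

/-- Diagrams which have a cap next to the first line. -/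
inductive StartsCap : {n m : ℕ} → Diag n m → Prop
  | cap (n : ℕ) (i : Fin (n + 1)) : StartsCap (.cap n i)
  | comp {n m l : ℕ} {a : Diag n m} (h : StartsCap a) (b : Diag m l) : StartsCap (a.comp b)
  -- Words in `Caps` begin with an identity diagram, which has to be skipped to reach the first cap.
  | id_comp {n m : ℕ} {a : Diag n m} (h : StartsCap a) : StartsCap ((Diag.id n).comp a)

/-- Diagrams which have a cup next to the second line. -/
inductive EndsCup : {n m : ℕ} → Diag n m → Prop
  | cup (n : ℕ) (i : Fin (n + 1)) : EndsCup (.cup n i)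
  | comp {n m l : ℕ} (a : Diag n m) {b : Diag m l} (h : EndsCup b) : EndsCup (a.comp b)

theorem StartsCap.strand {a : Diag n m} (h : StartsCap a) : StartsCap a.strand := by
  induction h with
  | cap n i => exact .cap _ _
  | comp _ b ih => exact .comp ih _
  | id_comp _ ih => exact .id_comp ih

theorem EndsCup.strand {a : Diag n m} (h : EndsCup a) : EndsCup a.strand := by
  induction h with
  | cup n i => exact .cup _ _
  | comp a _ ih => exact .comp _ ih

theorem map_birth_dotDeath {D : Type*} [Category* D] (G : Mat_ (Cob n n) ⥤ D) (q : ℤ)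
    (i : Fin (n + 1)) : G.map ((Mat_.embedding _).map (Cob.birth q n i)) ≫
      G.map ((Mat_.embedding _).map (Cob.dotDeath q n i)) = 𝟙 (G.obj (matOne n (q + 1))) := by
  rw [← G.map_comp, ← Functor.map_comp, Cob.birth_dotDeath]
  exact (congrArg G.map (CategoryTheory.Functor.map_id _ _)).trans (G.map_id _)

/-- Cap, cup, cap in the same gap is the cap followed by a circle, and it is killed because it
begins with the generator. The circle with shift `q - 1` has the identity with shift `q` as a
retract, by birth and dotted death; hence the cap with shift `q` is a retract of a killed object. -/
theorem kills_cap {K : CochainComplex (Mat_ (Cob n (m + 2))) ℤ} (i : Fin (m + 1))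
    (h : Kills (matTensor n (m + 2) (m + 2)) K (shifted 0 ((Diag.cap m i).comp (.cup m i))))
    (q : ℤ) : Kills (matTensor n (m + 2) m) K (shifted q (.cap m i)) := by
  have h := Kills.comp_right h (zero_add (q - 1)) (.cap m i)
  obtain ⟨e⟩ := (Diag.Isom.assoc (.cap m i) (.cup m i) (.cap m i)).shifted (q - 1)
  obtain ⟨e'⟩ := shifted_comp_iso 0 (q - 1) (q - 1) (zero_add _) (.cap m i) (circle m i)
  obtain ⟨e''⟩ := shifted_comp_iso 0 (q - 1 + 1) q (by ring) (.cap m i) (Diag.id m)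
  obtain ⟨u⟩ := (Diag.Isom.compId (Diag.cap m i)).shifted q
  refine .of_iso (u.symm ≪≫ e'') (.of_retract
    ((tensorLeft m (shifted 0 (.cap m i))).map ((Mat_.embedding _).map (Cob.birth (q - 1) m i)))
    ((tensorLeft m (shifted 0 (.cap m i))).map ((Mat_.embedding _).map (Cob.dotDeath (q - 1) m i)))
    (map_birth_dotDeath _ _ _) (.of_iso (e'.symm ≪≫ e.symm) h))

/-- The mirror image of `kills_cap`: in cup, cap, cup the circle comes first and the generator last.
-/
theorem kills_cup {K : CochainComplex (Mat_ (Cob (m + 2) n)) ℤ} (i : Fin (m + 1))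
    (h : Kills (matTensor (m + 2) (m + 2) n).flip K
      (shifted 0 ((Diag.cap m i).comp (.cup m i)))) (q : ℤ) :
    Kills (matTensor m (m + 2) n).flip K (shifted q (.cup m i)) := by
  have h := Kills.comp_left h (add_zero (q - 1)) (.cup m i)
  obtain ⟨e⟩ := (Diag.Isom.assoc (.cup m i) (.cap m i) (.cup m i)).shifted (q - 1)
  obtain ⟨e'⟩ := shifted_comp_iso (q - 1) 0 (q - 1) (add_zero _) (circle m i) (.cup m i)
  obtain ⟨e''⟩ := shifted_comp_iso (q - 1 + 1) 0 q (by ring) (Diag.id m) (.cup m i)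
  obtain ⟨u⟩ := (Diag.Isom.idComp (Diag.cup m i)).shifted q
  refine .of_iso (u.symm ≪≫ e'') (.of_retract
    ((tensorRight m (shifted 0 (.cup m i))).map ((Mat_.embedding _).map (Cob.birth (q - 1) m i)))
    ((tensorRight m (shifted 0 (.cup m i))).map ((Mat_.embedding _).map (Cob.dotDeath (q - 1) m i)))
    (map_birth_dotDeath _ _ _) (.of_iso (e'.symm ≪≫ e) h))

theorem kills_of_startsCap {w : Diag m l} (hw : StartsCap w)
    (K : CochainComplex (Mat_ (Cob n m)) ℤ)
    (h : ∀ i, Kills (matTensor n m m) K (shifted 0 (Diag.gen m i))) (q : ℤ) :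
    Kills (matTensor n m l) K (shifted q w) := by
  induction hw with
  | cap m i => exact kills_cap i (h i) q
  | comp _ b ih => exact Kills.comp_right (ih K h) (add_zero q) b
  | @id_comp _ _ a _ ih =>
    obtain ⟨e⟩ := (Diag.Isom.idComp a).shifted q
    exact .of_iso e (ih K h)

theorem kills_of_endsCup {w : Diag l m} (hw : EndsCup w)
    (K : CochainComplex (Mat_ (Cob m n)) ℤ)
    (h : ∀ i, Kills (matTensor m m n).flip K (shifted 0 (Diag.gen m i))) (q : ℤ) :
    Kills (matTensor l m n).flip K (shifted q w) := by
  induction hw with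
  | cup m i => exact kills_cup i (h i) q
  | comp a _ ih => exact Kills.comp_left (ih K h) (zero_add q) a

/-- A complex concentrated in degree zero contributes a single column, so contractibility of the
total complex is contractibility of that column. -/
theorem kills_gen_of_contractible (C : BKom n m) (i : Fin (m - 1))
    (h : Nonempty (HomotopyEquiv (C.tensor (genComplex m i)).K 0)) :
    Kills (matTensor n m m) C.K (shifted 0 (Diag.gen m i)) := by
  obtain ⟨e⟩ := h
  have : HomologicalComplex.HasMapBifunctor C.K
      ((HomologicalComplex.single _ (ComplexShape.up ℤ) 0).obj (shifted 0 (Diag.gen m i)))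
      (matTensor n m m) (ComplexShape.up ℤ) := BKom.hasTensor C (genComplex m i)
  exact .of_single C.bdd (isNull_zero.of_homotopyEquiv e)

theorem kills_flip_gen_of_contractible (C : BKom n m) (i : Fin (n - 1))
    (h : Nonempty (HomotopyEquiv ((genComplex n i).tensor C).K 0)) :
    Kills (matTensor n n m).flip C.K (shifted 0 (Diag.gen n i)) := by
  obtain ⟨e⟩ := h
  have := BKom.hasTensor (genComplex n i) C
  -- Columns are formed by fixing the second argument. Here the generator is the first factor, so
  -- the total complex is compared with that of the flipped bifunctor.
  let u := HomologicalComplex.mapBifunctorFlipIso (genComplex n i).K C.K (matTensor n n m)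
    (ComplexShape.up ℤ)
  have : HomologicalComplex.HasMapBifunctor C.K
      ((HomologicalComplex.single _ (ComplexShape.up ℤ) 0).obj (shifted 0 (Diag.gen n i)))
      (matTensor n n m).flip (ComplexShape.up ℤ) :=
    inferInstanceAs (HomologicalComplex.HasMapBifunctor C.K (genComplex n i).K
      (matTensor n n m).flip (ComplexShape.up ℤ))
  exact .of_single C.bdd (isNull_zero.of_homotopyEquiv ((HomotopyEquiv.ofIso u).trans e))

/-! ### Summands isomorphic to the identity diagram -/

/-- Each cap lowers the number of strands by two, so the number of endpoints tells whether the word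
is trivial. -/
theorem Caps.startsCap {a : Diag n m} (h : Caps a) :
    m = n ∧ HEq a (Diag.id n) ∨ m < n ∧ StartsCap a := by
  induction h with
  | id => exact .inl ⟨rfl, HEq.rfl⟩
  | snoc h i ih =>
    rcases ih with ⟨rfl, ih⟩ | ⟨hlt, ih⟩
    · obtain rfl := eq_of_heq ih
      exact .inr ⟨by omega, .id_comp (.cap _ _)⟩
    · exact .inr ⟨by omega, .comp ih _⟩

theorem Cups.endsCup {b : Diag n m} (h : Cups b) :
    n = m ∧ HEq b (Diag.id n) ∨ n < m ∧ EndsCup b := by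
  induction h with
  | id => exact .inl ⟨rfl, HEq.rfl⟩
  | snoc h i ih =>
    refine .inr ⟨?_, .comp _ (.cup _ _)⟩
    rcases ih with ⟨rfl, ih⟩ | ⟨hlt, ih⟩ <;> omega

/-- Diagrams which have a cap next to the first line and a cup next to the second line. -/
def IsTurnback (w : Diag n m) : Prop := StartsCap w ∧ EndsCup w

/-- With `n` endpoints on both lines there are as many caps as cups. Hence there are none of either
kind, or at least one of each. -/
theorem IsNormal.isTurnback {w : Diag n n} (h : IsNormal w) :
    w = (Diag.id n).comp (.id n) ∨ IsTurnback w := by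
  obtain ⟨l, a, b, rfl, ha, hb⟩ := h
  rcases ha.startsCap with ⟨rfl, ha⟩ | ⟨hlt, ha⟩
  · rcases hb.endsCup with ⟨-, hb⟩ | ⟨hlt, -⟩
    · rw [eq_of_heq ha, eq_of_heq hb]
      exact .inl rfl
    · omega
  · rcases hb.endsCup with ⟨rfl, -⟩ | ⟨-, hb⟩
    · omega
    · exact .inr ⟨.comp ha _, .comp _ hb⟩

/-- A summand of a finite biproduct can be split off. -/
theorem exists_biproduct_iso_biprod {C : Type*} [Category* C] [Preadditive C]
    [HasFiniteBiproducts C] [HasBinaryBiproducts C] {J : Type} [Finite J] (f : J → C) (j : J) :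
    ∃ D, Nonempty (⨁ f ≅ f j ⊞ D) := by
  classical
  refine ⟨⨁ Subtype.restrict (fun i => i ≠ j) f, ⟨mapIsoBiprod (𝟭 C) (a := biproduct.π f j)
    (a' := biproduct.ι f j) (b := biproduct.toSubtype f (fun i => i ≠ j))
    (b' := biproduct.fromSubtype f (fun i => i ≠ j)) ?_ ?_ ?_ ?_ ?_⟩⟩
  · simp
  · simp
  · simp
  · ext i
    simp
  · refine (congrArg (_ + ·) (biproduct.toSubtype_fromSubtype f (fun i => i ≠ j))).trans ?_
    ext i : 1
    by_cases h : i = j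
    · subst h; simp
    · simp [h, biproduct.ι_π_ne f (Ne.symm h)]

/-- An identity among the normal forms can be split off through all nested direct sums. The first
alternative has the shape that `no_identity` excludes. -/
theorem Spanned.isTurnback {M : Mat_ (Cob n n)} (h : Spanned IsNormal M) :
    (∃ j D, Nonempty (M ≅ matOne n j ⊞ D)) ∨ Spanned IsTurnback M := by
  induction h with
  | of q w h =>
    rcases h.isTurnback with rfl | h
    · obtain ⟨e⟩ := (Diag.Isom.idComp (Diag.id n)).shifted q
      exact .inl ⟨q, 0, ⟨e ≪≫ (isoBiprodZero (isZero_zero _))⟩⟩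
    · exact .inr (.of q w h)
  | sum f e _ ih =>
    by_cases h : ∃ i j D, Nonempty (f i ≅ matOne n j ⊞ D)
    · obtain ⟨i, j, D, ⟨e'⟩⟩ := h
      obtain ⟨D', ⟨e''⟩⟩ := exists_biproduct_iso_biprod f i
      exact .inl ⟨j, D ⊞ D', ⟨e ≪≫ e'' ≪≫ biprod.mapIso e' (Iso.refl D') ≪≫
        biprod.associator _ _ _⟩⟩
    · exact .inr (.sum f e fun i => (ih i).resolve_left fun h' => h ⟨i, h'⟩)

/-! ### Projectors with additional strands -/

theorem spanned_strand {M : Mat_ (Cob n m)} (h : Spanned IsTurnback M) :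
    Spanned IsTurnback ((Cob.strand n m).mapMat_.obj M) :=
  h.map _ fun q w hw => .of q w.strand ⟨hw.1.strand, hw.2.strand⟩

end BarNatan

/-! ### Absorption of projectors -/

namespace BarNatan

variable {n m : ℕ}

/-- Complexes which consist of the identity diagram in degree zero and of diagrams that begin with a
cap and end with a cup in positive degrees. -/
structure IsProjectorLike (P : Kom n) : Prop where
  zero_of_neg : ∀ q < 0, IsZero (P.K.X q)
  zero_iso : Nonempty (P.K.X 0 ≅ matOne n 0)
  turnback : ∀ q, 0 < q → Spanned IsTurnback (P.K.X q)

/-- This keeps the features of a universal projector that pass to complexes with additional strands.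
-/
theorem IsUniversalProjector.isProjectorLike {P : Kom n} (h : IsUniversalProjector P) :
    IsProjectorLike P where
  zero_of_neg := h.zero_of_neg
  zero_iso := h.zero_iso
  turnback q hq := (Spanned.normal (P.K.X q)).isTurnback.resolve_left
    fun ⟨j, D, ⟨e⟩⟩ => (h.no_identity q hq j D).false e

theorem IsProjectorLike.strand {P : Kom n} (h : IsProjectorLike P) :
    IsProjectorLike (P.strand : Kom (n + 1)) where
  zero_of_neg q hq := Functor.map_isZero (Cob.strand n n).mapMat_ (h.zero_of_neg q hq)
  zero_iso := h.zero_iso.map (Cob.strand n n).mapMat_.mapIso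
  turnback q hq := spanned_strand (h.turnback q hq)

theorem IsProjectorLike.strands {P : Kom n} (h : IsProjectorLike P) :
    ∀ k, IsProjectorLike (P.strands k : Kom (n + k))
  | 0 => h
  | k + 1 => (h.strands k).strand

/-- A complex that is killed by the generators on the right absorbs projectors on the right. -/
theorem tensor_equivalent_left {C : Kom n} {P : Kom n} (hP : IsProjectorLike P)
    (hC : ∀ i, (C.tensor (genComplex n i)).Contractible) : (C.tensor P).Equivalent C := by
  obtain ⟨e⟩ := tot_homotopyEquiv (F := matTensor n n n) C.bdd hP.zero_of_neg
    fun q hq => (hP.turnback q hq).kills fun r w hw =>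
      kills_of_startsCap hw.1 C.K (fun i => kills_gen_of_contractible C i (hC i)) r
  -- The surviving column is `C` glued with the term of `P` in degree zero, which the right unitor
  -- identifies with `C`.
  obtain ⟨f⟩ := hP.zero_iso
  exact ⟨e.trans (HomotopyEquiv.ofIso
    ((NatIso.mapHomologicalComplex ((matTensor n n n).flip.mapIso f ≪≫ tensorRightOne n n)
      (ComplexShape.up ℤ)).app C.K))⟩

/-- A complex that is killed by the generators on the left absorbs projectors on the left. -/
theorem tensor_equivalent_right {C : Kom n} {P : Kom n} (hP : IsProjectorLike P)
    (hC : ∀ i, ((genComplex n i).tensor C).Contractible) : (P.tensor C).Equivalent C := by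
  have := BKom.hasTensor P C
  obtain ⟨e⟩ := tot_homotopyEquiv (F := (matTensor n n n).flip) C.bdd hP.zero_of_neg
    fun q hq => (hP.turnback q hq).kills fun r w hw =>
      kills_of_endsCup hw.2 C.K (fun i => kills_flip_gen_of_contractible C i (hC i)) r
  -- Flipping makes `P` the second factor, so that its terms index the columns.
  let u := HomologicalComplex.mapBifunctorFlipIso P.K C.K (matTensor n n n) (ComplexShape.up ℤ)
  obtain ⟨f⟩ := hP.zero_iso
  exact ⟨(HomotopyEquiv.ofIso u.symm).trans (e.trans (HomotopyEquiv.ofIso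
    ((NatIso.mapHomologicalComplex ((matTensor n n n).mapIso f ≪≫ tensorLeftOne n n)
      (ComplexShape.up ℤ)).app C.K)))⟩

end BarNatan

/-- The larger number of strands is written as `m + k`, so that `D.strands k` and `C` live in the
same category without transport. -/
theorem proposition3p3 (m k : ℕ) (C : BarNatan.Kom (m + k)) (D : BarNatan.Kom m)
    (hC : BarNatan.IsUniversalProjector C) (hD : BarNatan.IsUniversalProjector D) :
    (C.tensor (D.strands k)).Equivalent C ∧ C.Equivalent ((D.strands k).tensor C) :=
  have h := hD.isProjectorLike.strands k
  ⟨BarNatan.tensor_equivalent_left h hC.tensor_gen,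
    (BarNatan.tensor_equivalent_right h hC.gen_tensor).map HomotopyEquiv.symm⟩
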